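/- Let $(\bar M,\phi,\xi,\eta,g)$ be a nearly cosymplectic manifold, that is, a smooth Riemannian manifold with a smooth $(1,1)$-tensor field $\phi$, vector field $\xi$ and $1$-form $\eta$ such that $\phi^2=-I+\eta\otimes\xi$, $\phi\xi=0$, $\eta\circ\phi=0$, $\eta(\xi)=1$, $\eta(X)=g(X,\xi)$, $g(\phi X,\phi Y)=g(X,Y)-\eta(X)\eta(Y)$ and $(\bar\nabla_X\phi)Y+(\bar\nabla_Y\phi)X=0$ for all vector fields $X,Y$, where $\bar\nabla$ is the Riemannian connection of $g$. Let $(N_T,g_T)$ and $(N_\theta,g_\theta)$ be Riemannian manifolds, $f>0$ a smooth function on $N_T$, and let $M=N_T\times_f N_\theta$, i.e. $N_T\times N_\theta$ with the metric $g_T+f^2g_\theta$, be isometrically immersed in $\bar M$ as a warped product semi-slant submanifold with slant angle $\theta$: $\xi$ is tangent to the leaves $N_T\times\{b\}$; each leaf $N_T\times\{b\}$ is invariant ($\phi X$ is tangent to it for every tangent $X$); and each leaf $\{a\}\times N_\theta$ is proper slant with the same angle $\theta$ (for every tangent vector $X$ not proportional to $\xi$ the angle between $\phi X$ and the tangent space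 of the leaf is $\theta$, and the leaf is neither invariant nor anti-invariant, where anti-invariant means that $\phi X$ is normal to the leaf for every tangent $X$). Let $\dim N_\theta=2q$, let $h$ be the second fundamental form of $M$ in $\bar M$, $\|h\|^2=\sum_{i,j}g(h(e_i,e_j),h(e_i,e_j))$ for an orthonormal frame $(e_i)$ of $M$, and let $\nabla\ln f$ be the gradient of $\ln f$ on $M$. Then: (i) At every point of $M$, $$\|h\|^2\ \ge\ 4q\csc^2\theta\,\Bigl(1+\tfrac19\cos^2\theta\Bigr)\,\|\nabla\ln f\|^2 .$$ (ii) If equality holds in (i) at every point of $M$, then $N_T$ is totally geodesic in $\bar M$ (every leaf $N_T\times\{b\}$ has vanishing second fundamental form), $N_\theta$ is totally umbilical in $\bar M$ (the second fundamental form $h_a$ of every leaf $\{a\}\times N_\theta$ satisfies $h_a(Z,W)=g(Z,W)H_a$, with $H_a$ its mean curvature vector), and $M$ is minimal in $\bar M$ (its mean curvature vector vanishes). -/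

import Mathlib

open Bundle Manifold
open scoped ContDiff

noncomputable section

namespace WarpedSemiSlant

/-! ### The Riemannian connection

`M` is a smooth manifold without boundary, modelled on a finite-dimensional space `E`, with a smooth
Riemannian metric `inner ℝ` on its tangent spaces. The tangent space at `x` is identified with `E`
by the differential of the preferred chart `extChartAt 𝓘(ℝ, E) x`, so the coordinate formulas below,
evaluated at `x` in that chart, take values in the tangent space at `x`. -/

/-- The identification of the tangent space at `x` with the model space by the preferred chart
at `x` (in Mathlib, the identity map). -/
def tangentCoord {F : Type*} [NormedAddCommGroup F] [NormedSpace ℝ F]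
    {H : Type*} [TopologicalSpace H] (I : ModelWithCorners ℝ F H)
    {N : Type*} [TopologicalSpace N] [ChartedSpace H N] (x : N) : TangentSpace I x ≃L[ℝ] F :=
  ContinuousLinearEquiv.refl ℝ F

section Connection

variable {E : Type*} [NormedAddCommGroup E] [NormedSpace ℝ E]
  {M : Type*} [TopologicalSpace M] [ChartedSpace E M]

/-- The coordinate vector field `∑ wⁱ ∂ᵢ` of the preferred chart at `x`, at the point of coordinates
`y`. -/
def coordVec (x : M) (y : E) (w : E) :
    TangentSpace 𝓘(ℝ, E) ((extChartAt 𝓘(ℝ, E) x).symm y) :=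
  mfderiv 𝓘(ℝ, E) 𝓘(ℝ, E) (extChartAt 𝓘(ℝ, E) x).symm y
    ((tangentCoord 𝓘(ℝ, E) y).symm w)

/-- The coordinates, in the preferred chart at `x`, of a vector field `Y`, as a function of the
coordinates `y` of the point. -/
def coordRep (x : M) (Y : ∀ p : M, TangentSpace 𝓘(ℝ, E) p) (y : E) : E :=
  tangentCoord 𝓘(ℝ, E) _
    (mfderiv 𝓘(ℝ, E) 𝓘(ℝ, E) (extChartAt 𝓘(ℝ, E) x) ((extChartAt 𝓘(ℝ, E) x).symm y)
      (Y ((extChartAt 𝓘(ℝ, E) x).symm y)))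

variable [RiemannianBundle (fun p : M ↦ TangentSpace 𝓘(ℝ, E) p)]

/-- The metric coefficient `y ↦ g(∂_v, ∂_w)` in the preferred chart at `x`. -/
def metricCoeff (x : M) (v w : E) (y : E) : ℝ :=
  inner ℝ (coordVec x y v) (coordVec x y w)

/-- The derivative of the metric coefficient `g(∂_v, ∂_w)` in the direction `u`, at `x`. -/
def metricDeriv (x : M) (u v w : E) : ℝ :=
  fderiv ℝ (metricCoeff x v w) (extChartAt 𝓘(ℝ, E) x x) u

/-- The right-hand side of Koszul's formula for the coordinate fields `∂_v, ∂_w, ∂_z`, at `x`. -/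
def koszul (x : M) (v w z : E) : ℝ :=
  (metricDeriv x v w z + metricDeriv x w v z - metricDeriv x z v w) / 2

/-- The Christoffel symbols at `x` in the preferred chart at `x`: `christoffel x v w` is the vector
`∇_v ∂_w`, characterized by
`g(∇_v ∂_w, z) = 1/2 (v g(∂_w, ∂_z) + w g(∂_v, ∂_z) - z g(∂_v, ∂_w))`. -/
def christoffel (x : M) (v w : TangentSpace 𝓘(ℝ, E) x) : TangentSpace 𝓘(ℝ, E) x :=
  Classical.epsilon fun u : TangentSpace 𝓘(ℝ, E) x ↦ ∀ z : TangentSpace 𝓘(ℝ, E) x,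
    inner ℝ u z = koszul x (tangentCoord 𝓘(ℝ, E) x v) (tangentCoord 𝓘(ℝ, E) x w)
      (tangentCoord 𝓘(ℝ, E) x z)

/-- The covariant derivative `∇_v Y` of the Riemannian connection at `x`. -/
def covDeriv (Y : ∀ p : M, TangentSpace 𝓘(ℝ, E) p) (x : M) (v : TangentSpace 𝓘(ℝ, E) x) :
    TangentSpace 𝓘(ℝ, E) x :=
  (tangentCoord 𝓘(ℝ, E) x).symm
      (fderiv ℝ (coordRep x Y) (extChartAt 𝓘(ℝ, E) x x) (tangentCoord 𝓘(ℝ, E) x v)) +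
    christoffel x v (Y x)

end Connection

/-! ### Nearly cosymplectic structures -/

section Structures

variable (E : Type*) [NormedAddCommGroup E] [NormedSpace ℝ E]
  (M : Type*) [TopologicalSpace M] [ChartedSpace E M] [IsManifold 𝓘(ℝ, E) ∞ M]
  [RiemannianBundle (fun p : M ↦ TangentSpace 𝓘(ℝ, E) p)]

/-- An almost contact metric structure `(φ, ξ, η, g)`; `g` is the given Riemannian metric. -/
structure AlmostContactMetricStructure where
  φ : ∀ x : M, TangentSpace 𝓘(ℝ, E) x →L[ℝ] TangentSpace 𝓘(ℝ, E) x
  ξ : ∀ x : M, TangentSpace 𝓘(ℝ, E) x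
  η : ∀ x : M, TangentSpace 𝓘(ℝ, E) x →L[ℝ] ℝ
  smooth_φ : ContMDiff 𝓘(ℝ, E) (𝓘(ℝ, E).prod 𝓘(ℝ, E →L[ℝ] E)) ∞
    (fun x ↦ TotalSpace.mk' (E →L[ℝ] E)
      (E := fun x : M ↦ TangentSpace 𝓘(ℝ, E) x →L[ℝ] TangentSpace 𝓘(ℝ, E) x) x (φ x))
  smooth_ξ : ContMDiff 𝓘(ℝ, E) (𝓘(ℝ, E).prod 𝓘(ℝ, E)) ∞
    (fun x ↦ TotalSpace.mk' E (E := fun x : M ↦ TangentSpace 𝓘(ℝ, E) x) x (ξ x))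
  smooth_η : ContMDiff 𝓘(ℝ, E) (𝓘(ℝ, E).prod 𝓘(ℝ, E →L[ℝ] ℝ)) ∞
    (fun x ↦ TotalSpace.mk' (E →L[ℝ] ℝ)
      (E := fun x : M ↦ TangentSpace 𝓘(ℝ, E) x →L[ℝ] Bundle.Trivial M ℝ x) x (η x))
  φ_φ : ∀ x v, φ x (φ x v) = -v + η x v • ξ x
  φ_ξ : ∀ x, φ x (ξ x) = 0
  η_φ : ∀ x v, η x (φ x v) = 0
  η_ξ : ∀ x, η x (ξ x) = 1
  η_eq_inner : ∀ x v, η x v = inner ℝ v (ξ x)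
  inner_φ_φ : ∀ x v w, inner ℝ (φ x v) (φ x w) = inner ℝ v w - η x v * η x w

variable {E M}

/-- `(∇_X φ) Y = ∇_X (φ Y) - φ (∇_X Y)` at `x`. -/
def AlmostContactMetricStructure.covDerivPhi (S : AlmostContactMetricStructure E M)
    (X Y : ∀ p : M, TangentSpace 𝓘(ℝ, E) p) (x : M) : TangentSpace 𝓘(ℝ, E) x :=
  covDeriv (fun p ↦ S.φ p (Y p)) x (X x) - S.φ x (covDeriv Y x (X x))

/-- The structure is nearly cosymplectic: `(∇_X φ) Y + (∇_Y φ) X = 0` for all (locally defined)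
smooth vector fields `X`, `Y`. -/
def AlmostContactMetricStructure.IsNearlyCosymplectic (S : AlmostContactMetricStructure E M) :
    Prop :=
  ∀ (x : M) (X Y : ∀ p : M, TangentSpace 𝓘(ℝ, E) p),
    ContMDiffAt 𝓘(ℝ, E) (𝓘(ℝ, E).prod 𝓘(ℝ, E)) ∞
      (fun p ↦ TotalSpace.mk' E (E := fun p : M ↦ TangentSpace 𝓘(ℝ, E) p) p (X p)) x →
    ContMDiffAt 𝓘(ℝ, E) (𝓘(ℝ, E).prod 𝓘(ℝ, E)) ∞
      (fun p ↦ TotalSpace.mk' E (E := fun p : M ↦ TangentSpace 𝓘(ℝ, E) p) p (Y p)) x →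
    S.covDerivPhi X Y x + S.covDerivPhi Y X x = 0

end Structures

/-! ### Immersed submanifolds

`ι : N → M` is a smooth immersion; `N` has no boundary and carries the metric induced by `ι`. -/

section Submanifolds

variable (E : Type*) [NormedAddCommGroup E] [NormedSpace ℝ E]
  {M : Type*} [TopologicalSpace M] [ChartedSpace E M]
  [RiemannianBundle (fun p : M ↦ TangentSpace 𝓘(ℝ, E) p)]
  {F : Type*} [NormedAddCommGroup F] [NormedSpace ℝ F]
  {H : Type*} [TopologicalSpace H] (I : ModelWithCorners ℝ F H)
  {N : Type*} [TopologicalSpace N] [ChartedSpace H N]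

/-- The tangent space of the submanifold at `x`, as a subspace of the ambient tangent space. -/
def tangentImage (ι : N → M) (x : N) : Submodule ℝ (TangentSpace 𝓘(ℝ, E) (ι x)) :=
  LinearMap.range (mfderiv I 𝓘(ℝ, E) ι x).toLinearMap

/-- The induced metric. -/
def inducedInner (ι : N → M) (x : N) (v w : TangentSpace I x) : ℝ :=
  inner ℝ (mfderiv I 𝓘(ℝ, E) ι x v) (mfderiv I 𝓘(ℝ, E) ι x w)

/-- The gradient of `u : N → ℝ` for the induced metric: the vector with `g(∇u, v) = v u`. -/
def inducedGradient (ι : N → M) (u : N → ℝ) (x : N) : TangentSpace I x :=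
  Classical.epsilon fun w : TangentSpace I x ↦ ∀ v : TangentSpace I x,
    inducedInner E I ι x w v = tangentCoord 𝓘(ℝ, ℝ) (u x) (mfderiv I 𝓘(ℝ, ℝ) u x v)

/-- `‖∇u‖²` for the induced metric. -/
def gradNormSq (ι : N → M) (u : N → ℝ) (x : N) : ℝ :=
  inducedInner E I ι x (inducedGradient E I ι u x) (inducedGradient E I ι u x)

variable [FiniteDimensional ℝ E]

instance (p : M) : FiniteDimensional ℝ (TangentSpace 𝓘(ℝ, E) p) :=
  inferInstanceAs (FiniteDimensional ℝ E)

/-- The component of an ambient tangent vector tangent to the submanifold. -/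
def tangentPart (ι : N → M) (x : N) (v : TangentSpace 𝓘(ℝ, E) (ι x)) :
    TangentSpace 𝓘(ℝ, E) (ι x) :=
  (tangentImage E I ι x).starProjection v

/-- The component of an ambient tangent vector normal to the submanifold. -/
def normalPart (ι : N → M) (x : N) (v : TangentSpace 𝓘(ℝ, E) (ι x)) :
    TangentSpace 𝓘(ℝ, E) (ι x) :=
  v - tangentPart E I ι x v

/-- The ambient covariant derivative along `ι`, in the direction `v` at `x`, of the vector field
`dι(∂_w)`, where `∂_w` is the coordinate vector field of the preferred chart at `x` with value `w`:
in coordinates, with `ι` written as `u`, it is `∂_v ∂_w u + Γ(∂_v u, ∂_w u)`. -/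
def ambientDeriv (ι : N → M) (x : N) (v w : TangentSpace I x) : TangentSpace 𝓘(ℝ, E) (ι x) :=
  (tangentCoord 𝓘(ℝ, E) (ι x)).symm
      (fderiv ℝ (fderiv ℝ (writtenInExtChartAt I 𝓘(ℝ, E) x ι)) (extChartAt I x x)
        (tangentCoord I x v) (tangentCoord I x w)) +
    christoffel (ι x) (mfderiv I 𝓘(ℝ, E) ι x v) (mfderiv I 𝓘(ℝ, E) ι x w)

/-- The second fundamental form `h(v, w)`: the normal component of the ambient covariant derivative
(Gauss formula). -/
def secondFundamentalForm (ι : N → M) (x : N) (v w : TangentSpace I x) :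
    TangentSpace 𝓘(ℝ, E) (ι x) :=
  normalPart E I ι x (ambientDeriv E I ι x v w)

/-- An orthonormal frame of the tangent space of `N` at `x` for the induced metric: vectors whose
images under `dι` form an orthonormal basis of the tangent space of the submanifold. -/
def orthonormalFrame (ι : N → M) (x : N) (i : Fin (Module.finrank ℝ (tangentImage E I ι x))) :
    TangentSpace I x :=
  Classical.choose (stdOrthonormalBasis ℝ (tangentImage E I ι x) i).2

/-- `‖h‖² = ∑ᵢⱼ g(h(eᵢ, eⱼ), h(eᵢ, eⱼ))`. -/
def secondFundamentalFormNormSq (ι : N → M) (x : N) : ℝ :=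
  ∑ i, ∑ j, inner ℝ
    (secondFundamentalForm E I ι x (orthonormalFrame E I ι x i) (orthonormalFrame E I ι x j))
    (secondFundamentalForm E I ι x (orthonormalFrame E I ι x i) (orthonormalFrame E I ι x j))

/-- The mean curvature vector `H = (1/m) ∑ᵢ h(eᵢ, eᵢ)`. -/
def meanCurvature (ι : N → M) (x : N) : TangentSpace 𝓘(ℝ, E) (ι x) :=
  (1 / (Module.finrank ℝ (tangentImage E I ι x) : ℝ)) •
    ∑ i, secondFundamentalForm E I ι x (orthonormalFrame E I ι x i) (orthonormalFrame E I ι x i)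

def IsTotallyGeodesic (ι : N → M) : Prop :=
  ∀ x v w, secondFundamentalForm E I ι x v w = 0

def IsTotallyUmbilical (ι : N → M) : Prop :=
  ∀ x v w, secondFundamentalForm E I ι x v w = inducedInner E I ι x v w • meanCurvature E I ι x

def IsMinimal (ι : N → M) : Prop :=
  ∀ x, meanCurvature E I ι x = 0

variable [IsManifold 𝓘(ℝ, E) ∞ M]

/-- `φ X` is tangent to the submanifold for every tangent `X`. -/
def IsInvariant (S : AlmostContactMetricStructure E M) (ι : N → M) : Prop :=
  ∀ x, ∀ X ∈ tangentImage E I ι x, normalPart E I ι x (S.φ (ι x) X) = 0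

/-- `φ X` is normal to the submanifold for every tangent `X`. -/
def IsAntiInvariant (S : AlmostContactMetricStructure E M) (ι : N → M) : Prop :=
  ∀ x, ∀ X ∈ tangentImage E I ι x, tangentPart E I ι x (S.φ (ι x) X) = 0

/-- The submanifold is slant with slant angle `θ`: for every tangent vector `X` that is nonzero and
not proportional to `ξ`, the angle between `φ X` and the tangent space (that is, between `φ X` and
its tangential component) is `θ`. -/
def IsSlant (S : AlmostContactMetricStructure E M) (ι : N → M) (θ : ℝ) : Prop :=
  ∀ x, ∀ X ∈ tangentImage E I ι x, X ∉ Submodule.span ℝ {S.ξ (ι x)} →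
    InnerProductGeometry.angle (S.φ (ι x) X) (tangentPart E I ι x (S.φ (ι x) X)) = θ

/-- Slant, and neither invariant nor anti-invariant. -/
def IsProperSlant (S : AlmostContactMetricStructure E M) (ι : N → M) (θ : ℝ) : Prop :=
  IsSlant E I S ι θ ∧ ¬ IsInvariant E I S ι ∧ ¬ IsAntiInvariant E I S ι

end Submanifolds

/-! ### Warped product semi-slant submanifolds -/

section Warped

variable (E : Type*) [NormedAddCommGroup E] [NormedSpace ℝ E] [FiniteDimensional ℝ E]
  {M : Type*} [TopologicalSpace M] [ChartedSpace E M] [IsManifold 𝓘(ℝ, E) ∞ M]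
  [RiemannianBundle (fun p : M ↦ TangentSpace 𝓘(ℝ, E) p)]
  (E₁ : Type*) [NormedAddCommGroup E₁] [NormedSpace ℝ E₁]
  {N₁ : Type*} [TopologicalSpace N₁] [ChartedSpace E₁ N₁]
  [RiemannianBundle (fun p : N₁ ↦ TangentSpace 𝓘(ℝ, E₁) p)]
  (E₂ : Type*) [NormedAddCommGroup E₂] [NormedSpace ℝ E₂]
  {N₂ : Type*} [TopologicalSpace N₂] [ChartedSpace E₂ N₂]
  [RiemannianBundle (fun p : N₂ ↦ TangentSpace 𝓘(ℝ, E₂) p)]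

/-- `ι` is an isometric immersion of the warped product `N₁ ×_f N₂`, whose metric is
`g₁ + f² g₂` with `f > 0` a smooth function on `N₁`. -/
structure IsWarpedProductImmersion (f : N₁ → ℝ) (ι : N₁ × N₂ → M) : Prop where
  smooth_f : ContMDiff 𝓘(ℝ, E₁) 𝓘(ℝ, ℝ) ∞ f
  f_pos : ∀ a, 0 < f a
  smooth_ι : ContMDiff (𝓘(ℝ, E₁).prod 𝓘(ℝ, E₂)) 𝓘(ℝ, E) ∞ ι
  isometric : ∀ (a : N₁) (b : N₂) (v₁ w₁ : TangentSpace 𝓘(ℝ, E₁) a)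
    (v₂ w₂ : TangentSpace 𝓘(ℝ, E₂) b),
    inducedInner E (𝓘(ℝ, E₁).prod 𝓘(ℝ, E₂)) ι (a, b)
        ((tangentCoord (𝓘(ℝ, E₁).prod 𝓘(ℝ, E₂)) (a, b)).symm
          (tangentCoord 𝓘(ℝ, E₁) a v₁, tangentCoord 𝓘(ℝ, E₂) b v₂))
        ((tangentCoord (𝓘(ℝ, E₁).prod 𝓘(ℝ, E₂)) (a, b)).symm
          (tangentCoord 𝓘(ℝ, E₁) a w₁, tangentCoord 𝓘(ℝ, E₂) b w₂)) =
      inner ℝ v₁ w₁ + f a ^ 2 * inner ℝ v₂ w₂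

/-- `ι` presents `N₁ ×_f N₂` as a warped product semi-slant submanifold with slant angle `θ`: the
leaves `N₁ × {b}` are invariant and tangent to `ξ`, the leaves `{a} × N₂` are proper slant. -/
structure IsWarpedProductSemiSlant (S : AlmostContactMetricStructure E M) (f : N₁ → ℝ)
    (ι : N₁ × N₂ → M) (θ : ℝ) : Prop extends
    IsWarpedProductImmersion E E₁ E₂ f ι where
  ξ_tangent : ∀ a b, S.ξ (ι (a, b)) ∈ tangentImage E 𝓘(ℝ, E₁) (fun a' ↦ ι (a', b)) a
  invariant : ∀ b, IsInvariant E 𝓘(ℝ, E₁) S (fun a ↦ ι (a, b))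
  properSlant : ∀ a, IsProperSlant E 𝓘(ℝ, E₂) S (fun b ↦ ι (a, b)) θ

end Warped

end WarpedSemiSlant

end

/-
At each point, the metric `g₁ + f² g₂` determines the components of the ambient derivative tangent
to `M`. Near cosymplecticity makes `∇φ` totally skew, and combining this with the slant condition
gives, for `X` tangent to `N₁`, `Z` tangent to `N₂` and `T Z` the tangential part of `φ Z`,
  `⟨h(X, Z), φ Z⟩ = -(φ X ln f) |Z|²` and `⟨h(X, Z), φ T Z⟩ = ⅓ (X ln f) cos²θ |Z|²`.
The normal parts of `φ Z` and `φ T Z` are orthogonal, so Bessel's inequality bounds `|h(X, Z)|²`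
from below. Since `ξ` is of Killing type, `ξ ln f = 0`, hence `φ` preserves `‖∇ ln f‖`; summing over
an orthonormal frame counts every mixed term twice and gives the estimate. In the case of equality
the terms left out, `h(X, Y)` and `h(Z, W)`, vanish.
-/

noncomputable section

namespace WarpedSemiSlant

section Frames

variable {V : Type*} [NormedAddCommGroup V] [InnerProductSpace ℝ V]
  {F : Type*} [AddCommGroup F] [Module ℝ F]

/-- `e` is an orthonormal frame of `F` for the inner product pulled back by `D`, typically the
differential of an immersion. -/
structure IsFrame {κ : Type*} [Fintype κ] (D : F →ₗ[ℝ] V) (e : κ → F) : Prop where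
  orthonormal : Orthonormal ℝ (fun i ↦ D (e i))
  sum_inner_smul : ∀ z, ∑ j, inner ℝ (D (e j)) (D z) • e j = z

namespace IsFrame

variable {κ κ' : Type*} [Fintype κ] [Fintype κ'] {D : F →ₗ[ℝ] V} {e : κ → F} {e' : κ' → F}

theorem norm_eq_one (he : IsFrame D e) (i : κ) : ‖D (e i)‖ = 1 := he.orthonormal.1 i

theorem sum_inner_sq (he : IsFrame D e) (z : F) :
    ∑ j, inner ℝ (D (e j)) (D z) ^ 2 = ‖D z‖ ^ 2 := by
  rw [← real_inner_self_eq_norm_sq]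
  conv_rhs => enter [2]; rw [← he.sum_inner_smul z]
  simp only [map_sum, map_smul, sum_inner, real_inner_smul_left, sq]

theorem sum_apply_sq (he : IsFrame D e) {L : F →ₗ[ℝ] ℝ} {g : F}
    (hg : ∀ v, L v = inner ℝ (D g) (D v)) : ∑ i, L (e i) ^ 2 = ‖D g‖ ^ 2 := by
  simp only [hg, real_inner_comm (D (e _)) (D g), he.sum_inner_sq]

theorem exists_gradient (he : IsFrame D e) (L : F →ₗ[ℝ] ℝ) :
    ∃ g, ∀ v, inner ℝ (D g) (D v) = L v := by
  refine ⟨∑ j, L (e j) • e j, fun v ↦ ?_⟩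
  conv_rhs => rw [← he.sum_inner_smul v]
  simp only [map_sum, map_smul, sum_inner, real_inner_smul_left, smul_eq_mul, mul_comm]

theorem sum_apply_self_eq {W : Type*} [AddCommGroup W] [Module ℝ W]
    (he : IsFrame D e) (he' : IsFrame D e') (β : F →ₗ[ℝ] F →ₗ[ℝ] W) :
    ∑ i, β (e i) (e i) = ∑ j, β (e' j) (e' j) :=
  calc ∑ i, β (e i) (e i)
      = ∑ i, ∑ j, inner ℝ (D (e' j)) (D (e i)) • β (e' j) (e i) := by
        refine Finset.sum_congr rfl fun i _ ↦ ?_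
        conv_lhs => enter [1]; rw [← he'.sum_inner_smul (e i)]
        simp only [map_sum, map_smul, LinearMap.sum_apply, LinearMap.smul_apply]
    _ = ∑ j, ∑ i, inner ℝ (D (e i)) (D (e' j)) • β (e' j) (e i) := by
        rw [Finset.sum_comm]
        simp only [real_inner_comm]
    _ = ∑ j, β (e' j) (e' j) := by
        simp only [← map_smul, ← map_sum, he.sum_inner_smul]

theorem sum_sum_norm_sq_eq {W : Type*} [NormedAddCommGroup W] [InnerProductSpace ℝ W]
    (he : IsFrame D e) (he' : IsFrame D e') (h : F →ₗ[ℝ] F →ₗ[ℝ] W) :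
    ∑ i, ∑ j, ‖h (e i) (e j)‖ ^ 2 = ∑ i, ∑ j, ‖h (e' i) (e' j)‖ ^ 2 := by
  have norm_sq (A : F →ₗ[ℝ] W) : ∑ j, ‖A (e j)‖ ^ 2 = ∑ j, ‖A (e' j)‖ ^ 2 := by
    simpa using he.sum_apply_self_eq he' ((innerₗ W).compl₁₂ A A)
  calc ∑ i, ∑ j, ‖h (e i) (e j)‖ ^ 2
      = ∑ i, ∑ j, ‖h (e i) (e' j)‖ ^ 2 := Finset.sum_congr rfl fun i _ ↦ norm_sq (h (e i))
    _ = ∑ j, ∑ i, ‖h.flip (e' j) (e i)‖ ^ 2 := Finset.sum_comm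
    _ = ∑ j, ∑ i, ‖h.flip (e' j) (e' i)‖ ^ 2 :=
        Finset.sum_congr rfl fun j _ ↦ norm_sq (h.flip (e' j))
    _ = ∑ i, ∑ j, ‖h (e' i) (e' j)‖ ^ 2 := Finset.sum_comm

theorem eq_zero_of_sum_norm_sq {W : Type*} [NormedAddCommGroup W] [NormedSpace ℝ W]
    (he : IsFrame D e) (h : F →ₗ[ℝ] F →ₗ[ℝ] W) (h0 : ∑ i, ∑ j, ‖h (e i) (e j)‖ ^ 2 = 0) (x y : F) :
    h x y = 0 := by
  have h_frame (i j) : h (e i) (e j) = 0 := by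
    rw [← Fintype.sum_prod_type', Finset.sum_eq_zero_iff_of_nonneg fun _ _ ↦ sq_nonneg _] at h0
    simpa using h0 (i, j) (Finset.mem_univ _)
  rw [← he.sum_inner_smul x, ← he.sum_inner_smul y]
  simp only [map_sum, map_smul, LinearMap.sum_apply, LinearMap.smul_apply, h_frame, smul_zero,
    Finset.sum_const_zero]

theorem of_orthonormalBasis (hD : Function.Injective D)
    (b : OrthonormalBasis κ ℝ (LinearMap.range D)) (hb : ∀ i, D (e i) = b i) : IsFrame D e where
  orthonormal := by
    have hb' : (fun i ↦ D (e i)) = (LinearMap.range D).subtypeₗᵢ ∘ b := funext hb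
    rw [hb']
    exact b.orthonormal.comp_linearIsometry _
  sum_inner_smul z := hD <| by
    simpa [hb] using congrArg Subtype.val (b.sum_repr' ⟨D z, LinearMap.mem_range_self D z⟩)

theorem prod {E₁ E₂ : Type*} [AddCommGroup E₁] [Module ℝ E₁] [AddCommGroup E₂] [Module ℝ E₂]
    {D : E₁ × E₂ →ₗ[ℝ] V} (hD : ∀ x z, inner ℝ (D (x, 0)) (D (0, z)) = 0)
    {e₁ : κ → E₁} {e₂ : κ' → E₂} (h₁ : IsFrame (D ∘ₗ LinearMap.inl ℝ E₁ E₂) e₁)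
    (h₂ : IsFrame (D ∘ₗ LinearMap.inr ℝ E₁ E₂) e₂) :
    IsFrame D (Sum.elim (fun i ↦ (e₁ i, 0)) (fun j ↦ (0, e₂ j))) where
  orthonormal := by
    classical
    have h1 := orthonormal_iff_ite.mp h₁.orthonormal
    have h2 := orthonormal_iff_ite.mp h₂.orthonormal
    rw [orthonormal_iff_ite]
    rintro (i | i) (j | j)
    · simpa using h1 i j
    · simpa using hD _ _
    · simpa [real_inner_comm] using hD (e₁ j) (e₂ i)
    · simpa using h2 i j
  sum_inner_smul := by
    rintro ⟨x, z⟩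
    have hx := h₁.sum_inner_smul x
    have hz := h₂.sum_inner_smul z
    have hD' (x z) : inner ℝ (D (0, z)) (D (x, 0)) = 0 := by rw [real_inner_comm, hD]
    simp only [LinearMap.comp_apply, LinearMap.inl_apply, LinearMap.inr_apply] at hx hz
    have hxz : D (x, z) = D (x, 0) + D (0, z) := by rw [← map_add]; simp
    simp only [Fintype.sum_sum_type, Sum.elim_inl, Sum.elim_inr, hxz, inner_add_right, hD, hD',
      add_zero, zero_add]
    ext
    · simp [Prod.fst_sum, hx]
    · simp [Prod.snd_sum, hz]

end IsFrame

theorem exists_isFrame [FiniteDimensional ℝ F] {D : F →ₗ[ℝ] V} (hD : Function.Injective D) :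
    ∃ e : Fin (Module.finrank ℝ F) → F, IsFrame D e := by
  have h : Module.finrank ℝ (LinearMap.range D) = Module.finrank ℝ F :=
    LinearMap.finrank_range_of_inj hD
  let b := (stdOrthonormalBasis ℝ (LinearMap.range D)).reindex (finCongr h)
  choose e he using fun i ↦ (b i).2
  exact ⟨e, .of_orthonormalBasis hD b he⟩

end Frames

section NormalComponent

variable {V : Type*} [NormedAddCommGroup V] [InnerProductSpace ℝ V]
  {F : Type*} [AddCommGroup F] [Module ℝ F]
  (D : F →ₗ[ℝ] V) [(LinearMap.range D).HasOrthogonalProjection]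

/-- The component normal to the submanifold, whose tangent space is the range of the differential
`D` of the immersion. -/
abbrev normalComponent : V →L[ℝ] V := (LinearMap.range D)ᗮ.starProjection

/-- The second fundamental form, given the ambient covariant derivatives `B v w` of the coordinate
fields along the immersion. -/
def secondForm (B : F →ₗ[ℝ] F →ₗ[ℝ] V) : F →ₗ[ℝ] F →ₗ[ℝ] V :=
  B.compr₂ (normalComponent D).toLinearMap

theorem secondForm_apply (B : F →ₗ[ℝ] F →ₗ[ℝ] V) (v w : F) :
    secondForm D B v w = normalComponent D (B v w) := rfl

theorem inner_normalComponent_normalComponent (v w : V) :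
    inner ℝ (normalComponent D v) (normalComponent D w) = inner ℝ (normalComponent D v) w := by
  rw [← Submodule.inner_starProjection_left_eq_right,
    Submodule.starProjection_eq_self_iff.mpr (Submodule.starProjection_apply_mem _ v)]

theorem normalComponent_range (w : F) : normalComponent D (D w) = 0 := by
  rw [normalComponent, Submodule.starProjection_orthogonal_val,
    Submodule.starProjection_eq_self_iff.mpr (LinearMap.mem_range_self D w), sub_self]

variable {D} in
theorem exists_eq_of_secondForm_eq_zero {B : F →ₗ[ℝ] F →ₗ[ℝ] V} {v w : F}
    (h : secondForm D B v w = 0) : ∃ t, D t = B v w := by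
  rw [secondForm_apply, normalComponent, Submodule.starProjection_orthogonal_val, sub_eq_zero] at h
  exact LinearMap.mem_range.mp (Submodule.starProjection_eq_self_iff.mp h.symm)

variable {D} in
theorem normalComponent_eq_sub {v : V} {t : F} (h : ∀ w, inner ℝ (v - D t) (D w) = 0) :
    normalComponent D v = v - D t := by
  rw [normalComponent, Submodule.starProjection_orthogonal_val,
    ← Submodule.eq_starProjection_of_mem_of_inner_eq_zero (LinearMap.mem_range_self D t)]
  rintro _ ⟨w, rfl⟩
  exact h w

end NormalComponent

section Pointwise

variable {V : Type*} [NormedAddCommGroup V] [InnerProductSpace ℝ V]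
  {E₁ : Type*} [AddCommGroup E₁] [Module ℝ E₁] {E₂ : Type*} [AddCommGroup E₂] [Module ℝ E₂]

/-- The relations that hold at one point of an isometrically immersed warped product: `D` is the
differential of the immersion, `B v w` the ambient covariant derivative of the coordinate field `w`
in the direction `v`, and `lam` the differential of the logarithm of the warping function. The
three derivative relations come from differentiating the blocks of the metric `g₁ + f² g₂`. -/
structure WarpedPoint (D : E₁ × E₂ →ₗ[ℝ] V) (B : E₁ × E₂ →ₗ[ℝ] E₁ × E₂ →ₗ[ℝ] V)
    (lam : E₁ →ₗ[ℝ] ℝ) : Prop where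
  injective : Function.Injective D
  orthogonal : ∀ x z, inner ℝ (D (x, 0)) (D (0, z)) = 0
  symm : ∀ v w, B v w = B w v
  vertical_deriv : ∀ x z w, 2 * lam x * inner ℝ (D (0, z)) (D (0, w)) =
    inner ℝ (B (x, 0) (0, z)) (D (0, w)) + inner ℝ (D (0, z)) (B (x, 0) (0, w))
  mixed_deriv : ∀ s x z,
    inner ℝ (B s (x, 0)) (D (0, z)) + inner ℝ (D (x, 0)) (B s (0, z)) = 0
  horizontal_deriv : ∀ z x y,
    inner ℝ (B (0, z) (x, 0)) (D (y, 0)) + inner ℝ (D (x, 0)) (B (0, z) (y, 0)) = 0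

/-- `D (0, y)` is the component of `φ (D (0, z))` tangent to the second factor. -/
def IsTangentialPart (D : E₁ × E₂ →ₗ[ℝ] V) (φ : V →ₗ[ℝ] V) (z y : E₂) : Prop :=
  ∀ w, inner ℝ (φ (D (0, z))) (D (0, w)) = inner ℝ (D (0, y)) (D (0, w))

/-- A `WarpedPoint` in an almost contact metric space `(V, φ, ξ)`, whose first factor is invariant
and tangent to `ξ`, and whose second factor is slant with angle `θ` and not invariant. -/
structure SemiSlantPoint (D : E₁ × E₂ →ₗ[ℝ] V) (B : E₁ × E₂ →ₗ[ℝ] E₁ × E₂ →ₗ[ℝ] V)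
    (lam : E₁ →ₗ[ℝ] ℝ) (φ : V →ₗ[ℝ] V) (ξ : V) (θ : ℝ) : Prop extends WarpedPoint D B lam where
  skew : ∀ v w, inner ℝ (φ v) w = -inner ℝ v (φ w)
  inner_map : ∀ v w, inner ℝ (φ v) (φ w) = inner ℝ v w - inner ℝ v ξ * inner ℝ w ξ
  invariant : ∀ x, ∃ y, φ (D (x, 0)) = D (y, 0)
  reeb : ∃ x, ξ = D (x, 0)
  slant : ∀ z, ∃ y, IsTangentialPart D φ z y ∧
    ‖D (0, y)‖ ^ 2 = Real.cos θ ^ 2 * ‖D (0, z)‖ ^ 2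
  sin_ne_zero : Real.sin θ ≠ 0

/-- A `SemiSlantPoint` of a nearly cosymplectic manifold; `P u v` stands for `(∇_u φ) v`. The last
two fields come from differentiating `g(φ ∂ₓ, ∂_w) = 0` along the second factor, and the inequality
`g(φ ∂_z, ∂_y) ≤ cos² θ g(∂_z, ∂_z)`, an equality at the point, along the first factor. -/
structure NearlyCosymplecticPoint (D : E₁ × E₂ →ₗ[ℝ] V) (B : E₁ × E₂ →ₗ[ℝ] E₁ × E₂ →ₗ[ℝ] V)
    (lam : E₁ →ₗ[ℝ] ℝ) (φ : V →ₗ[ℝ] V) (ξ : V) (θ : ℝ) (P : V → V → V) : Prop extends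
    SemiSlantPoint D B lam φ ξ θ where
  killing : ∀ z, inner ℝ (B (0, z) (0, z)) ξ = 0
  nearly : ∀ u v, P u v = -P v u
  skew_covDeriv : ∀ u v w, inner ℝ (P u v) w = -inner ℝ (P u w) v
  mixed_form : ∀ z x w, inner ℝ (P (D (0, z)) (D (x, 0))) (D (0, w)) =
    inner ℝ (B (0, z) (x, 0)) (φ (D (0, w))) - inner ℝ (B (0, z) (0, w)) (φ (D (x, 0)))
  slant_deriv : ∀ x z y, IsTangentialPart D φ z y →
    inner ℝ (P (D (x, 0)) (D (0, z))) (D (0, y)) - inner ℝ (B (x, 0) (0, z)) (φ (D (0, y))) +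
      inner ℝ (B (x, 0) (0, y)) (φ (D (0, z))) =
        2 * lam x * (Real.cos θ ^ 2 * ‖D (0, z)‖ ^ 2)

variable {D : E₁ × E₂ →ₗ[ℝ] V} {B : E₁ × E₂ →ₗ[ℝ] E₁ × E₂ →ₗ[ℝ] V} {lam : E₁ →ₗ[ℝ] ℝ}
  {κ κ₁ κ₂ : Type*} [Fintype κ] [Fintype κ₁] [Fintype κ₂]
  {e : κ → E₁ × E₂} {e₁ : κ₁ → E₁} {e₂ : κ₂ → E₂}

theorem map_prodMk {W : Type*} [AddCommGroup W] [Module ℝ W] (A : E₁ × E₂ →ₗ[ℝ] W) (x : E₁)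
    (z : E₂) : A (x, z) = A (x, 0) + A (0, z) := by
  rw [← map_add, Prod.mk_add_mk, add_zero, zero_add]

namespace WarpedPoint

theorem inner_vertical_horizontal (H : WarpedPoint D B lam) (x : E₁) (z w : E₂) :
    inner ℝ (B (0, z) (0, w)) (D (x, 0)) = -(lam x * inner ℝ (D (0, z)) (D (0, w))) := by
  have h_vert := H.vertical_deriv x z w
  have h_zw := H.mixed_deriv (0, z) x w
  have h_wz := H.mixed_deriv (0, w) x z
  rw [H.symm (0, z) (x, 0)] at h_zw
  rw [H.symm (0, w) (0, z), H.symm (0, w)] at h_wz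
  rw [real_inner_comm] at h_zw h_wz ⊢
  linarith [real_inner_comm (B (x, 0) (0, z)) (D (0, w)),
    real_inner_comm (D (0, z)) (B (x, 0) (0, w))]

theorem inner_mixed_vertical (H : WarpedPoint D B lam) (x : E₁) (z w : E₂) :
    inner ℝ (B (x, 0) (0, z)) (D (0, w)) = lam x * inner ℝ (D (0, z)) (D (0, w)) := by
  have h_mixed := H.mixed_deriv (0, z) x w
  rw [H.symm (0, z) (x, 0), real_inner_comm (B (0, z) (0, w)), H.inner_vertical_horizontal]
    at h_mixed
  linarith

theorem exists_frames [FiniteDimensional ℝ E₁] [FiniteDimensional ℝ E₂] (H : WarpedPoint D B lam) :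
    ∃ (e₁ : Fin (Module.finrank ℝ E₁) → E₁) (e₂ : Fin (Module.finrank ℝ E₂) → E₂),
      IsFrame (D ∘ₗ LinearMap.inl ℝ E₁ E₂) e₁ ∧ IsFrame (D ∘ₗ LinearMap.inr ℝ E₁ E₂) e₂ := by
  obtain ⟨e₁, he₁⟩ := exists_isFrame (D := D ∘ₗ LinearMap.inl ℝ E₁ E₂)
    (H.injective.comp LinearMap.inl_injective)
  obtain ⟨e₂, he₂⟩ := exists_isFrame (D := D ∘ₗ LinearMap.inr ℝ E₁ E₂)
    (H.injective.comp LinearMap.inr_injective)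
  exact ⟨e₁, e₂, he₁, he₂⟩

theorem inner_horizontal_vertical (H : WarpedPoint D B lam) (x y : E₁) (z : E₂) :
    inner ℝ (B (x, 0) (y, 0)) (D (0, z)) = 0 := by
  have h_horiz := H.horizontal_deriv z x y
  have h_xy := H.mixed_deriv (x, 0) y z
  have h_yx := H.mixed_deriv (y, 0) x z
  rw [H.symm (0, z), H.symm (0, z)] at h_horiz
  rw [H.symm (y, 0)] at h_yx
  linarith [real_inner_comm (B (x, 0) (0, z)) (D (y, 0))]

variable [(LinearMap.range D).HasOrthogonalProjection]

theorem secondForm_symm (H : WarpedPoint D B lam) (v w : E₁ × E₂) :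
    secondForm D B v w = secondForm D B w v := by
  rw [secondForm_apply, H.symm, secondForm_apply]

theorem sum_norm_secondForm_sq (H : WarpedPoint D B lam) (he : IsFrame D e)
    (he₁ : IsFrame (D ∘ₗ LinearMap.inl ℝ E₁ E₂) e₁)
    (he₂ : IsFrame (D ∘ₗ LinearMap.inr ℝ E₁ E₂) e₂) :
    ∑ i, ∑ j, ‖secondForm D B (e i) (e j)‖ ^ 2 =
      ∑ i, ∑ j, ‖secondForm D B (e₁ i, 0) (e₁ j, 0)‖ ^ 2 +
        2 * ∑ i, ∑ j, ‖secondForm D B (e₁ i, 0) (0, e₂ j)‖ ^ 2 +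
        ∑ i, ∑ j, ‖secondForm D B (0, e₂ i) (0, e₂ j)‖ ^ 2 := by
  have h_flip : ∑ i, ∑ j, ‖secondForm D B (0, e₂ i) (e₁ j, 0)‖ ^ 2 =
      ∑ i, ∑ j, ‖secondForm D B (e₁ i, 0) (0, e₂ j)‖ ^ 2 := by
    rw [Finset.sum_comm]
    simp only [H.secondForm_symm (0, e₂ _)]
  rw [he.sum_sum_norm_sq_eq (IsFrame.prod H.orthogonal he₁ he₂)]
  simp only [Fintype.sum_sum_type, Sum.elim_inl, Sum.elim_inr, Finset.sum_add_distrib, h_flip]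
  ring

theorem sum_secondForm_self_eq_zero [FiniteDimensional ℝ E₁] [FiniteDimensional ℝ E₂]
    (H : WarpedPoint D B lam) (he : IsFrame D e)
    (h_horizontal : ∀ x y, secondForm D B (x, 0) (y, 0) = 0)
    (h_vertical : ∀ z w, secondForm D B (0, z) (0, w) = 0) :
    ∑ i, secondForm D B (e i) (e i) = 0 := by
  obtain ⟨e₁, e₂, he₁, he₂⟩ := H.exists_frames
  rw [he.sum_apply_self_eq (IsFrame.prod H.orthogonal he₁ he₂)]
  simp [h_horizontal, h_vertical]

theorem secondForm_inl_eq_zero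
    [(LinearMap.range (D ∘ₗ LinearMap.inl ℝ E₁ E₂)).HasOrthogonalProjection]
    (H : WarpedPoint D B lam) {x y : E₁} (h : secondForm D B (x, 0) (y, 0) = 0) :
    secondForm (D ∘ₗ LinearMap.inl ℝ E₁ E₂)
      (B.compl₁₂ (LinearMap.inl ℝ E₁ E₂) (LinearMap.inl ℝ E₁ E₂)) x y = 0 := by
  obtain ⟨⟨s, t⟩, h_tangent⟩ := exists_eq_of_secondForm_eq_zero h
  have h_vertical := H.inner_horizontal_vertical x y t
  rw [← h_tangent, map_prodMk D s, inner_add_left, H.orthogonal, zero_add, inner_self_eq_zero]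
    at h_vertical
  have h_range : B (x, 0) (y, 0) = D (s, 0) := by
    rw [← h_tangent, map_prodMk D s, h_vertical, add_zero]
  calc secondForm (D ∘ₗ LinearMap.inl ℝ E₁ E₂)
        (B.compl₁₂ (LinearMap.inl ℝ E₁ E₂) (LinearMap.inl ℝ E₁ E₂)) x y
      = normalComponent (D ∘ₗ LinearMap.inl ℝ E₁ E₂) (D (s, 0)) := by rw [← h_range]; rfl
    _ = 0 := normalComponent_range (D ∘ₗ LinearMap.inl ℝ E₁ E₂) s

theorem secondForm_inr_eq [(LinearMap.range (D ∘ₗ LinearMap.inr ℝ E₁ E₂)).HasOrthogonalProjection]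
    (H : WarpedPoint D B lam) {g : E₁} (hg : ∀ x, lam x = inner ℝ (D (g, 0)) (D (x, 0)))
    {z w : E₂} (h : secondForm D B (0, z) (0, w) = 0) :
    secondForm (D ∘ₗ LinearMap.inr ℝ E₁ E₂)
      (B.compl₁₂ (LinearMap.inr ℝ E₁ E₂) (LinearMap.inr ℝ E₁ E₂)) z w =
        -(inner ℝ (D (0, z)) (D (0, w)) • D (g, 0)) := by
  obtain ⟨⟨s, t⟩, h_tangent⟩ := exists_eq_of_secondForm_eq_zero h
  set c := inner ℝ (D (0, z)) (D (0, w)) with hc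
  have h_add : D (s + c • g, 0) = D (s, 0) + c • D (g, 0) := by
    rw [← map_smul, ← map_add]; simp
  have h_horizontal : D (s, 0) = -(c • D (g, 0)) := by
    have h_inner := H.inner_vertical_horizontal (s + c • g) z w
    rw [← h_tangent, map_prodMk D s, inner_add_left, real_inner_comm (D (_, 0)) (D (0, t)),
      H.orthogonal, hg, ← hc, h_add] at h_inner
    refine eq_neg_of_add_eq_zero_left (inner_self_eq_zero (𝕜 := ℝ).mp ?_)
    rw [inner_add_left, real_inner_smul_left]
    linarith
  have h_normal : normalComponent (D ∘ₗ LinearMap.inr ℝ E₁ E₂) (B (0, z) (0, w)) =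
      B (0, z) (0, w) - (D ∘ₗ LinearMap.inr ℝ E₁ E₂) t := by
    refine normalComponent_eq_sub fun v ↦ ?_
    simp only [LinearMap.comp_apply, LinearMap.inr_apply]
    rw [← h_tangent, map_prodMk D s, add_sub_cancel_right, H.orthogonal]
  calc _ = D (s, t) - D (0, t) := h_normal.trans (by rw [h_tangent]; rfl)
    _ = -(c • D (g, 0)) := by rw [map_prodMk D s, add_sub_cancel_right, h_horizontal]

theorem secondForm_horizontal_and_vertical_eq_zero (H : WarpedPoint D B lam) (he : IsFrame D e)
    (he₁ : IsFrame (D ∘ₗ LinearMap.inl ℝ E₁ E₂) e₁)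
    (he₂ : IsFrame (D ∘ₗ LinearMap.inr ℝ E₁ E₂) e₂)
    (h_le : ∑ i, ∑ j, ‖secondForm D B (e i) (e j)‖ ^ 2 ≤
      2 * ∑ i, ∑ j, ‖secondForm D B (e₁ i, 0) (0, e₂ j)‖ ^ 2) :
    (∀ x y, secondForm D B (x, 0) (y, 0) = 0) ∧ ∀ z w, secondForm D B (0, z) (0, w) = 0 := by
  rw [H.sum_norm_secondForm_sq he he₁ he₂] at h_le
  have h₁ : 0 ≤ ∑ i, ∑ j, ‖secondForm D B (e₁ i, 0) (e₁ j, 0)‖ ^ 2 := by positivity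
  have h₂ : 0 ≤ ∑ i, ∑ j, ‖secondForm D B (0, e₂ i) (0, e₂ j)‖ ^ 2 := by positivity
  exact ⟨he₁.eq_zero_of_sum_norm_sq
      ((secondForm D B).compl₁₂ (LinearMap.inl ℝ E₁ E₂) (LinearMap.inl ℝ E₁ E₂))
      (le_antisymm (by simpa using by linarith) (by simpa using h₁)),
    he₂.eq_zero_of_sum_norm_sq
      ((secondForm D B).compl₁₂ (LinearMap.inr ℝ E₁ E₂) (LinearMap.inr ℝ E₁ E₂))
      (le_antisymm (by simpa using by linarith) (by simpa using h₂))⟩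

end WarpedPoint

namespace SemiSlantPoint

variable {φ : V →ₗ[ℝ] V} {ξ : V} {θ : ℝ}

theorem inner_map_self (H : SemiSlantPoint D B lam φ ξ θ) (v : V) : inner ℝ (φ v) v = 0 := by
  linarith [H.skew v v, real_inner_comm v (φ v)]

theorem inner_map_vertical_horizontal (H : SemiSlantPoint D B lam φ ξ θ) (x : E₁) (z : E₂) :
    inner ℝ (φ (D (0, z))) (D (x, 0)) = 0 := by
  obtain ⟨y, hy⟩ := H.invariant x
  rw [H.skew, hy, real_inner_comm, H.orthogonal, neg_zero]

theorem inner_tangentialPart_self (H : SemiSlantPoint D B lam φ ξ θ) {y z : E₂}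
    (hy : IsTangentialPart D φ z y) : inner ℝ (D (0, z)) (D (0, y)) = 0 := by
  rw [real_inner_comm, ← hy z, H.inner_map_self]

theorem norm_map_vertical (H : SemiSlantPoint D B lam φ ξ θ) (z : E₂) :
    ‖φ (D (0, z))‖ ^ 2 = ‖D (0, z)‖ ^ 2 := by
  obtain ⟨x, hx⟩ := H.reeb
  rw [← real_inner_self_eq_norm_sq, H.inner_map, hx, real_inner_comm (D (x, 0)), H.orthogonal,
    mul_zero, sub_zero, real_inner_self_eq_norm_sq]

variable [(LinearMap.range D).HasOrthogonalProjection]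

theorem normalComponent_map (H : SemiSlantPoint D B lam φ ξ θ) {y z : E₂}
    (hy : IsTangentialPart D φ z y) :
    normalComponent D (φ (D (0, z))) = φ (D (0, z)) - D (0, y) := by
  refine normalComponent_eq_sub ?_
  rintro ⟨x, w⟩
  rw [map_prodMk D x, inner_add_right, inner_sub_left, inner_sub_left, hy w,
    H.inner_map_vertical_horizontal, real_inner_comm, H.orthogonal, sub_self, sub_self, add_zero]

theorem norm_normalComponent_map_sq (H : SemiSlantPoint D B lam φ ξ θ) (z : E₂) :
    ‖normalComponent D (φ (D (0, z)))‖ ^ 2 = Real.sin θ ^ 2 * ‖D (0, z)‖ ^ 2 := by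
  obtain ⟨y, hy, h_norm⟩ := H.slant z
  rw [H.normalComponent_map hy, norm_sub_sq_real, hy y, real_inner_self_eq_norm_sq,
    H.norm_map_vertical, h_norm, Real.sin_sq]
  ring

theorem inner_normalComponent_map (H : SemiSlantPoint D B lam φ ξ θ) (z w : E₂) :
    inner ℝ (normalComponent D (φ (D (0, z)))) (normalComponent D (φ (D (0, w)))) =
      Real.sin θ ^ 2 * inner ℝ (D (0, z)) (D (0, w)) := by
  have h_add := H.norm_normalComponent_map_sq (z + w)
  have h_map : D (0, z + w) = D (0, z) + D (0, w) := by rw [← map_add]; simp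
  rw [h_map, map_add, map_add, norm_add_sq_real, norm_add_sq_real,
    H.norm_normalComponent_map_sq, H.norm_normalComponent_map_sq] at h_add
  linarith

theorem inner_secondForm_mixed_map (H : SemiSlantPoint D B lam φ ξ θ) (x : E₁) (z w : E₂) :
    inner ℝ (secondForm D B (x, 0) (0, z)) (φ (D (0, w))) =
      inner ℝ (B (x, 0) (0, z)) (φ (D (0, w))) + lam x * inner ℝ (φ (D (0, z))) (D (0, w)) := by
  obtain ⟨y, hy, -⟩ := H.slant w
  have h_skew : inner ℝ (φ (D (0, z))) (D (0, w)) = -inner ℝ (D (0, z)) (D (0, y)) := by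
    rw [H.skew, real_inner_comm, hy z, real_inner_comm]
  rw [secondForm_apply, ← inner_normalComponent_normalComponent,
    Submodule.inner_starProjection_left_eq_right,
    Submodule.starProjection_eq_self_iff.mpr (Submodule.starProjection_apply_mem _ _),
    H.normalComponent_map hy, inner_sub_right, H.inner_mixed_vertical, h_skew]
  ring

end SemiSlantPoint

namespace NearlyCosymplecticPoint

variable {φ : V →ₗ[ℝ] V} {ξ : V} {θ : ℝ} {P : V → V → V}

theorem lam_eq_zero_of_reeb (H : NearlyCosymplecticPoint D B lam φ ξ θ P) {r : E₁} {z : E₂}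
    (hr : ξ = D (r, 0)) (hz : z ≠ 0) : lam r = 0 := by
  have h_killing := H.killing z
  rw [hr, H.inner_vertical_horizontal, neg_eq_zero, mul_eq_zero] at h_killing
  refine h_killing.resolve_right fun h ↦ hz ?_
  have h_eq := H.injective ((inner_self_eq_zero.mp h).trans (map_zero D).symm)
  exact congrArg Prod.snd h_eq

theorem inner_covDeriv_map_horizontal (H : NearlyCosymplecticPoint D B lam φ ξ θ P) {x x' : E₁}
    (hx : φ (D (x, 0)) = D (x', 0)) (z w : E₂) :
    inner ℝ (P (D (x, 0)) (D (0, z))) (D (0, w)) =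
      -inner ℝ (B (x, 0) (0, z)) (φ (D (0, w))) - lam x' * inner ℝ (D (0, z)) (D (0, w)) := by
  rw [H.nearly, inner_neg_left, H.mixed_form, hx, H.inner_vertical_horizontal, H.symm (0, z)]
  ring

theorem sum_lam_map_sq (H : NearlyCosymplecticPoint D B lam φ ξ θ P)
    (he₁ : IsFrame (D ∘ₗ LinearMap.inl ℝ E₁ E₂) e₁) {g : E₁}
    (hg : ∀ x, lam x = inner ℝ (D (g, 0)) (D (x, 0))) {z : E₂} (hz : z ≠ 0) {J : κ₁ → E₁}
    (hJ : ∀ i, φ (D (e₁ i, 0)) = D (J i, 0)) : ∑ i, lam (J i) ^ 2 = ‖D (g, 0)‖ ^ 2 := by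
  obtain ⟨g', hg'⟩ := H.invariant g
  obtain ⟨r, hr⟩ := H.reeb
  calc ∑ i, lam (J i) ^ 2 = ∑ i, inner ℝ (D (e₁ i, 0)) (D (g', 0)) ^ 2 := by
        refine Finset.sum_congr rfl fun i _ ↦ ?_
        rw [hg, ← hJ, real_inner_comm, H.skew, hg', neg_sq]
    _ = ‖φ (D (g, 0))‖ ^ 2 := hg' ▸ he₁.sum_inner_sq g'
    _ = ‖D (g, 0)‖ ^ 2 := by
        rw [← real_inner_self_eq_norm_sq (φ _), H.inner_map, hr, ← hg r,
          H.lam_eq_zero_of_reeb hr hz, mul_zero, sub_zero, real_inner_self_eq_norm_sq]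

variable [(LinearMap.range D).HasOrthogonalProjection]

theorem inner_secondForm_mixed_map_self (H : NearlyCosymplecticPoint D B lam φ ξ θ P) {x x' : E₁}
    (hx : φ (D (x, 0)) = D (x', 0)) (z : E₂) :
    inner ℝ (secondForm D B (x, 0) (0, z)) (φ (D (0, z))) = -lam x' * ‖D (0, z)‖ ^ 2 := by
  have h_form := H.inner_covDeriv_map_horizontal hx z z
  rw [self_eq_neg.mp (H.skew_covDeriv (D (x, 0)) (D (0, z)) (D (0, z))),
    real_inner_self_eq_norm_sq] at h_form
  rw [H.inner_secondForm_mixed_map, H.inner_map_self]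
  linarith

theorem inner_secondForm_mixed_map_tangentialPart (H : NearlyCosymplecticPoint D B lam φ ξ θ P)
    (x : E₁) {y z : E₂} (hy : IsTangentialPart D φ z y)
    (h_norm : ‖D (0, y)‖ ^ 2 = Real.cos θ ^ 2 * ‖D (0, z)‖ ^ 2) :
    inner ℝ (secondForm D B (x, 0) (0, z)) (φ (D (0, y))) =
      lam x / 3 * (Real.cos θ ^ 2 * ‖D (0, z)‖ ^ 2) := by
  obtain ⟨x', hx⟩ := H.invariant x
  have h_zy := H.inner_covDeriv_map_horizontal hx z y
  have h_yz := H.inner_covDeriv_map_horizontal hx y z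
  rw [H.inner_tangentialPart_self hy] at h_zy
  rw [real_inner_comm, real_inner_comm (D (0, z)) (D (0, y)), H.inner_tangentialPart_self hy,
    real_inner_comm, H.skew_covDeriv] at h_yz
  -- By the total skewness of `g((∇_u φ) v, w)` the three terms of `slant_deriv` are equal.
  have h_deriv := H.slant_deriv x z y hy
  rw [H.inner_secondForm_mixed_map, hy y, real_inner_self_eq_norm_sq, h_norm]
  linarith

/-- Bessel's inequality for `h(x, z)` and the orthogonal normal components of `φ z` and `φ y`, where
`y` is the tangential part of `φ z`. -/
theorem le_norm_secondForm_mixed_sq (H : NearlyCosymplecticPoint D B lam φ ξ θ P) {x x' : E₁}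
    (hx : φ (D (x, 0)) = D (x', 0)) (z : E₂) :
    (lam x' ^ 2 + 1 / 9 * Real.cos θ ^ 2 * lam x ^ 2) * ‖D (0, z)‖ ^ 2 ≤
      Real.sin θ ^ 2 * ‖secondForm D B (x, 0) (0, z)‖ ^ 2 := by
  obtain ⟨y, hy, h_norm⟩ := H.slant z
  set h := secondForm D B (x, 0) (0, z) with hh
  set n := normalComponent D (φ (D (0, z)))
  set m := normalComponent D (φ (D (0, y)))
  have h_n : inner ℝ h n = -lam x' * ‖D (0, z)‖ ^ 2 := by
    rw [← H.inner_secondForm_mixed_map_self hx, hh, secondForm_apply,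
      inner_normalComponent_normalComponent]
  have h_m : inner ℝ h m = lam x / 3 * (Real.cos θ ^ 2 * ‖D (0, z)‖ ^ 2) := by
    rw [← H.inner_secondForm_mixed_map_tangentialPart x hy h_norm, hh, secondForm_apply,
      inner_normalComponent_normalComponent]
  have h_nm : inner ℝ n m = 0 := by
    rw [H.inner_normalComponent_map, H.inner_tangentialPart_self hy, mul_zero]
  have h_expand : ‖Real.sin θ ^ 2 • h + lam x' • n - (lam x / 3) • m‖ ^ 2 =
      Real.sin θ ^ 2 * (Real.sin θ ^ 2 * ‖h‖ ^ 2 -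
        (lam x' ^ 2 + 1 / 9 * Real.cos θ ^ 2 * lam x ^ 2) * ‖D (0, z)‖ ^ 2) := by
    simp only [norm_sub_sq_real, norm_add_sq_real, inner_add_left, real_inner_smul_left,
      real_inner_smul_right, norm_smul, mul_pow, Real.norm_eq_abs, sq_abs, h_n, h_m, h_nm,
      H.norm_normalComponent_map_sq z, H.norm_normalComponent_map_sq y, h_norm, n, m]
    ring
  have h_sin : 0 < Real.sin θ ^ 2 := sq_pos_of_ne_zero H.sin_ne_zero
  exact sub_nonneg.mp (nonneg_of_mul_nonneg_right (h_expand ▸ sq_nonneg _) h_sin)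

theorem le_sum_norm_secondForm_mixed_sq (H : NearlyCosymplecticPoint D B lam φ ξ θ P)
    (he₁ : IsFrame (D ∘ₗ LinearMap.inl ℝ E₁ E₂) e₁)
    (he₂ : IsFrame (D ∘ₗ LinearMap.inr ℝ E₁ E₂) e₂) {g : E₁}
    (hg : ∀ x, lam x = inner ℝ (D (g, 0)) (D (x, 0))) :
    Fintype.card κ₂ * (1 / Real.sin θ) ^ 2 * (1 + 1 / 9 * Real.cos θ ^ 2) * ‖D (g, 0)‖ ^ 2 ≤
      ∑ i, ∑ j, ‖secondForm D B (e₁ i, 0) (0, e₂ j)‖ ^ 2 := by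
  rcases isEmpty_or_nonempty κ₂ with _ | ⟨⟨k⟩⟩
  · simp
  have hz : e₂ k ≠ 0 := fun h ↦ he₂.orthonormal.ne_zero k (by rw [h, map_zero])
  choose J hJ using fun i ↦ H.invariant (e₁ i)
  have h_le (i j) : (1 / Real.sin θ) ^ 2 *
      (lam (J i) ^ 2 + 1 / 9 * Real.cos θ ^ 2 * lam (e₁ i) ^ 2) ≤
        ‖secondForm D B (e₁ i, 0) (0, e₂ j)‖ ^ 2 := by
    have h_unit : ‖D (0, e₂ j)‖ = 1 := he₂.norm_eq_one j
    have h_bessel := H.le_norm_secondForm_mixed_sq (hJ i) (e₂ j)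
    rw [h_unit, one_pow, mul_one] at h_bessel
    rw [div_pow, one_pow, one_div_mul_eq_div]
    exact (div_le_iff₀' (sq_pos_of_ne_zero H.sin_ne_zero)).mpr h_bessel
  have h_sum : ∑ i, lam (e₁ i) ^ 2 = ‖D (g, 0)‖ ^ 2 := he₁.sum_apply_sq hg
  refine le_of_eq_of_le ?_ (Finset.sum_le_sum fun i _ ↦ Finset.sum_le_sum fun j _ ↦ h_le i j)
  simp only [Finset.sum_const, Finset.card_univ, nsmul_eq_mul, ← Finset.mul_sum,
    Finset.sum_add_distrib, h_sum, H.sum_lam_map_sq he₁ hg hz hJ]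
  ring

variable [FiniteDimensional ℝ E₁] [FiniteDimensional ℝ E₂]

theorem le_sum_norm_secondForm_sq (H : NearlyCosymplecticPoint D B lam φ ξ θ P) (he : IsFrame D e)
    {g : E₁} (hg : ∀ x, lam x = inner ℝ (D (g, 0)) (D (x, 0))) :
    2 * Module.finrank ℝ E₂ * (1 / Real.sin θ) ^ 2 * (1 + 1 / 9 * Real.cos θ ^ 2) *
      ‖D (g, 0)‖ ^ 2 ≤ ∑ i, ∑ j, ‖secondForm D B (e i) (e j)‖ ^ 2 := by
  obtain ⟨e₁, e₂, he₁, he₂⟩ := H.exists_frames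
  have h_mixed := H.le_sum_norm_secondForm_mixed_sq he₁ he₂ hg
  rw [Fintype.card_fin] at h_mixed
  have h₁ : 0 ≤ ∑ i, ∑ j, ‖secondForm D B (e₁ i, 0) (e₁ j, 0)‖ ^ 2 := by positivity
  have h₂ : 0 ≤ ∑ i, ∑ j, ‖secondForm D B (0, e₂ i) (0, e₂ j)‖ ^ 2 := by positivity
  rw [H.sum_norm_secondForm_sq he he₁ he₂]
  linarith

theorem secondForm_eq_zero_of_sum_norm_sq_eq (H : NearlyCosymplecticPoint D B lam φ ξ θ P)
    (he : IsFrame D e) {g : E₁} (hg : ∀ x, lam x = inner ℝ (D (g, 0)) (D (x, 0)))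
    (h_eq : ∑ i, ∑ j, ‖secondForm D B (e i) (e j)‖ ^ 2 = 2 * Module.finrank ℝ E₂ *
      (1 / Real.sin θ) ^ 2 * (1 + 1 / 9 * Real.cos θ ^ 2) * ‖D (g, 0)‖ ^ 2) :
    (∀ x y, secondForm D B (x, 0) (y, 0) = 0) ∧ ∀ z w, secondForm D B (0, z) (0, w) = 0 := by
  obtain ⟨e₁, e₂, he₁, he₂⟩ := H.exists_frames
  have h_mixed := H.le_sum_norm_secondForm_mixed_sq he₁ he₂ hg
  rw [Fintype.card_fin] at h_mixed
  exact H.secondForm_horizontal_and_vertical_eq_zero he he₁ he₂ (by linarith)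

end NearlyCosymplecticPoint

end Pointwise

section RiemannianChart

open Filter Topology

variable {E : Type*} [NormedAddCommGroup E] [NormedSpace ℝ E]
  {F : Type*} [NormedAddCommGroup F] [NormedSpace ℝ F]

-- Without these two shortcuts the search for the norm on bilinear forms times out.
instance bilinNormedAddCommGroup : NormedAddCommGroup (E →L[ℝ] E →L[ℝ] ℝ) :=
  ContinuousLinearMap.toNormedAddCommGroup

instance bilinNormedSpace : NormedSpace ℝ (E →L[ℝ] E →L[ℝ] ℝ) :=
  ContinuousLinearMap.toNormedSpace

/-- The covariant derivative `∇_s W` of a vector field `W` along `u`, where the Christoffel symbols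
at `u x₀` are `Γ`. -/
def covDerivAlong (Γ : E → E → E) (u W : F → E) (x₀ s : F) : E :=
  fderiv ℝ W x₀ s + Γ (fderiv ℝ u x₀ s) (W x₀)

/-- The covariant derivative `∇_v ∂_w` along `u` of the coordinate field `∂_w u`. -/
def alongDeriv (u : F → E) (Γ : E → E → E) (x₀ v w : F) : E :=
  fderiv ℝ (fderiv ℝ u) x₀ v w + Γ (fderiv ℝ u x₀ v) (fderiv ℝ u x₀ w)

/-- `(∇_v Φ) w` for a field of endomorphisms `Φ`, where the Christoffel symbols at `y₀` are `Γ`. -/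
def covDerivEnd (y₀ : E) (Φ : E → E →L[ℝ] E) (Γ : E → E → E) (v w : E) : E :=
  fderiv ℝ Φ y₀ v w + Γ v (Φ y₀ w) - Φ y₀ (Γ v w)

/-- A Riemannian metric `G` on an open set of `E` containing `y₀`, with Christoffel symbols `Γ`
at `y₀`. -/
structure RiemannianChart (y₀ : E) (G : E → E →L[ℝ] E →L[ℝ] ℝ) (Γ : E → E → E) : Prop where
  differentiableAt_metric : DifferentiableAt ℝ G y₀
  symm : ∀ᶠ y in 𝓝 y₀, ∀ v w, G y v w = G y w v
  pos : ∀ v, v ≠ 0 → 0 < G y₀ v v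
  koszul : ∀ v w z, G y₀ (Γ v w) z =
    (fderiv ℝ G y₀ v w z + fderiv ℝ G y₀ w v z - fderiv ℝ G y₀ z v w) / 2

variable {Γ : E → E → E} {u W W₁ W₂ : F → E} {x₀ : F}

theorem fderiv_apply_apply {G : E → E →L[ℝ] E →L[ℝ] ℝ} {y₀ : E} (hG : DifferentiableAt ℝ G y₀)
    (s v w : E) : fderiv ℝ (fun y ↦ G y v w) y₀ s = fderiv ℝ G y₀ s v w := by
  have h := (hG.hasFDerivAt.clm_apply (hasFDerivAt_const v y₀)).clm_apply (hasFDerivAt_const w y₀)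
  simp [h.fderiv]

theorem differentiableAt_fderiv_apply (hu : ContDiffAt ℝ 2 u x₀) (w : F) :
    DifferentiableAt ℝ (fun x ↦ fderiv ℝ u x w) x₀ :=
  ((hu.fderiv_right (m := 1) (by norm_num)).differentiableAt one_ne_zero).clm_apply
    (differentiableAt_const w)

theorem covDerivAlong_fderiv (hu : ContDiffAt ℝ 2 u x₀) (v w : F) :
    covDerivAlong Γ u (fun x ↦ fderiv ℝ u x w) x₀ v = alongDeriv u Γ x₀ v w := by
  have h := (hu.fderiv_right (m := 1) (by norm_num)).differentiableAt one_ne_zero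
  rw [covDerivAlong, fderiv_clm_apply h (differentiableAt_const w)]
  simp [alongDeriv]

theorem covDerivAlong_id_const (v y s : E) :
    covDerivAlong Γ (fun y ↦ y) (fun _ ↦ v) y s = Γ s v := by
  simp [covDerivAlong]

theorem covDerivAlong_map {Φ : E → E →L[ℝ] E} (hΦ : DifferentiableAt ℝ Φ (u x₀))
    (hu : DifferentiableAt ℝ u x₀) (hW : DifferentiableAt ℝ W x₀) (s : F) :
    covDerivAlong Γ u (fun x ↦ Φ (u x) (W x)) x₀ s =
      covDerivEnd (u x₀) Φ Γ (fderiv ℝ u x₀ s) (W x₀) + Φ (u x₀) (covDerivAlong Γ u W x₀ s) := by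
  have h := (hΦ.hasFDerivAt.comp x₀ hu.hasFDerivAt).clm_apply hW.hasFDerivAt
  rw [covDerivAlong, show fderiv ℝ (fun x ↦ Φ (u x) (W x)) x₀ = _ from h.fderiv]
  simp only [covDerivAlong, covDerivEnd, Function.comp_apply, add_apply, map_add,
    ContinuousLinearMap.comp_apply, ContinuousLinearMap.flip_apply]
  abel

namespace RiemannianChart

variable {y₀ : E} {G : E → E →L[ℝ] E →L[ℝ] ℝ}

theorem symm_at (C : RiemannianChart y₀ G Γ) (v w : E) : G y₀ v w = G y₀ w v :=
  C.symm.self_of_nhds v w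

theorem nonneg (C : RiemannianChart y₀ G Γ) (v : E) : 0 ≤ G y₀ v v := by
  rcases eq_or_ne v 0 with rfl | hv
  · simp
  · exact (C.pos v hv).le

theorem metric_ext (C : RiemannianChart y₀ G Γ) {v w : E} (h : ∀ z, G y₀ v z = G y₀ w z) :
    v = w := by
  by_contra h_ne
  exact (C.pos (v - w) (sub_ne_zero.mpr h_ne)).ne' (by
    rw [map_sub (G y₀), sub_apply, h, sub_self])

theorem fderiv_metric_symm (C : RiemannianChart y₀ G Γ) (s v w : E) :
    fderiv ℝ G y₀ s v w = fderiv ℝ G y₀ s w v := by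
  have h_symm : (fun y ↦ G y v w) =ᶠ[𝓝 y₀] fun y ↦ G y w v := C.symm.mono fun y hy ↦ hy v w
  have hG := C.differentiableAt_metric
  rw [← fderiv_apply_apply hG, ← fderiv_apply_apply hG, h_symm.fderiv_eq]

theorem fderiv_metric (C : RiemannianChart y₀ G Γ) (s v w : E) :
    fderiv ℝ G y₀ s v w = G y₀ (Γ s v) w + G y₀ v (Γ s w) := by
  rw [C.symm_at v, C.koszul, C.koszul, C.fderiv_metric_symm s w v, C.fderiv_metric_symm v s w,
    C.fderiv_metric_symm w s v]
  ring

theorem christoffel_symm (C : RiemannianChart y₀ G Γ) (v w : E) : Γ v w = Γ w v :=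
  C.metric_ext fun z ↦ by
    rw [C.koszul, C.koszul, C.fderiv_metric_symm z v w]
    ring

theorem christoffel_add (C : RiemannianChart y₀ G Γ) (v w w' : E) :
    Γ v (w + w') = Γ v w + Γ v w' :=
  C.metric_ext fun z ↦ by
    simp only [C.koszul, map_add, add_apply]
    ring

theorem christoffel_smul (C : RiemannianChart y₀ G Γ) (v w : E) (c : ℝ) :
    Γ v (c • w) = c • Γ v w :=
  C.metric_ext fun z ↦ by
    simp only [C.koszul, map_smul, smul_apply, smul_eq_mul]
    ring

theorem alongDeriv_symm (C : RiemannianChart y₀ G Γ) (hu : ContDiffAt ℝ 2 u x₀) (v w : F) :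
    alongDeriv u Γ x₀ v w = alongDeriv u Γ x₀ w v := by
  rw [alongDeriv, alongDeriv, hu.isSymmSndFDerivAt (by simp) v w, C.christoffel_symm]

theorem alongDeriv_add (C : RiemannianChart y₀ G Γ) (v w w' : F) :
    alongDeriv u Γ x₀ v (w + w') = alongDeriv u Γ x₀ v w + alongDeriv u Γ x₀ v w' := by
  simp only [alongDeriv, map_add, C.christoffel_add]
  abel

theorem alongDeriv_smul (C : RiemannianChart y₀ G Γ) (v w : F) (c : ℝ) :
    alongDeriv u Γ x₀ v (c • w) = c • alongDeriv u Γ x₀ v w := by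
  simp only [alongDeriv, map_smul, C.christoffel_smul, smul_add]

theorem differentiableAt_metric_along (C : RiemannianChart (u x₀) G Γ)
    (hu : DifferentiableAt ℝ u x₀) (h₁ : DifferentiableAt ℝ W₁ x₀)
    (h₂ : DifferentiableAt ℝ W₂ x₀) :
    DifferentiableAt ℝ (fun x ↦ G (u x) (W₁ x) (W₂ x)) x₀ :=
  ((C.differentiableAt_metric.comp x₀ hu).clm_apply h₁).clm_apply h₂

theorem fderiv_metric_along (C : RiemannianChart (u x₀) G Γ) (hu : DifferentiableAt ℝ u x₀)
    (h₁ : DifferentiableAt ℝ W₁ x₀) (h₂ : DifferentiableAt ℝ W₂ x₀) (s : F) :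
    fderiv ℝ (fun x ↦ G (u x) (W₁ x) (W₂ x)) x₀ s =
      G (u x₀) (covDerivAlong Γ u W₁ x₀ s) (W₂ x₀) +
        G (u x₀) (W₁ x₀) (covDerivAlong Γ u W₂ x₀ s) := by
  have h := ((C.differentiableAt_metric.hasFDerivAt.comp x₀ hu.hasFDerivAt).clm_apply
    h₁.hasFDerivAt).clm_apply h₂.hasFDerivAt
  rw [show fderiv ℝ (fun x ↦ G (u x) (W₁ x) (W₂ x)) x₀ = _ from h.fderiv]
  simp only [covDerivAlong, Function.comp_apply, add_apply, ContinuousLinearMap.comp_apply,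
    ContinuousLinearMap.flip_apply, C.fderiv_metric, map_add]
  ring

theorem fderiv_metric_fderiv (C : RiemannianChart (u x₀) G Γ) (hu : ContDiffAt ℝ 2 u x₀)
    (s v w : F) :
    fderiv ℝ (fun x ↦ G (u x) (fderiv ℝ u x v) (fderiv ℝ u x w)) x₀ s =
      G (u x₀) (alongDeriv u Γ x₀ s v) (fderiv ℝ u x₀ w) +
        G (u x₀) (fderiv ℝ u x₀ v) (alongDeriv u Γ x₀ s w) := by
  rw [C.fderiv_metric_along (hu.differentiableAt two_ne_zero) (differentiableAt_fderiv_apply hu v)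
    (differentiableAt_fderiv_apply hu w), covDerivAlong_fderiv hu, covDerivAlong_fderiv hu]

end RiemannianChart

/-- A nearly cosymplectic structure `(Φ, Ξ)` on an open set of `E` containing `y₀`, with
metric `G`. -/
structure NearlyCosymplecticChart (y₀ : E) (G : E → E →L[ℝ] E →L[ℝ] ℝ) (Φ : E → E →L[ℝ] E)
    (Ξ : E → E) (Γ : E → E → E) : Prop extends RiemannianChart y₀ G Γ where
  differentiableAt_map : DifferentiableAt ℝ Φ y₀
  differentiableAt_reeb : DifferentiableAt ℝ Ξ y₀
  skew : ∀ᶠ y in 𝓝 y₀, ∀ v w, G y (Φ y v) w = -G y v (Φ y w)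
  metric_map : ∀ᶠ y in 𝓝 y₀, ∀ v w,
    G y (Φ y v) (Φ y w) = G y v w - G y v (Ξ y) * G y w (Ξ y)
  map_reeb : ∀ᶠ y in 𝓝 y₀, Φ y (Ξ y) = 0
  nearly : ∀ v w, covDerivEnd y₀ Φ Γ v w + covDerivEnd y₀ Φ Γ w v = 0

namespace NearlyCosymplecticChart

variable {y₀ : E} {G : E → E →L[ℝ] E →L[ℝ] ℝ} {Φ : E → E →L[ℝ] E} {Ξ : E → E}

theorem skew_at (C : NearlyCosymplecticChart y₀ G Φ Ξ Γ) (v w : E) :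
    G y₀ (Φ y₀ v) w = -G y₀ v (Φ y₀ w) :=
  C.skew.self_of_nhds v w

theorem differentiableAt_map_apply (C : NearlyCosymplecticChart y₀ G Φ Ξ Γ) (v : E) :
    DifferentiableAt ℝ (fun y ↦ Φ y v) y₀ :=
  C.differentiableAt_map.clm_apply (differentiableAt_const v)

theorem covDerivAlong_map_const (C : NearlyCosymplecticChart y₀ G Φ Ξ Γ) (s v : E) :
    covDerivAlong Γ (fun y ↦ y) (fun y ↦ Φ y v) y₀ s =
      covDerivEnd y₀ Φ Γ s v + Φ y₀ (Γ s v) := by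
  rw [covDerivAlong_map (u := fun y ↦ y) C.differentiableAt_map differentiableAt_fun_id
    (differentiableAt_const v), covDerivAlong_id_const]
  simp

theorem covDerivEnd_skew (C : NearlyCosymplecticChart y₀ G Φ Ξ Γ) (s v w : E) :
    G y₀ (covDerivEnd y₀ Φ Γ s v) w = -G y₀ (covDerivEnd y₀ Φ Γ s w) v := by
  have h_left := C.fderiv_metric_along (u := fun y ↦ y) differentiableAt_fun_id
    (C.differentiableAt_map_apply v) (differentiableAt_const w) s
  have h_right := C.fderiv_metric_along (u := fun y ↦ y) differentiableAt_fun_id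
    (differentiableAt_const v) (C.differentiableAt_map_apply w) s
  have h_skew : (fun y ↦ G y (Φ y v) w) =ᶠ[𝓝 y₀] fun y ↦ -G y v (Φ y w) :=
    C.skew.mono fun y hy ↦ hy v w
  rw [h_skew.fderiv_eq, fderiv_fun_neg, neg_apply, h_right,
    C.covDerivAlong_map_const, C.covDerivAlong_map_const, covDerivAlong_id_const,
    covDerivAlong_id_const] at h_left
  simp only [map_add, add_apply, C.skew_at] at h_left
  rw [C.symm_at _ v]
  linarith

theorem metric_covDerivEnd_map (C : NearlyCosymplecticChart y₀ G Φ Ξ Γ) {x : E}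
    (hx : G y₀ x (Ξ y₀) = 0) (s : E) : G y₀ (covDerivEnd y₀ Φ Γ s x) (Φ y₀ x) = 0 := by
  have h_map := C.fderiv_metric_along (u := fun y ↦ y) differentiableAt_fun_id
    (C.differentiableAt_map_apply x) (C.differentiableAt_map_apply x) s
  have h_const := C.fderiv_metric_along (u := fun y ↦ y) differentiableAt_fun_id
    (differentiableAt_const x) (differentiableAt_const x) s
  have h_diff := C.differentiableAt_metric_along (u := fun y ↦ y) differentiableAt_fun_id
    (differentiableAt_const x) (differentiableAt_const x)
  have h_reeb := C.differentiableAt_metric_along (u := fun y ↦ y) differentiableAt_fun_id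
    (differentiableAt_const x) C.differentiableAt_reeb
  have h_eq : (fun y ↦ G y (Φ y x) (Φ y x)) =ᶠ[𝓝 y₀]
      fun y ↦ G y x x - G y x (Ξ y) * G y x (Ξ y) := C.metric_map.mono fun y hy ↦ hy x x
  rw [h_eq.fderiv_eq, fderiv_fun_sub h_diff (h_reeb.fun_mul h_reeb), fderiv_fun_mul h_reeb h_reeb,
    sub_apply, h_const, hx, C.covDerivAlong_map_const, covDerivAlong_id_const] at h_map
  have h_metric := C.metric_map.self_of_nhds (Γ s x) x
  simp only [zero_smul, add_zero, zero_apply, sub_zero, map_add, add_apply,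
    C.symm_at (Φ y₀ x), C.symm_at x (Γ s x)] at h_map
  rw [hx, mul_zero, sub_zero] at h_metric
  linarith

theorem covDerivEnd_reeb (C : NearlyCosymplecticChart y₀ G Φ Ξ Γ) (x : E) :
    covDerivEnd y₀ Φ Γ x (Ξ y₀) = -Φ y₀ (covDerivAlong Γ (fun y ↦ y) Ξ y₀ x) := by
  have h_zero : covDerivAlong Γ (fun y ↦ y) (fun y ↦ Φ y (Ξ y)) y₀ x = 0 := by
    have h_christoffel : Γ x 0 = 0 := by simpa using C.christoffel_smul x 0 0
    have h_eq : (fun y ↦ Φ y (Ξ y)) =ᶠ[𝓝 y₀] fun _ ↦ 0 := C.map_reeb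
    simp [covDerivAlong, h_eq.fderiv_eq, C.map_reeb.self_of_nhds, h_christoffel]
  rw [covDerivAlong_map (u := fun y ↦ y) C.differentiableAt_map differentiableAt_fun_id
    C.differentiableAt_reeb] at h_zero
  simpa using eq_neg_of_add_eq_zero_left h_zero

theorem metric_covDerivAlong_reeb (C : NearlyCosymplecticChart y₀ G Φ Ξ Γ) {x : E}
    (hx : G y₀ x (Ξ y₀) = 0) : G y₀ (covDerivAlong Γ (fun y ↦ y) Ξ y₀ x) x = 0 := by
  set N := covDerivAlong Γ (fun y ↦ y) Ξ y₀ x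
  calc G y₀ N x = G y₀ (Φ y₀ N) (Φ y₀ x) := by
        rw [C.metric_map.self_of_nhds, hx, mul_zero, sub_zero]
    _ = G y₀ (covDerivEnd y₀ Φ Γ (Ξ y₀) x) (Φ y₀ x) := by
        rw [eq_neg_of_add_eq_zero_left (C.nearly (Ξ y₀) x), C.covDerivEnd_reeb, neg_neg]
    _ = 0 := C.metric_covDerivEnd_map hx (Ξ y₀)

theorem fderiv_metric_map_fderiv (C : NearlyCosymplecticChart (u x₀) G Φ Ξ Γ)
    (hu : ContDiffAt ℝ 2 u x₀) (s v w : F) :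
    fderiv ℝ (fun x ↦ G (u x) (Φ (u x) (fderiv ℝ u x v)) (fderiv ℝ u x w)) x₀ s =
      G (u x₀) (covDerivEnd (u x₀) Φ Γ (fderiv ℝ u x₀ s) (fderiv ℝ u x₀ v)) (fderiv ℝ u x₀ w) -
        G (u x₀) (alongDeriv u Γ x₀ s v) (Φ (u x₀) (fderiv ℝ u x₀ w)) +
        G (u x₀) (alongDeriv u Γ x₀ s w) (Φ (u x₀) (fderiv ℝ u x₀ v)) := by
  have hu₁ := hu.differentiableAt two_ne_zero
  have hv := differentiableAt_fderiv_apply hu v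
  have h_map : DifferentiableAt ℝ (fun x ↦ Φ (u x) (fderiv ℝ u x v)) x₀ :=
    (C.differentiableAt_map.comp x₀ hu₁).clm_apply hv
  rw [C.fderiv_metric_along hu₁ h_map (differentiableAt_fderiv_apply hu w),
    covDerivAlong_map C.differentiableAt_map hu₁ hv, covDerivAlong_fderiv hu,
    covDerivAlong_fderiv hu, map_add, add_apply, C.skew_at (alongDeriv ..), C.symm_at (Φ _ _)]
  ring

theorem metric_reeb_alongDeriv_self (C : NearlyCosymplecticChart (u x₀) G Φ Ξ Γ)
    (hu : ContDiffAt ℝ 2 u x₀) {w : F}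
    (hw : ∀ᶠ x in 𝓝 x₀, G (u x) (Ξ (u x)) (fderiv ℝ u x w) = 0) :
    G (u x₀) (Ξ (u x₀)) (alongDeriv u Γ x₀ w w) = 0 := by
  have hu₁ := hu.differentiableAt two_ne_zero
  have h_killing := C.metric_covDerivAlong_reeb ((C.symm_at _ _).trans hw.self_of_nhds)
  have h_comp : covDerivAlong Γ u (fun x ↦ Ξ (u x)) x₀ w =
      covDerivAlong Γ (fun y ↦ y) Ξ (u x₀) (fderiv ℝ u x₀ w) := by
    rw [covDerivAlong, fderiv_fun_comp x₀ C.differentiableAt_reeb hu₁]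
    simp [covDerivAlong]
  have h_reeb : DifferentiableAt ℝ (fun x ↦ Ξ (u x)) x₀ := C.differentiableAt_reeb.comp x₀ hu₁
  have h_deriv := C.fderiv_metric_along hu₁ h_reeb (differentiableAt_fderiv_apply hu w) w
  have h_eq : (fun x ↦ G (u x) (Ξ (u x)) (fderiv ℝ u x w)) =ᶠ[𝓝 x₀] fun _ ↦ 0 := hw
  rw [h_eq.fderiv_eq, covDerivAlong_fderiv hu, h_comp, h_killing, zero_add] at h_deriv
  simpa using h_deriv.symm

end NearlyCosymplecticChart

end RiemannianChart

section WarpedChart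

open Filter Topology

variable {E : Type*} [NormedAddCommGroup E] [NormedSpace ℝ E]
  {E₁ : Type*} [NormedAddCommGroup E₁] [NormedSpace ℝ E₁]
  {E₂ : Type*} [NormedAddCommGroup E₂] [NormedSpace ℝ E₂]

theorem fderiv_apply_inl {h : E₁ × E₂ → ℝ} {m : E₁ → ℝ} {p : E₁ × E₂}
    (hh : DifferentiableAt ℝ h p) (hm : (fun s ↦ h (s, p.2)) =ᶠ[𝓝 p.1] m) (x : E₁) :
    fderiv ℝ h p (x, 0) = fderiv ℝ m p.1 x := by
  have h_comp : HasFDerivAt (fun s ↦ h (s, p.2)) _ p.1 :=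
    HasFDerivAt.comp p.1 (g := h) hh.hasFDerivAt (hasFDerivAt_prodMk_left p.1 p.2)
  rw [← hm.fderiv_eq, h_comp.fderiv]
  rfl

theorem fderiv_apply_inr {h : E₁ × E₂ → ℝ} {m : E₂ → ℝ} {p : E₁ × E₂}
    (hh : DifferentiableAt ℝ h p) (hm : (fun t ↦ h (p.1, t)) =ᶠ[𝓝 p.2] m) (z : E₂) :
    fderiv ℝ h p (0, z) = fderiv ℝ m p.2 z := by
  have h_comp : HasFDerivAt (fun t ↦ h (p.1, t)) _ p.2 :=
    HasFDerivAt.comp p.2 (g := h) hh.hasFDerivAt (hasFDerivAt_prodMk_right p.1 p.2)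
  rw [← hm.fderiv_eq, h_comp.fderiv]
  rfl

/-- The immersion of a warped product semi-slant submanifold read in charts around the point of
coordinates `p`; `ρ` is the warping function, divided by its value at that point. -/
structure WarpedChart (G : E → E →L[ℝ] E →L[ℝ] ℝ) (Φ : E → E →L[ℝ] E) (Ξ : E → E)
    (u : E₁ × E₂ → E) (p : E₁ × E₂) (ρ : E₁ → ℝ) (θ : ℝ) : Prop where
  contDiffAt : ContDiffAt ℝ 2 u p
  differentiableAt : DifferentiableAt ℝ ρ p.1
  normalized : ρ p.1 = 1
  mixed : ∀ᶠ q in 𝓝 p, ∀ x z, G (u q) (fderiv ℝ u q (x, 0)) (fderiv ℝ u q (0, z)) = 0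
  horizontal : ∀ᶠ t in 𝓝 p.2, ∀ x y,
    G (u (p.1, t)) (fderiv ℝ u (p.1, t) (x, 0)) (fderiv ℝ u (p.1, t) (y, 0)) =
      G (u p) (fderiv ℝ u p (x, 0)) (fderiv ℝ u p (y, 0))
  vertical : ∀ᶠ s in 𝓝 p.1, ∀ z w,
    G (u (s, p.2)) (fderiv ℝ u (s, p.2) (0, z)) (fderiv ℝ u (s, p.2) (0, w)) =
      ρ s ^ 2 * G (u p) (fderiv ℝ u p (0, z)) (fderiv ℝ u p (0, w))
  invariant : ∀ᶠ q in 𝓝 p, ∀ x z,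
    G (u q) (Φ (u q) (fderiv ℝ u q (x, 0))) (fderiv ℝ u q (0, z)) = 0
  reeb : ∀ᶠ q in 𝓝 p, ∀ z, G (u q) (Ξ (u q)) (fderiv ℝ u q (0, z)) = 0
  slant : ∀ᶠ q in 𝓝 p, ∀ z, ∃ t,
    (∀ w, G (u q) (Φ (u q) (fderiv ℝ u q (0, z))) (fderiv ℝ u q (0, w)) =
      G (u q) (fderiv ℝ u q (0, t)) (fderiv ℝ u q (0, w))) ∧
    G (u q) (fderiv ℝ u q (0, t)) (fderiv ℝ u q (0, t)) =
      Real.cos θ ^ 2 * G (u q) (fderiv ℝ u q (0, z)) (fderiv ℝ u q (0, z))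

namespace WarpedChart

variable {G : E → E →L[ℝ] E →L[ℝ] ℝ} {Φ : E → E →L[ℝ] E} {Ξ : E → E} {Γ : E → E → E}
  {u : E₁ × E₂ → E} {p : E₁ × E₂} {ρ : E₁ → ℝ} {θ : ℝ}

theorem differentiableAt_metric_fderiv (U : WarpedChart G Φ Ξ u p ρ θ)
    (C : RiemannianChart (u p) G Γ) (v w : E₁ × E₂) :
    DifferentiableAt ℝ (fun q ↦ G (u q) (fderiv ℝ u q v) (fderiv ℝ u q w)) p :=
  C.differentiableAt_metric_along (U.contDiffAt.differentiableAt two_ne_zero)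
    (differentiableAt_fderiv_apply U.contDiffAt v) (differentiableAt_fderiv_apply U.contDiffAt w)

theorem fderiv_warping_sq_mul (U : WarpedChart G Φ Ξ u p ρ θ) (c : ℝ) (x : E₁) :
    fderiv ℝ (fun s ↦ ρ s ^ 2 * c) p.1 x = 2 * fderiv ℝ ρ p.1 x * c := by
  have h : HasFDerivAt (fun s ↦ ρ s ^ 2 * c) _ p.1 :=
    (U.differentiableAt.hasFDerivAt.pow 2).mul_const c
  simp only [h.fderiv, U.normalized, smul_apply, smul_eq_mul]
  norm_num
  ring

theorem vertical_deriv (U : WarpedChart G Φ Ξ u p ρ θ) (C : RiemannianChart (u p) G Γ)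
    (x : E₁) (z w : E₂) :
    2 * fderiv ℝ ρ p.1 x * G (u p) (fderiv ℝ u p (0, z)) (fderiv ℝ u p (0, w)) =
      G (u p) (alongDeriv u Γ p (x, 0) (0, z)) (fderiv ℝ u p (0, w)) +
        G (u p) (fderiv ℝ u p (0, z)) (alongDeriv u Γ p (x, 0) (0, w)) := by
  rw [← C.fderiv_metric_fderiv U.contDiffAt, ← U.fderiv_warping_sq_mul]
  exact (fderiv_apply_inl (U.differentiableAt_metric_fderiv C _ _)
    (U.vertical.mono fun s hs ↦ hs z w) x).symm

theorem mixed_deriv (U : WarpedChart G Φ Ξ u p ρ θ) (C : RiemannianChart (u p) G Γ)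
    (s : E₁ × E₂) (x : E₁) (z : E₂) :
    G (u p) (alongDeriv u Γ p s (x, 0)) (fderiv ℝ u p (0, z)) +
      G (u p) (fderiv ℝ u p (x, 0)) (alongDeriv u Γ p s (0, z)) = 0 := by
  have h_eq : (fun q ↦ G (u q) (fderiv ℝ u q (x, 0)) (fderiv ℝ u q (0, z))) =ᶠ[𝓝 p] fun _ ↦ 0 :=
    U.mixed.mono fun q hq ↦ hq x z
  rw [← C.fderiv_metric_fderiv U.contDiffAt, h_eq.fderiv_eq, fderiv_fun_const]
  rfl

theorem horizontal_deriv (U : WarpedChart G Φ Ξ u p ρ θ) (C : RiemannianChart (u p) G Γ)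
    (z : E₂) (x y : E₁) :
    G (u p) (alongDeriv u Γ p (0, z) (x, 0)) (fderiv ℝ u p (y, 0)) +
      G (u p) (fderiv ℝ u p (x, 0)) (alongDeriv u Γ p (0, z) (y, 0)) = 0 := by
  rw [← C.fderiv_metric_fderiv U.contDiffAt,
    fderiv_apply_inr (U.differentiableAt_metric_fderiv C _ _)
      (U.horizontal.mono fun t ht ↦ ht x y), fderiv_fun_const]
  rfl

theorem killing (U : WarpedChart G Φ Ξ u p ρ θ) (C : NearlyCosymplecticChart (u p) G Φ Ξ Γ)
    (z : E₂) : G (u p) (alongDeriv u Γ p (0, z) (0, z)) (Ξ (u p)) = 0 :=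
  (C.symm_at _ _).trans
    (C.metric_reeb_alongDeriv_self U.contDiffAt (U.reeb.mono fun _ hq ↦ hq z))

theorem mixed_form (U : WarpedChart G Φ Ξ u p ρ θ)
    (C : NearlyCosymplecticChart (u p) G Φ Ξ Γ) (z : E₂) (x : E₁) (w : E₂) :
    G (u p) (covDerivEnd (u p) Φ Γ (fderiv ℝ u p (0, z)) (fderiv ℝ u p (x, 0)))
        (fderiv ℝ u p (0, w)) =
      G (u p) (alongDeriv u Γ p (0, z) (x, 0)) (Φ (u p) (fderiv ℝ u p (0, w))) -
        G (u p) (alongDeriv u Γ p (0, z) (0, w)) (Φ (u p) (fderiv ℝ u p (x, 0))) := by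
  have h_eq : (fun q ↦ G (u q) (Φ (u q) (fderiv ℝ u q (x, 0))) (fderiv ℝ u q (0, w))) =ᶠ[𝓝 p]
      fun _ ↦ 0 := U.invariant.mono fun q hq ↦ hq x w
  have h_deriv := C.fderiv_metric_map_fderiv U.contDiffAt (0, z) (x, 0) (0, w)
  rw [h_eq.fderiv_eq, fderiv_fun_const, Pi.zero_apply, zero_apply] at h_deriv
  linarith

theorem metric_tangentialPart_self (U : WarpedChart G Φ Ξ u p ρ θ)
    (C : RiemannianChart (u p) G Γ) {z y : E₂}
    (hy : ∀ w, G (u p) (Φ (u p) (fderiv ℝ u p (0, z))) (fderiv ℝ u p (0, w)) =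
      G (u p) (fderiv ℝ u p (0, y)) (fderiv ℝ u p (0, w))) :
    G (u p) (fderiv ℝ u p (0, y)) (fderiv ℝ u p (0, y)) =
      Real.cos θ ^ 2 * G (u p) (fderiv ℝ u p (0, z)) (fderiv ℝ u p (0, z)) := by
  obtain ⟨t, ht, ht_sq⟩ := U.slant.self_of_nhds z
  rw [← ht_sq, ← hy y, ht y, C.symm_at, ← hy t, ht t]

theorem eventually_metric_map_le (U : WarpedChart G Φ Ξ u p ρ θ)
    (C : RiemannianChart (u p) G Γ) {z y : E₂}
    (hy : ∀ w, G (u p) (Φ (u p) (fderiv ℝ u p (0, z))) (fderiv ℝ u p (0, w)) =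
      G (u p) (fderiv ℝ u p (0, y)) (fderiv ℝ u p (0, w))) :
    ∀ᶠ s in 𝓝 p.1, G (u (s, p.2)) (Φ (u (s, p.2)) (fderiv ℝ u (s, p.2) (0, z)))
        (fderiv ℝ u (s, p.2) (0, y)) ≤
      ρ s ^ 2 * (Real.cos θ ^ 2 * G (u p) (fderiv ℝ u p (0, z)) (fderiv ℝ u p (0, z))) := by
  have h_tendsto : Tendsto (fun s : E₁ ↦ (s, p.2)) (𝓝 p.1) (𝓝 p) :=
    (Continuous.prodMk_left p.2).tendsto p.1
  filter_upwards [h_tendsto.eventually U.slant, U.vertical] with s h_slant h_vertical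
  obtain ⟨t, ht, ht_sq⟩ := h_slant z
  rw [h_vertical, h_vertical] at ht_sq
  have h_nonneg := mul_nonneg (sq_nonneg (ρ s))
    (C.nonneg (fderiv ℝ u p (0, t) - fderiv ℝ u p (0, y)))
  simp only [map_sub, sub_apply, U.metric_tangentialPart_self C hy,
    C.symm_at (fderiv ℝ u p (0, y)) (fderiv ℝ u p (0, t))] at h_nonneg
  rw [ht, h_vertical]
  linarith

theorem slant_deriv (U : WarpedChart G Φ Ξ u p ρ θ)
    (C : NearlyCosymplecticChart (u p) G Φ Ξ Γ) (x : E₁) {z y : E₂}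
    (hy : ∀ w, G (u p) (Φ (u p) (fderiv ℝ u p (0, z))) (fderiv ℝ u p (0, w)) =
      G (u p) (fderiv ℝ u p (0, y)) (fderiv ℝ u p (0, w))) :
    G (u p) (covDerivEnd (u p) Φ Γ (fderiv ℝ u p (x, 0)) (fderiv ℝ u p (0, z)))
          (fderiv ℝ u p (0, y)) -
        G (u p) (alongDeriv u Γ p (x, 0) (0, z)) (Φ (u p) (fderiv ℝ u p (0, y))) +
        G (u p) (alongDeriv u Γ p (x, 0) (0, y)) (Φ (u p) (fderiv ℝ u p (0, z))) =
      2 * fderiv ℝ ρ p.1 x *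
        (Real.cos θ ^ 2 * G (u p) (fderiv ℝ u p (0, z)) (fderiv ℝ u p (0, z))) := by
  rw [← C.fderiv_metric_map_fderiv U.contDiffAt, ← U.fderiv_warping_sq_mul]
  set c := Real.cos θ ^ 2 * G (u p) (fderiv ℝ u p (0, z)) (fderiv ℝ u p (0, z))
  set Ω : E₁ × E₂ → ℝ :=
    fun q ↦ G (u q) (Φ (u q) (fderiv ℝ u q (0, z))) (fderiv ℝ u q (0, y))
  have hu := U.contDiffAt.differentiableAt two_ne_zero
  have h_diff : DifferentiableAt ℝ Ω p :=
    C.differentiableAt_metric_along hu ((C.differentiableAt_map.comp p hu).clm_apply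
      (differentiableAt_fderiv_apply U.contDiffAt _)) (differentiableAt_fderiv_apply U.contDiffAt _)
  have h_slice : DifferentiableAt ℝ (fun s ↦ Ω (s, p.2)) p.1 :=
    DifferentiableAt.comp p.1 (g := Ω) h_diff
      (differentiableAt_fun_id.prodMk (differentiableAt_const p.2))
  have h_warping : DifferentiableAt ℝ (fun s ↦ ρ s ^ 2 * c) p.1 :=
    (U.differentiableAt.pow 2).mul_const c
  have h_max : IsLocalMax (fun s ↦ Ω (s, p.2) - ρ s ^ 2 * c) p.1 := by
    filter_upwards [U.eventually_metric_map_le C.toRiemannianChart hy] with s hs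
    have h_eq : Ω p = c := (hy y).trans (U.metric_tangentialPart_self C.toRiemannianChart hy)
    simpa [U.normalized, h_eq] using hs
  have h_crit := h_max.fderiv_eq_zero
  rw [fderiv_fun_sub h_slice h_warping, sub_eq_zero] at h_crit
  rw [fderiv_apply_inl h_diff (Eventually.of_forall fun _ ↦ rfl), h_crit]

theorem nearlyCosymplecticPoint {V : Type*} [NormedAddCommGroup V] [InnerProductSpace ℝ V]
    {D : E₁ × E₂ →ₗ[ℝ] V} {B : E₁ × E₂ →ₗ[ℝ] E₁ × E₂ →ₗ[ℝ] V} {φ : V →ₗ[ℝ] V} {ξ : V}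
    (U : WarpedChart G Φ Ξ u p ρ θ) (C : NearlyCosymplecticChart (u p) G Φ Ξ Γ)
    (c : E ≃ₗ[ℝ] V) (hc : ∀ v w, inner ℝ (c v) (c w) = G (u p) v w)
    (hD : ∀ v, D v = c (fderiv ℝ u p v)) (hB : ∀ v w, B v w = c (alongDeriv u Γ p v w))
    (hφ : ∀ v, φ (c v) = c (Φ (u p) v)) (hξ : ξ = c (Ξ (u p)))
    (injective : Function.Injective D) (h_inv : ∀ x, ∃ y, φ (D (x, 0)) = D (y, 0))
    (h_reeb : ∃ x, ξ = D (x, 0)) (sin_ne_zero : Real.sin θ ≠ 0) :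
    NearlyCosymplecticPoint D B (fderiv ℝ ρ p.1 : E₁ →ₗ[ℝ] ℝ) φ ξ θ
      (fun v w ↦ c (covDerivEnd (u p) Φ Γ (c.symm v) (c.symm w))) where
  injective := injective
  orthogonal x z := by simpa only [hD, hc] using U.mixed.self_of_nhds x z
  symm v w := by rw [hB, hB, C.alongDeriv_symm U.contDiffAt]
  vertical_deriv x z w := by
    simpa only [hD, hB, hc, ContinuousLinearMap.coe_coe] using
      U.vertical_deriv C.toRiemannianChart x z w
  mixed_deriv s x z := by simpa only [hD, hB, hc] using U.mixed_deriv C.toRiemannianChart s x z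
  horizontal_deriv z x y := by
    simpa only [hD, hB, hc] using U.horizontal_deriv C.toRiemannianChart z x y
  skew v w := by
    obtain ⟨v, rfl⟩ := c.surjective v
    obtain ⟨w, rfl⟩ := c.surjective w
    simpa only [hφ, hc] using C.skew_at v w
  inner_map v w := by
    obtain ⟨v, rfl⟩ := c.surjective v
    obtain ⟨w, rfl⟩ := c.surjective w
    simpa only [hφ, hc, hξ] using C.metric_map.self_of_nhds v w
  invariant := h_inv
  reeb := h_reeb
  slant z := by
    obtain ⟨t, ht, ht_sq⟩ := U.slant.self_of_nhds z
    exact ⟨t, fun w ↦ by simpa only [hD, hφ, hc] using ht w,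
      by simpa only [← real_inner_self_eq_norm_sq, hD, hc] using ht_sq⟩
  sin_ne_zero := sin_ne_zero
  killing z := by simpa only [hB, hξ, hc] using U.killing C z
  nearly v w := by
    rw [eq_neg_of_add_eq_zero_left (C.nearly (c.symm v) (c.symm w)), map_neg]
  skew_covDeriv v w z := by
    simpa only [← hc, c.apply_symm_apply] using
      C.covDerivEnd_skew (c.symm v) (c.symm w) (c.symm z)
  mixed_form z x w := by
    simpa only [hD, hB, hφ, hc, c.symm_apply_apply] using U.mixed_form C z x w
  slant_deriv x z y hy := by
    have h_deriv := U.slant_deriv C x (y := y) fun w ↦ by simpa only [hD, hφ, hc] using hy w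
    simpa only [← real_inner_self_eq_norm_sq, hD, hB, hφ, hc, c.symm_apply_apply,
      ContinuousLinearMap.coe_coe] using h_deriv

end WarpedChart

end WarpedChart

section ChartFields

open Set

variable {E : Type*} [NormedAddCommGroup E] [NormedSpace ℝ E]
  {M : Type*} [TopologicalSpace M] [ChartedSpace E M]

theorem extChartAt_symm_mem_source {p : M} {y : E} (hy : y ∈ (extChartAt 𝓘(ℝ, E) p).target) :
    (extChartAt 𝓘(ℝ, E) p).symm y ∈ (chartAt E p).source :=
  extChartAt_source 𝓘(ℝ, E) p ▸ (extChartAt 𝓘(ℝ, E) p).map_target hy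

variable [IsManifold 𝓘(ℝ, E) ∞ M]

theorem extChartAt_symm_mem_baseSet {p : M} {y : E} (hy : y ∈ (extChartAt 𝓘(ℝ, E) p).target) :
    (extChartAt 𝓘(ℝ, E) p).symm y ∈ (trivializationAt E (TangentSpace 𝓘(ℝ, E)) p).baseSet := by
  simpa using extChartAt_symm_mem_source hy

/-- The vector field with constant coordinates `w` in the preferred chart at `p`; it extends to all
of `M` the coordinate field `coordVec`, which is only given along the inverse chart. -/
def constField (p : M) (w : E) (q : M) : TangentSpace 𝓘(ℝ, E) q :=
  (trivializationAt E (TangentSpace 𝓘(ℝ, E)) p).symmL ℝ q w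

theorem trivializationAt_constField {p q : M}
    (hq : q ∈ (trivializationAt E (TangentSpace 𝓘(ℝ, E)) p).baseSet) (w : E) :
    (trivializationAt E (TangentSpace 𝓘(ℝ, E)) p ⟨q, constField p w q⟩).2 = w := by
  rw [constField, Trivialization.symmL_apply _ hq, Trivialization.mk_symm _ hq]
  exact congrArg Prod.snd (Trivialization.apply_symm_apply _ ((Trivialization.mem_target _).mpr hq))

theorem contMDiffAt_constField {p q : M} (hq : q ∈ (chartAt E p).source) (w : E) :
    ContMDiffAt 𝓘(ℝ, E) (𝓘(ℝ, E).prod 𝓘(ℝ, E)) ∞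
      (fun q ↦ TotalSpace.mk' E (E := fun q : M ↦ TangentSpace 𝓘(ℝ, E) q) q
        (constField p w q)) q := by
  set T := trivializationAt E (TangentSpace 𝓘(ℝ, E)) p
  have h_base : q ∈ T.baseSet := by simpa [T] using hq
  rw [T.contMDiffAt_section_iff h_base]
  refine (contMDiffAt_const (c := w)).congr_of_eventuallyEq ?_
  filter_upwards [T.open_baseSet.mem_nhds h_base] with r hr
  exact trivializationAt_constField hr w

theorem coordVec_eq_constField {p : M} {y : E} (hy : y ∈ (extChartAt 𝓘(ℝ, E) p).target) (w : E) :
    coordVec p y w = constField p w ((extChartAt 𝓘(ℝ, E) p).symm y) := by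
  have h := TangentBundle.symmL_trivializationAt (I := 𝓘(ℝ, E)) (𝕜 := ℝ)
    (extChartAt_symm_mem_source hy)
  simp only [modelWithCornersSelf_coe, range_id, mfderivWithin_univ] at h
  refine Eq.trans ?_ (DFunLike.congr_fun h w).symm
  let A (y : E) : E →L[ℝ] E := mfderiv 𝓘(ℝ, E) 𝓘(ℝ, E) (extChartAt 𝓘(ℝ, E) p).symm y
  exact congrArg (fun y ↦ A y w) ((extChartAt 𝓘(ℝ, E) p).right_inv hy).symm

theorem coordRep_eq_trivializationAt {p : M} {y : E} (hy : y ∈ (extChartAt 𝓘(ℝ, E) p).target)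
    (Y : ∀ p : M, TangentSpace 𝓘(ℝ, E) p) :
    coordRep p Y y = (trivializationAt E (TangentSpace 𝓘(ℝ, E)) p
      ⟨(extChartAt 𝓘(ℝ, E) p).symm y, Y ((extChartAt 𝓘(ℝ, E) p).symm y)⟩).2 := by
  have h := TangentBundle.continuousLinearMapAt_trivializationAt (I := 𝓘(ℝ, E)) (𝕜 := ℝ)
    (extChartAt_symm_mem_source hy)
  refine (DFunLike.congr_fun h (Y ((extChartAt 𝓘(ℝ, E) p).symm y))).symm.trans ?_
  rw [Trivialization.continuousLinearMapAt_apply,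
    Trivialization.coe_linearMapAt_of_mem _ (extChartAt_symm_mem_baseSet hy)]

theorem coordRep_constField {p : M} {y : E} (hy : y ∈ (extChartAt 𝓘(ℝ, E) p).target) (w : E) :
    coordRep p (constField p w) y = w := by
  rw [coordRep_eq_trivializationAt hy,
    trivializationAt_constField (extChartAt_symm_mem_baseSet hy)]

theorem coordVec_mfderiv {p : M} {y : E} (hy : y ∈ (extChartAt 𝓘(ℝ, E) p).target)
    (X : TangentSpace 𝓘(ℝ, E) ((extChartAt 𝓘(ℝ, E) p).symm y)) :
    coordVec p y (tangentCoord 𝓘(ℝ, E) _ (mfderiv 𝓘(ℝ, E) 𝓘(ℝ, E) (extChartAt 𝓘(ℝ, E) p)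
      ((extChartAt 𝓘(ℝ, E) p).symm y) X)) = X := by
  have h := mfderivWithin_extChartAt_symm_comp_mfderiv_extChartAt (I := 𝓘(ℝ, E)) hy
  simp only [modelWithCornersSelf_coe, range_id, mfderivWithin_univ] at h
  exact DFunLike.congr_fun h X

theorem coordVec_coordRep {p : M} {y : E} (hy : y ∈ (extChartAt 𝓘(ℝ, E) p).target)
    (Y : ∀ p : M, TangentSpace 𝓘(ℝ, E) p) :
    coordVec p y (coordRep p Y y) = Y ((extChartAt 𝓘(ℝ, E) p).symm y) :=
  coordVec_mfderiv hy (Y _)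

theorem contDiffOn_coordRep {p : M} {Y : ∀ p : M, TangentSpace 𝓘(ℝ, E) p}
    (hY : ∀ q ∈ (chartAt E p).source, ContMDiffAt 𝓘(ℝ, E) (𝓘(ℝ, E).prod 𝓘(ℝ, E)) ∞
      (fun q ↦ TotalSpace.mk' E (E := fun q : M ↦ TangentSpace 𝓘(ℝ, E) q) q (Y q)) q) :
    ContDiffOn ℝ ∞ (coordRep p Y) (extChartAt 𝓘(ℝ, E) p).target := by
  have h_triv : ContMDiffOn 𝓘(ℝ, E) 𝓘(ℝ, E) ∞
      (fun y ↦ (trivializationAt E (TangentSpace 𝓘(ℝ, E)) p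
        ⟨(extChartAt 𝓘(ℝ, E) p).symm y, Y ((extChartAt 𝓘(ℝ, E) p).symm y)⟩).2)
      (extChartAt 𝓘(ℝ, E) p).target := fun y hy ↦
    (((trivializationAt E (TangentSpace 𝓘(ℝ, E)) p).contMDiffAt_section_iff
      (extChartAt_symm_mem_baseSet hy)).mp (hY _ (extChartAt_symm_mem_source hy))
      ).comp_contMDiffWithinAt y (contMDiffOn_extChartAt_symm p y hy)
  exact (contMDiffOn_iff_contDiffOn.mp h_triv).congr fun y hy ↦
    coordRep_eq_trivializationAt hy Y

theorem constField_self (p : M) (w : E) :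
    constField p w p = (tangentCoord 𝓘(ℝ, E) p).symm w :=
  (DFunLike.congr_fun (TangentBundle.symmL_trivializationAt (I := 𝓘(ℝ, E)) (𝕜 := ℝ)
    (mem_chart_source E p)) w).trans
    (DFunLike.congr_fun (mfderivWithin_range_extChartAt_symm (I := 𝓘(ℝ, E)) (x := p)) w)

theorem coordRep_self (p : M) (Y : ∀ p : M, TangentSpace 𝓘(ℝ, E) p) :
    coordRep p Y (extChartAt 𝓘(ℝ, E) p p) = tangentCoord 𝓘(ℝ, E) p (Y p) := by
  let k (q : M) : E := tangentCoord 𝓘(ℝ, E) _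
    (mfderiv 𝓘(ℝ, E) 𝓘(ℝ, E) (extChartAt 𝓘(ℝ, E) p) q (Y q))
  exact (congrArg k (extChartAt_to_inv p)).trans
    (DFunLike.congr_fun (mfderiv_extChartAt_self (I := 𝓘(ℝ, E)) (x := p)) (Y p))

variable [RiemannianBundle (fun p : M ↦ TangentSpace 𝓘(ℝ, E) p)]

theorem contDiffOn_metricCoeff
    [IsContMDiffRiemannianBundle 𝓘(ℝ, E) ∞ E (fun p : M ↦ TangentSpace 𝓘(ℝ, E) p)]
    (p : M) (v w : E) :
    ContDiffOn ℝ ∞ (metricCoeff p v w) (extChartAt 𝓘(ℝ, E) p).target := by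
  have h_const : ContMDiffOn 𝓘(ℝ, E) 𝓘(ℝ, ℝ) ∞
      (fun y ↦ inner ℝ (constField p v ((extChartAt 𝓘(ℝ, E) p).symm y))
        (constField p w ((extChartAt 𝓘(ℝ, E) p).symm y)))
      (extChartAt 𝓘(ℝ, E) p).target := by
    intro y hy
    have h_inner := ContMDiffAt.inner_bundle (E := fun p : M ↦ TangentSpace 𝓘(ℝ, E) p)
      (contMDiffAt_constField (extChartAt_symm_mem_source hy) v)
      (contMDiffAt_constField (extChartAt_symm_mem_source hy) w)
    exact h_inner.comp_contMDiffWithinAt y (contMDiffOn_extChartAt_symm p y hy)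
  exact (contMDiffOn_iff_contDiffOn.mp h_const).congr fun y hy ↦ by
    rw [metricCoeff, coordVec_eq_constField hy, coordVec_eq_constField hy]

/-- The metric in the preferred chart at `p`. -/
def chartMetric (p : M) (y : E) : E →L[ℝ] E →L[ℝ] ℝ :=
  let A := (mfderiv 𝓘(ℝ, E) 𝓘(ℝ, E) (extChartAt 𝓘(ℝ, E) p).symm y).comp
    (tangentCoord 𝓘(ℝ, E) y).symm.toContinuousLinearMap
  (innerSL ℝ).bilinearComp A A

omit [IsManifold 𝓘(ℝ, E) ∞ M] in
theorem chartMetric_apply (p : M) (y v w : E) :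
    chartMetric p y v w = inner ℝ (coordVec p y v) (coordVec p y w) := rfl

theorem chartMetric_extChartAt {p q : M} (hq : q ∈ (extChartAt 𝓘(ℝ, E) p).source) (v w : E) :
    chartMetric p (extChartAt 𝓘(ℝ, E) p q) v w =
      inner ℝ (constField p v q) (constField p w q) := by
  have hy := (extChartAt 𝓘(ℝ, E) p).map_source hq
  rw [chartMetric_apply, coordVec_eq_constField hy, coordVec_eq_constField hy]
  exact congrArg (fun q ↦ inner ℝ (constField p v q) (constField p w q))
    ((extChartAt 𝓘(ℝ, E) p).left_inv hq)

theorem chartMetric_self (p : M) (v w : E) :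
    chartMetric p (extChartAt 𝓘(ℝ, E) p p) v w =
      inner ℝ ((tangentCoord 𝓘(ℝ, E) p).symm v) ((tangentCoord 𝓘(ℝ, E) p).symm w) := by
  rw [chartMetric_extChartAt (mem_extChartAt_source p), constField_self, constField_self]

variable [FiniteDimensional ℝ E]

theorem contDiffOn_chartMetric
    [IsContMDiffRiemannianBundle 𝓘(ℝ, E) ∞ E (fun p : M ↦ TangentSpace 𝓘(ℝ, E) p)] (p : M) :
    ContDiffOn ℝ ∞ (chartMetric p) (extChartAt 𝓘(ℝ, E) p).target :=
  contDiffOn_clm_apply.mpr fun v ↦ contDiffOn_clm_apply.mpr fun w ↦ contDiffOn_metricCoeff p v w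

theorem differentiableAt_chartMetric
    [IsContMDiffRiemannianBundle 𝓘(ℝ, E) ∞ E (fun p : M ↦ TangentSpace 𝓘(ℝ, E) p)] (p : M) :
    DifferentiableAt ℝ (chartMetric p) (extChartAt 𝓘(ℝ, E) p p) :=
  ((contDiffOn_chartMetric p).contDiffAt (extChartAt_target_mem_nhds p)).differentiableAt (by simp)

theorem metricDeriv_eq
    [IsContMDiffRiemannianBundle 𝓘(ℝ, E) ∞ E (fun p : M ↦ TangentSpace 𝓘(ℝ, E) p)]
    (p : M) (s v w : E) :
    metricDeriv p s v w = fderiv ℝ (chartMetric p) (extChartAt 𝓘(ℝ, E) p p) s v w :=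
  fderiv_apply_apply (differentiableAt_chartMetric p) s v w

theorem inner_christoffel
    [IsContMDiffRiemannianBundle 𝓘(ℝ, E) ∞ E (fun p : M ↦ TangentSpace 𝓘(ℝ, E) p)]
    (p : M) (v w z : TangentSpace 𝓘(ℝ, E) p) :
    inner ℝ (christoffel p v w) z = koszul p (tangentCoord 𝓘(ℝ, E) p v) (tangentCoord 𝓘(ℝ, E) p w)
      (tangentCoord 𝓘(ℝ, E) p z) := by
  set v' := tangentCoord 𝓘(ℝ, E) p v
  set w' := tangentCoord 𝓘(ℝ, E) p w
  set G' := fderiv ℝ (chartMetric p) (extChartAt 𝓘(ℝ, E) p p)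
  let L : E →L[ℝ] ℝ := (2⁻¹ : ℝ) • (G' v' w' + G' w' v' - (G'.flip v').flip w')
  have h_koszul (z : E) : koszul p v' w' z = L z := by
    simp only [koszul, metricDeriv_eq, L, smul_apply, sub_apply, add_apply,
      ContinuousLinearMap.flip_apply, smul_eq_mul]
    ring
  have : CompleteSpace (TangentSpace 𝓘(ℝ, E) p) := FiniteDimensional.complete ℝ _
  have h_exists : ∃ u : TangentSpace 𝓘(ℝ, E) p, ∀ z : TangentSpace 𝓘(ℝ, E) p,
      inner ℝ u z = koszul p v' w' (tangentCoord 𝓘(ℝ, E) p z) :=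
    ⟨(InnerProductSpace.toDual ℝ _).symm (L.comp (tangentCoord 𝓘(ℝ, E) p).toContinuousLinearMap),
      fun z ↦ by rw [InnerProductSpace.toDual_symm_apply, h_koszul]; rfl⟩
  exact Classical.epsilon_spec h_exists z

end ChartFields

section NearlyCosymplectic

open Filter Topology Set

variable {E : Type*} [NormedAddCommGroup E] [NormedSpace ℝ E]
  {M : Type*} [TopologicalSpace M] [ChartedSpace E M] [IsManifold 𝓘(ℝ, E) ∞ M]

theorem constField_mfderiv {p q : M} (hq : q ∈ (extChartAt 𝓘(ℝ, E) p).source)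
    (X : TangentSpace 𝓘(ℝ, E) q) :
    constField p (tangentCoord 𝓘(ℝ, E) _
      (mfderiv 𝓘(ℝ, E) 𝓘(ℝ, E) (extChartAt 𝓘(ℝ, E) p) q X)) q = X :=
  (DFunLike.congr_fun (TangentBundle.symmL_trivializationAt (I := 𝓘(ℝ, E)) (𝕜 := ℝ)
    (extChartAt_source 𝓘(ℝ, E) p ▸ hq)) _).trans
    (DFunLike.congr_fun (mfderivWithin_extChartAt_symm_comp_mfderiv_extChartAt' hq) X)

theorem constField_coordRep {p q : M} (hq : q ∈ (extChartAt 𝓘(ℝ, E) p).source)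
    (Y : ∀ p : M, TangentSpace 𝓘(ℝ, E) p) :
    constField p (coordRep p Y (extChartAt 𝓘(ℝ, E) p q)) q = Y q := by
  let k (q : M) : E := tangentCoord 𝓘(ℝ, E) _
    (mfderiv 𝓘(ℝ, E) 𝓘(ℝ, E) (extChartAt 𝓘(ℝ, E) p) q (Y q))
  have h_rep : coordRep p Y (extChartAt 𝓘(ℝ, E) p q) = k q :=
    congrArg k ((extChartAt 𝓘(ℝ, E) p).left_inv hq)
  rw [h_rep]
  exact constField_mfderiv hq _

variable [RiemannianBundle (fun p : M ↦ TangentSpace 𝓘(ℝ, E) p)]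
  (S : AlmostContactMetricStructure E M)

theorem AlmostContactMetricStructure.skew (q : M)
    (v w : TangentSpace 𝓘(ℝ, E) q) : inner ℝ (S.φ q v) w = -inner ℝ v (S.φ q w) := by
  have h_map := S.inner_φ_φ q v (S.φ q w)
  rw [S.η_φ, S.φ_φ, inner_add_right, inner_neg_right, real_inner_smul_right,
    ← S.η_eq_inner, S.η_φ] at h_map
  linarith

theorem contMDiffAt_map_constField {p q : M} (hq : q ∈ (chartAt E p).source) (w : E) :
    ContMDiffAt 𝓘(ℝ, E) (𝓘(ℝ, E).prod 𝓘(ℝ, E)) ∞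
      (fun q ↦ TotalSpace.mk' E (E := fun q : M ↦ TangentSpace 𝓘(ℝ, E) q) q
        (S.φ q (constField p w q))) q :=
  ContMDiffAt.clm_bundle_apply (b := fun q : M ↦ q) (S.smooth_φ q) (contMDiffAt_constField hq w)

/-- The tensor `φ` in the preferred chart at `p`. -/
def chartMap (p : M) (y : E) : E →L[ℝ] E :=
  let q := (extChartAt 𝓘(ℝ, E) p).symm y
  (tangentCoord 𝓘(ℝ, E) _).toContinuousLinearMap ∘L
    mfderiv 𝓘(ℝ, E) 𝓘(ℝ, E) (extChartAt 𝓘(ℝ, E) p) q ∘L S.φ q ∘L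
      mfderiv 𝓘(ℝ, E) 𝓘(ℝ, E) (extChartAt 𝓘(ℝ, E) p).symm y ∘L
        (tangentCoord 𝓘(ℝ, E) y).symm.toContinuousLinearMap

theorem coordVec_chartMap {p : M} {y : E} (hy : y ∈ (extChartAt 𝓘(ℝ, E) p).target) (w : E) :
    coordVec p y (chartMap S p y w) = S.φ _ (coordVec p y w) :=
  coordVec_mfderiv hy _

theorem chartMap_eq_coordRep {p : M} {y : E} (hy : y ∈ (extChartAt 𝓘(ℝ, E) p).target) (w : E) :
    chartMap S p y w = coordRep p (fun q ↦ S.φ q (constField p w q)) y := by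
  rw [coordRep, ← coordVec_eq_constField hy]
  rfl

theorem chartMap_coordRep_reeb {p : M} {y : E} (hy : y ∈ (extChartAt 𝓘(ℝ, E) p).target) :
    chartMap S p y (coordRep p S.ξ y) = 0 := by
  have h : chartMap S p y (coordRep p S.ξ y) = tangentCoord 𝓘(ℝ, E) _
      (mfderiv 𝓘(ℝ, E) 𝓘(ℝ, E) (extChartAt 𝓘(ℝ, E) p) ((extChartAt 𝓘(ℝ, E) p).symm y)
        (S.φ _ (coordVec p y (coordRep p S.ξ y)))) := rfl
  rw [h, coordVec_coordRep hy, S.φ_ξ, map_zero, map_zero]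

theorem chartMap_self (p : M) (w : E) :
    chartMap S p (extChartAt 𝓘(ℝ, E) p p) w =
      tangentCoord 𝓘(ℝ, E) p (S.φ p ((tangentCoord 𝓘(ℝ, E) p).symm w)) := by
  rw [chartMap_eq_coordRep S (mem_extChartAt_target p), coordRep_self, constField_self]

theorem constField_chartMap {p q : M} (hq : q ∈ (extChartAt 𝓘(ℝ, E) p).source) (w : E) :
    constField p (chartMap S p (extChartAt 𝓘(ℝ, E) p q) w) q = S.φ q (constField p w q) := by
  rw [chartMap_eq_coordRep S ((extChartAt 𝓘(ℝ, E) p).map_source hq), constField_coordRep hq]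

/-- The Christoffel symbols at `p`, on the model space. -/
def chartChristoffel (p : M) (v w : E) : E :=
  tangentCoord 𝓘(ℝ, E) p (christoffel p ((tangentCoord 𝓘(ℝ, E) p).symm v)
    ((tangentCoord 𝓘(ℝ, E) p).symm w))

variable [FiniteDimensional ℝ E]

theorem contDiffOn_chartMap (p : M) :
    ContDiffOn ℝ ∞ (chartMap S p) (extChartAt 𝓘(ℝ, E) p).target :=
  contDiffOn_clm_apply.mpr fun w ↦
    (contDiffOn_coordRep fun _ hq ↦ contMDiffAt_map_constField S hq w).congr
      fun _ hy ↦ chartMap_eq_coordRep S hy w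

theorem differentiableAt_chartMap (p : M) :
    DifferentiableAt ℝ (chartMap S p) (extChartAt 𝓘(ℝ, E) p p) :=
  ((contDiffOn_chartMap S p).contDiffAt (extChartAt_target_mem_nhds p)).differentiableAt (by simp)

theorem covDerivPhi_constField (p : M) (v w : E) :
    S.covDerivPhi (constField p v) (constField p w) p = (tangentCoord 𝓘(ℝ, E) p).symm
      (covDerivEnd (extChartAt 𝓘(ℝ, E) p p) (chartMap S p) (chartChristoffel p) v w) := by
  have h_target := extChartAt_target_mem_nhds (I := 𝓘(ℝ, E)) p
  have h_const : fderiv ℝ (coordRep p (constField p w)) (extChartAt 𝓘(ℝ, E) p p) = 0 := by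
    have h_eq : coordRep p (constField p w) =ᶠ[𝓝 (extChartAt 𝓘(ℝ, E) p p)] fun _ ↦ w := by
      filter_upwards [h_target] with y hy using coordRep_constField hy w
    rw [h_eq.fderiv_eq, fderiv_fun_const, Pi.zero_apply]
  have h_map : fderiv ℝ (coordRep p (fun q ↦ S.φ q (constField p w q)))
      (extChartAt 𝓘(ℝ, E) p p) v =
        fderiv ℝ (chartMap S p) (extChartAt 𝓘(ℝ, E) p p) v w := by
    have h_eq : coordRep p (fun q ↦ S.φ q (constField p w q)) =ᶠ[𝓝 (extChartAt 𝓘(ℝ, E) p p)]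
        fun y ↦ chartMap S p y w := by
      filter_upwards [h_target] with y hy using (chartMap_eq_coordRep S hy w).symm
    rw [h_eq.fderiv_eq, fderiv_clm_apply (differentiableAt_chartMap S p)
      (differentiableAt_const w)]
    simp
  simp only [AlmostContactMetricStructure.covDerivPhi, covDeriv, h_const, h_map, constField_self,
    covDerivEnd, chartChristoffel, chartMap_self, map_add, map_sub,
    ContinuousLinearEquiv.symm_apply_apply, ContinuousLinearEquiv.apply_symm_apply, zero_apply,
    map_zero, zero_add]

variable [IsContMDiffRiemannianBundle 𝓘(ℝ, E) ∞ E (fun p : M ↦ TangentSpace 𝓘(ℝ, E) p)]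

theorem riemannianChart (p : M) :
    RiemannianChart (extChartAt 𝓘(ℝ, E) p p) (chartMetric p) (chartChristoffel p) where
  differentiableAt_metric := differentiableAt_chartMetric p
  symm := Eventually.of_forall fun y v w ↦ by
    rw [chartMetric_apply, chartMetric_apply, real_inner_comm]
  pos v hv := by
    rw [chartMetric_self]
    exact real_inner_self_pos.mpr
      ((map_ne_zero_iff _ (tangentCoord 𝓘(ℝ, E) p).symm.injective).mpr hv)
  koszul v w z := by
    rw [chartMetric_self, chartChristoffel, ContinuousLinearEquiv.symm_apply_apply,
      inner_christoffel, WarpedSemiSlant.koszul]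
    simp only [ContinuousLinearEquiv.apply_symm_apply, metricDeriv_eq]

variable {S}

theorem nearlyCosymplecticChart (hS : S.IsNearlyCosymplectic) (p : M) :
    NearlyCosymplecticChart (extChartAt 𝓘(ℝ, E) p p) (chartMetric p) (chartMap S p)
      (coordRep p S.ξ) (chartChristoffel p) where
  toRiemannianChart := riemannianChart p
  differentiableAt_map := differentiableAt_chartMap S p
  differentiableAt_reeb := ((contDiffOn_coordRep fun q _ ↦ S.smooth_ξ q).contDiffAt
    (extChartAt_target_mem_nhds p)).differentiableAt (by simp)
  skew := by
    filter_upwards [extChartAt_target_mem_nhds (I := 𝓘(ℝ, E)) p] with y hy v w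
    rw [chartMetric_apply, chartMetric_apply, coordVec_chartMap S hy, coordVec_chartMap S hy,
      S.skew]
  metric_map := by
    filter_upwards [extChartAt_target_mem_nhds (I := 𝓘(ℝ, E)) p] with y hy v w
    simp only [chartMetric_apply, coordVec_chartMap S hy, coordVec_coordRep hy, S.inner_φ_φ,
      S.η_eq_inner]
  map_reeb := by
    filter_upwards [extChartAt_target_mem_nhds (I := 𝓘(ℝ, E)) p] with y hy
      using chartMap_coordRep_reeb S hy
  nearly v w := by
    have h := hS p (constField p v) (constField p w)
      (contMDiffAt_constField (mem_chart_source E p) v)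
      (contMDiffAt_constField (mem_chart_source E p) w)
    rw [covDerivPhi_constField, covDerivPhi_constField, ← map_add] at h
    exact (ContinuousLinearEquiv.map_eq_zero_iff _).mp h

end NearlyCosymplectic

section Submanifold

variable {E : Type*} [NormedAddCommGroup E] [NormedSpace ℝ E]
  {M : Type*} [TopologicalSpace M] [ChartedSpace E M]
  {F : Type*} [NormedAddCommGroup F] [NormedSpace ℝ F]
  {H : Type*} [TopologicalSpace H] {I : ModelWithCorners ℝ F H}
  {N : Type*} [TopologicalSpace N] [ChartedSpace H N] {ι : N → M} {x : N}

variable (E I) in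
/-- The differential of `ι` at `x`, as a map on the model vector space. -/
def coordDeriv (ι : N → M) (x : N) : F →ₗ[ℝ] TangentSpace 𝓘(ℝ, E) (ι x) :=
  (mfderiv I 𝓘(ℝ, E) ι x).toLinearMap ∘ₗ (tangentCoord I x).symm.toLinearMap

variable (E I) in
theorem range_coordDeriv (ι : N → M) (x : N) :
    LinearMap.range (coordDeriv E I ι x) = tangentImage E I ι x :=
  LinearMap.range_comp_of_range_eq_top _ (tangentCoord I x).symm.range

variable [RiemannianBundle (fun p : M ↦ TangentSpace 𝓘(ℝ, E) p)]

theorem inducedInner_eq_coordDeriv (v w : TangentSpace I x) :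
    inducedInner E I ι x v w = inner ℝ (coordDeriv E I ι x (tangentCoord I x v))
      (coordDeriv E I ι x (tangentCoord I x w)) := rfl

variable [FiniteDimensional ℝ E]

theorem normalPart_eq_normalComponent (v : TangentSpace 𝓘(ℝ, E) (ι x)) :
    normalPart E I ι x v = normalComponent (coordDeriv E I ι x) v := by
  rw [normalComponent, Submodule.starProjection_orthogonal_val]
  simp only [range_coordDeriv]
  rfl

theorem exists_coordDeriv_eq_of_normalPart_eq_zero {v : TangentSpace 𝓘(ℝ, E) (ι x)}
    (h : normalPart E I ι x v = 0) : ∃ t, coordDeriv E I ι x t = v := by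
  rw [normalPart, sub_eq_zero, eq_comm, tangentPart, Submodule.starProjection_eq_self_iff,
    ← range_coordDeriv] at h
  exact h

theorem exists_coordDeriv_eq_tangentPart (v : TangentSpace 𝓘(ℝ, E) (ι x)) :
    ∃ t, coordDeriv E I ι x t = tangentPart E I ι x v := by
  have h_mem := Submodule.starProjection_apply_mem (tangentImage E I ι x) v
  rwa [← range_coordDeriv] at h_mem

theorem inner_tangentPart (v : TangentSpace 𝓘(ℝ, E) (ι x)) (w : F) :
    inner ℝ (tangentPart E I ι x v) (coordDeriv E I ι x w) =
      inner ℝ v (coordDeriv E I ι x w) := by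
  have h := Submodule.starProjection_inner_eq_zero (K := tangentImage E I ι x) v
    (coordDeriv E I ι x w) ⟨_, rfl⟩
  rw [inner_sub_left, sub_eq_zero] at h
  exact h.symm

theorem mfderiv_orthonormalFrame (i : Fin (Module.finrank ℝ (tangentImage E I ι x))) :
    mfderiv I 𝓘(ℝ, E) ι x (orthonormalFrame E I ι x i) =
      stdOrthonormalBasis ℝ (tangentImage E I ι x) i :=
  Classical.choose_spec (stdOrthonormalBasis ℝ (tangentImage E I ι x) i).2

theorem isFrame_orthonormalFrame (h : Function.Injective (coordDeriv E I ι x)) :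
    IsFrame (coordDeriv E I ι x) (fun i ↦ tangentCoord I x (orthonormalFrame E I ι x i)) :=
  .of_orthonormalBasis h (stdOrthonormalBasis ℝ (tangentImage E I ι x)) mfderiv_orthonormalFrame

theorem inducedInner_inducedGradient (h : Function.Injective (coordDeriv E I ι x)) (u : N → ℝ)
    (v : TangentSpace I x) :
    inducedInner E I ι x (inducedGradient E I ι u x) v =
      tangentCoord 𝓘(ℝ, ℝ) (u x) (mfderiv I 𝓘(ℝ, ℝ) u x v) := by
  obtain ⟨g, hg⟩ := (isFrame_orthonormalFrame h).exists_gradient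
    ((tangentCoord 𝓘(ℝ, ℝ) (u x)).toLinearMap ∘ₗ (mfderiv I 𝓘(ℝ, ℝ) u x).toLinearMap ∘ₗ
      (tangentCoord I x).symm.toLinearMap)
  have h_exists : ∃ w, ∀ v, inducedInner E I ι x w v =
      tangentCoord 𝓘(ℝ, ℝ) (u x) (mfderiv I 𝓘(ℝ, ℝ) u x v) :=
    ⟨(tangentCoord I x).symm g, fun v ↦ hg (tangentCoord I x v)⟩
  exact Classical.epsilon_spec h_exists v

section AmbientDerivative

variable {B : F →ₗ[ℝ] F →ₗ[ℝ] TangentSpace 𝓘(ℝ, E) (ι x)}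
  (hB : ∀ v w, ambientDeriv E I ι x v w = B (tangentCoord I x v) (tangentCoord I x w))

include hB

theorem secondFundamentalForm_eq_secondForm (v w : TangentSpace I x) :
    secondFundamentalForm E I ι x v w =
      secondForm (coordDeriv E I ι x) B (tangentCoord I x v) (tangentCoord I x w) := by
  rw [secondFundamentalForm, hB, normalPart_eq_normalComponent, secondForm_apply]

theorem secondFundamentalFormNormSq_eq_sum :
    secondFundamentalFormNormSq E I ι x = ∑ i, ∑ j, ‖secondForm (coordDeriv E I ι x) B
      (tangentCoord I x (orthonormalFrame E I ι x i))
      (tangentCoord I x (orthonormalFrame E I ι x j))‖ ^ 2 := by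
  simp only [secondFundamentalFormNormSq, secondFundamentalForm_eq_secondForm hB,
    real_inner_self_eq_norm_sq]

theorem meanCurvature_eq_zero
    (h : ∑ i, secondForm (coordDeriv E I ι x) B
      (tangentCoord I x (orthonormalFrame E I ι x i))
      (tangentCoord I x (orthonormalFrame E I ι x i)) = 0) :
    meanCurvature E I ι x = 0 := by
  simp only [meanCurvature, secondFundamentalForm_eq_secondForm hB, h, smul_zero]

end AmbientDerivative

theorem isTotallyUmbilical_of_forall_exists
    (h : ∀ x, ∃ K, ∀ v w, secondFundamentalForm E I ι x v w = inducedInner E I ι x v w • K) :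
    IsTotallyUmbilical E I ι := by
  intro x v w
  obtain ⟨K, hK⟩ := h x
  rw [hK]
  rcases eq_or_ne (Module.finrank ℝ (tangentImage E I ι x)) 0 with h_dim | h_dim
  · have h_mem : mfderiv I 𝓘(ℝ, E) ι x v ∈ tangentImage E I ι x := ⟨v, rfl⟩
    rw [Submodule.finrank_eq_zero.mp h_dim, Submodule.mem_bot] at h_mem
    rw [inducedInner, h_mem, inner_zero_left, zero_smul, zero_smul]
  · have h_frame : ∀ i, inducedInner E I ι x (orthonormalFrame E I ι x i)
        (orthonormalFrame E I ι x i) = 1 := by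
      intro i
      rw [inducedInner, mfderiv_orthonormalFrame, ← Submodule.coe_inner, real_inner_self_eq_norm_sq,
        (stdOrthonormalBasis ℝ (tangentImage E I ι x)).norm_eq_one, one_pow]
    have h_mean : meanCurvature E I ι x = K := by
      simp only [meanCurvature, hK, h_frame, one_smul, Finset.sum_const, Finset.card_univ,
        Fintype.card_fin]
      rw [← Nat.cast_smul_eq_nsmul ℝ, smul_smul, one_div_mul_cancel (Nat.cast_ne_zero.mpr h_dim),
        one_smul]
    rw [h_mean]

end Submanifold

section LeafDifferentials

variable {E : Type*} [NormedAddCommGroup E] [NormedSpace ℝ E]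
  {M : Type*} [TopologicalSpace M] [ChartedSpace E M]
  {E₁ : Type*} [NormedAddCommGroup E₁] [NormedSpace ℝ E₁]
  {N₁ : Type*} [TopologicalSpace N₁] [ChartedSpace E₁ N₁]
  {E₂ : Type*} [NormedAddCommGroup E₂] [NormedSpace ℝ E₂]
  {N₂ : Type*} [TopologicalSpace N₂] [ChartedSpace E₂ N₂]
  {ι : N₁ × N₂ → M} {a : N₁} {b : N₂}
  (h : MDifferentiableAt (𝓘(ℝ, E₁).prod 𝓘(ℝ, E₂)) 𝓘(ℝ, E) ι (a, b))

include h

theorem coordDeriv_horizontal_leaf :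
    coordDeriv E 𝓘(ℝ, E₁) (fun a' ↦ ι (a', b)) a =
      coordDeriv E (𝓘(ℝ, E₁).prod 𝓘(ℝ, E₂)) ι (a, b) ∘ₗ LinearMap.inl ℝ E₁ E₂ := by
  have h_inl : MDifferentiableAt 𝓘(ℝ, E₁) (𝓘(ℝ, E₁).prod 𝓘(ℝ, E₂)) (fun a' : N₁ ↦ (a', b)) a :=
    mdifferentiableAt_id.prodMk mdifferentiableAt_const
  have h_comp := mfderiv_comp a h h_inl
  rw [mfderiv_prod_left] at h_comp
  ext v
  exact DFunLike.congr_fun h_comp v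

theorem coordDeriv_vertical_leaf :
    coordDeriv E 𝓘(ℝ, E₂) (fun b' ↦ ι (a, b')) b =
      coordDeriv E (𝓘(ℝ, E₁).prod 𝓘(ℝ, E₂)) ι (a, b) ∘ₗ LinearMap.inr ℝ E₁ E₂ := by
  have h_inr : MDifferentiableAt 𝓘(ℝ, E₂) (𝓘(ℝ, E₁).prod 𝓘(ℝ, E₂)) (fun b' : N₂ ↦ (a, b')) b :=
    mdifferentiableAt_const.prodMk mdifferentiableAt_id
  have h_comp := mfderiv_comp b h h_inr
  rw [mfderiv_prod_right] at h_comp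
  ext v
  exact DFunLike.congr_fun h_comp v

end LeafDifferentials

section Immersion

variable {E : Type*} [NormedAddCommGroup E] [NormedSpace ℝ E]
  {M : Type*} [TopologicalSpace M] [ChartedSpace E M]
  [RiemannianBundle (fun p : M ↦ TangentSpace 𝓘(ℝ, E) p)]
  {E₁ : Type*} [NormedAddCommGroup E₁] [NormedSpace ℝ E₁]
  {N₁ : Type*} [TopologicalSpace N₁] [ChartedSpace E₁ N₁]
  [RiemannianBundle (fun p : N₁ ↦ TangentSpace 𝓘(ℝ, E₁) p)]
  {E₂ : Type*} [NormedAddCommGroup E₂] [NormedSpace ℝ E₂]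
  {N₂ : Type*} [TopologicalSpace N₂] [ChartedSpace E₂ N₂]
  [RiemannianBundle (fun p : N₂ ↦ TangentSpace 𝓘(ℝ, E₂) p)]
  {f : N₁ → ℝ} {ι : N₁ × N₂ → M}

namespace IsWarpedProductImmersion

theorem mdifferentiableAt (hM : IsWarpedProductImmersion E E₁ E₂ f ι) (p : N₁ × N₂) :
    MDifferentiableAt (𝓘(ℝ, E₁).prod 𝓘(ℝ, E₂)) 𝓘(ℝ, E) ι p :=
  (hM.smooth_ι p).mdifferentiableAt (by simp)

theorem inner_coordDeriv (hM : IsWarpedProductImmersion E E₁ E₂ f ι) (a : N₁) (b : N₂)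
    (v w : E₁ × E₂) :
    inner ℝ (coordDeriv E (𝓘(ℝ, E₁).prod 𝓘(ℝ, E₂)) ι (a, b) v)
        (coordDeriv E (𝓘(ℝ, E₁).prod 𝓘(ℝ, E₂)) ι (a, b) w) =
      inner ℝ ((tangentCoord 𝓘(ℝ, E₁) a).symm v.1) ((tangentCoord 𝓘(ℝ, E₁) a).symm w.1) +
        f a ^ 2 *
          inner ℝ ((tangentCoord 𝓘(ℝ, E₂) b).symm v.2) ((tangentCoord 𝓘(ℝ, E₂) b).symm w.2) :=
  hM.isometric a b ((tangentCoord 𝓘(ℝ, E₁) a).symm v.1) ((tangentCoord 𝓘(ℝ, E₁) a).symm w.1)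
    ((tangentCoord 𝓘(ℝ, E₂) b).symm v.2) ((tangentCoord 𝓘(ℝ, E₂) b).symm w.2)

theorem coordDeriv_injective (hM : IsWarpedProductImmersion E E₁ E₂ f ι) (p : N₁ × N₂) :
    Function.Injective (coordDeriv E (𝓘(ℝ, E₁).prod 𝓘(ℝ, E₂)) ι p) := by
  obtain ⟨a, b⟩ := p
  rw [injective_iff_map_eq_zero]
  intro v hv
  have h_norm := hM.inner_coordDeriv a b v v
  have hf := pow_pos (hM.f_pos a) 2
  rw [hv, inner_zero_left, real_inner_self_eq_norm_sq, real_inner_self_eq_norm_sq, eq_comm,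
    add_eq_zero_iff_of_nonneg (sq_nonneg _) (by positivity), mul_eq_zero,
    or_iff_right hf.ne'] at h_norm
  simp only [sq_eq_zero_iff, norm_eq_zero, ContinuousLinearEquiv.map_eq_zero_iff] at h_norm
  exact Prod.ext h_norm.1 h_norm.2

theorem inner_coordDeriv_inl_inr (hM : IsWarpedProductImmersion E E₁ E₂ f ι) (p : N₁ × N₂)
    (x : E₁) (z : E₂) :
    inner ℝ (coordDeriv E (𝓘(ℝ, E₁).prod 𝓘(ℝ, E₂)) ι p (x, 0))
      (coordDeriv E (𝓘(ℝ, E₁).prod 𝓘(ℝ, E₂)) ι p (0, z)) = 0 := by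
  simp [hM.inner_coordDeriv]

end IsWarpedProductImmersion

variable [FiniteDimensional ℝ E] [IsManifold 𝓘(ℝ, E) ∞ M]
  {S : AlmostContactMetricStructure E M} {θ : ℝ}

variable (E E₁ E₂) in
/-- `ι` presents `N₁ ×_f N₂` as a warped product of leaves `N₁ × {b}` that are invariant and tangent
to `ξ` and leaves `{a} × N₂` that are slant and not invariant. Unlike proper slant leaves, the
latter may be anti-invariant, which is the case `θ = π / 2`. -/
structure IsWarpedProductInvariantSlant (S : AlmostContactMetricStructure E M) (f : N₁ → ℝ)
    (ι : N₁ × N₂ → M) (θ : ℝ) : Prop extends IsWarpedProductImmersion E E₁ E₂ f ι where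
  ξ_tangent : ∀ a b, S.ξ (ι (a, b)) ∈ tangentImage E 𝓘(ℝ, E₁) (fun a' ↦ ι (a', b)) a
  invariant : ∀ b, IsInvariant E 𝓘(ℝ, E₁) S (fun a ↦ ι (a, b))
  slant : ∀ a, IsSlant E 𝓘(ℝ, E₂) S (fun b ↦ ι (a, b)) θ
  not_invariant : ∀ a, ¬ IsInvariant E 𝓘(ℝ, E₂) S (fun b ↦ ι (a, b))

theorem IsWarpedProductSemiSlant.isWarpedProductInvariantSlant
    (hM : IsWarpedProductSemiSlant E E₁ E₂ S f ι θ) :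
    IsWarpedProductInvariantSlant E E₁ E₂ S f ι θ where
  toIsWarpedProductImmersion := hM.toIsWarpedProductImmersion
  ξ_tangent := hM.ξ_tangent
  invariant := hM.invariant
  slant a := (hM.properSlant a).1
  not_invariant a := (hM.properSlant a).2.1

theorem norm_sq_eq_cos_angle_sq_mul {V : Type*} [NormedAddCommGroup V] [InnerProductSpace ℝ V]
    {v t : V} (h : inner ℝ v t = ‖t‖ ^ 2) :
    ‖t‖ ^ 2 = Real.cos (InnerProductGeometry.angle v t) ^ 2 * ‖v‖ ^ 2 := by
  rcases eq_or_ne t 0 with rfl | ht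
  · simp
  have h_cos := InnerProductGeometry.cos_angle_mul_norm_mul_norm v t
  rw [h, ← mul_assoc, sq, mul_left_inj' (norm_ne_zero_iff.mpr ht)] at h_cos
  rw [← h_cos, mul_pow]

namespace IsWarpedProductInvariantSlant

section

variable (hM : IsWarpedProductInvariantSlant E E₁ E₂ S f ι θ) (a : N₁) (b : N₂)

include hM

theorem exists_map_horizontal (x : E₁) :
    ∃ y, S.φ (ι (a, b)) (coordDeriv E (𝓘(ℝ, E₁).prod 𝓘(ℝ, E₂)) ι (a, b) (x, 0)) =
      coordDeriv E (𝓘(ℝ, E₁).prod 𝓘(ℝ, E₂)) ι (a, b) (y, 0) := by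
  have h_leaf := coordDeriv_horizontal_leaf (hM.mdifferentiableAt (a, b))
  obtain ⟨y, hy⟩ := exists_coordDeriv_eq_of_normalPart_eq_zero (hM.invariant b a
    (coordDeriv E 𝓘(ℝ, E₁) (fun a' ↦ ι (a', b)) a x) ⟨_, rfl⟩)
  rw [h_leaf] at hy
  exact ⟨y, hy.symm⟩

theorem exists_reeb_eq :
    ∃ x, S.ξ (ι (a, b)) = coordDeriv E (𝓘(ℝ, E₁).prod 𝓘(ℝ, E₂)) ι (a, b) (x, 0) := by
  have h_mem := hM.ξ_tangent a b
  rw [← range_coordDeriv, coordDeriv_horizontal_leaf (hM.mdifferentiableAt (a, b))] at h_mem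
  obtain ⟨x, hx⟩ := h_mem
  exact ⟨x, hx.symm⟩

theorem inner_reeb_vertical (z : E₂) : inner ℝ (S.ξ (ι (a, b)))
    (coordDeriv E (𝓘(ℝ, E₁).prod 𝓘(ℝ, E₂)) ι (a, b) (0, z)) = 0 := by
  obtain ⟨x, hx⟩ := hM.exists_reeb_eq a b
  rw [hx, hM.inner_coordDeriv_inl_inr]

theorem inner_map_horizontal_vertical (x : E₁) (z : E₂) :
    inner ℝ (S.φ (ι (a, b)) (coordDeriv E (𝓘(ℝ, E₁).prod 𝓘(ℝ, E₂)) ι (a, b) (x, 0)))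
      (coordDeriv E (𝓘(ℝ, E₁).prod 𝓘(ℝ, E₂)) ι (a, b) (0, z)) = 0 := by
  obtain ⟨y, hy⟩ := hM.exists_map_horizontal a b x
  rw [hy, hM.inner_coordDeriv_inl_inr]

theorem norm_map_vertical (z : E₂) :
    ‖S.φ (ι (a, b)) (coordDeriv E (𝓘(ℝ, E₁).prod 𝓘(ℝ, E₂)) ι (a, b) (0, z))‖ =
      ‖coordDeriv E (𝓘(ℝ, E₁).prod 𝓘(ℝ, E₂)) ι (a, b) (0, z)‖ := by
  have h := S.inner_φ_φ (ι (a, b)) (coordDeriv E (𝓘(ℝ, E₁).prod 𝓘(ℝ, E₂)) ι (a, b) (0, z))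
    (coordDeriv E (𝓘(ℝ, E₁).prod 𝓘(ℝ, E₂)) ι (a, b) (0, z))
  rw [S.η_eq_inner, real_inner_comm (S.ξ _), hM.inner_reeb_vertical, mul_zero, sub_zero,
    real_inner_self_eq_norm_sq, real_inner_self_eq_norm_sq] at h
  exact (pow_left_inj₀ (norm_nonneg _) (norm_nonneg _) two_ne_zero).mp h

theorem norm_sq_tangentPart_map_vertical (z : E₂) :
    ‖tangentPart E 𝓘(ℝ, E₂) (fun b' ↦ ι (a, b')) b
        (S.φ (ι (a, b)) (coordDeriv E (𝓘(ℝ, E₁).prod 𝓘(ℝ, E₂)) ι (a, b) (0, z)))‖ ^ 2 =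
      Real.cos θ ^ 2 * ‖coordDeriv E (𝓘(ℝ, E₁).prod 𝓘(ℝ, E₂)) ι (a, b) (0, z)‖ ^ 2 := by
  have h_leaf := coordDeriv_vertical_leaf (hM.mdifferentiableAt (a, b))
  set X := coordDeriv E (𝓘(ℝ, E₁).prod 𝓘(ℝ, E₂)) ι (a, b) (0, z) with hX
  rcases eq_or_ne X 0 with h0 | h0
  · simp [h0, tangentPart]
  have h_span : X ∉ Submodule.span ℝ {S.ξ (ι (a, b))} := by
    rintro h_mem
    obtain ⟨c, hc⟩ := Submodule.mem_span_singleton.mp h_mem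
    refine h0 (inner_self_eq_zero (𝕜 := ℝ).mp ?_)
    nth_rewrite 1 [← hc]
    rw [real_inner_smul_left, hX, hM.inner_reeb_vertical, mul_zero]
  have h_mem : X ∈ tangentImage E 𝓘(ℝ, E₂) (fun b' ↦ ι (a, b')) b := by
    rw [← range_coordDeriv, h_leaf]
    exact ⟨z, rfl⟩
  obtain ⟨t, ht⟩ := exists_coordDeriv_eq_tangentPart (I := 𝓘(ℝ, E₂)) (ι := fun b' ↦ ι (a, b'))
    (S.φ (ι (a, b)) X)
  have h_inner := inner_tangentPart (I := 𝓘(ℝ, E₂)) (ι := fun b' ↦ ι (a, b'))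
    (S.φ (ι (a, b)) X) t
  rw [ht, real_inner_self_eq_norm_sq] at h_inner
  rw [norm_sq_eq_cos_angle_sq_mul h_inner.symm, hM.slant a b X h_mem h_span, hX,
    hM.norm_map_vertical]

theorem exists_isTangentialPart (z : E₂) :
    ∃ y, IsTangentialPart (coordDeriv E (𝓘(ℝ, E₁).prod 𝓘(ℝ, E₂)) ι (a, b)) (S.φ (ι (a, b))) z y ∧
      ‖coordDeriv E (𝓘(ℝ, E₁).prod 𝓘(ℝ, E₂)) ι (a, b) (0, y)‖ ^ 2 =
        Real.cos θ ^ 2 * ‖coordDeriv E (𝓘(ℝ, E₁).prod 𝓘(ℝ, E₂)) ι (a, b) (0, z)‖ ^ 2 := by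
  have h_leaf := coordDeriv_vertical_leaf (hM.mdifferentiableAt (a, b))
  set X := coordDeriv E (𝓘(ℝ, E₁).prod 𝓘(ℝ, E₂)) ι (a, b) (0, z) with hX
  obtain ⟨y, hy⟩ := exists_coordDeriv_eq_tangentPart (I := 𝓘(ℝ, E₂)) (ι := fun b' ↦ ι (a, b'))
    (S.φ (ι (a, b)) X)
  have h_inner := inner_tangentPart (I := 𝓘(ℝ, E₂)) (ι := fun b' ↦ ι (a, b'))
    (S.φ (ι (a, b)) X)
  have h_norm := hM.norm_sq_tangentPart_map_vertical a b z
  rw [← hX, ← hy, h_leaf] at h_norm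
  rw [← hy, h_leaf] at h_inner
  exact ⟨y, fun w ↦ (h_inner w).symm, h_norm⟩

end

theorem sin_ne_zero (hM : IsWarpedProductInvariantSlant E E₁ E₂ S f ι θ) (a : N₁) :
    Real.sin θ ≠ 0 := by
  refine fun h_sin ↦ hM.not_invariant a ?_
  rintro b _ ⟨z, rfl⟩
  have h_leaf := coordDeriv_vertical_leaf (hM.mdifferentiableAt (a, b))
  have h_norm := hM.norm_sq_tangentPart_map_vertical a b (tangentCoord 𝓘(ℝ, E₂) b z)
  rw [Real.cos_sq', h_sin, zero_pow two_ne_zero, sub_zero, one_mul,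
    pow_left_inj₀ (norm_nonneg _) (norm_nonneg _) two_ne_zero, ← hM.norm_map_vertical] at h_norm
  change normalPart E 𝓘(ℝ, E₂) (fun b' ↦ ι (a, b')) b
    (S.φ (ι (a, b)) (coordDeriv E 𝓘(ℝ, E₂) (fun b' ↦ ι (a, b')) b
      (tangentCoord 𝓘(ℝ, E₂) b z))) = 0
  rw [h_leaf, normalPart, sub_eq_zero, eq_comm]
  exact Submodule.starProjection_eq_self_iff.mpr
    ((Submodule.mem_iff_norm_starProjection _ _).mpr h_norm)

end IsWarpedProductInvariantSlant

end Immersion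

section ChartReading

open Filter Topology

variable {E : Type*} [NormedAddCommGroup E] [NormedSpace ℝ E]
  {M : Type*} [TopologicalSpace M] [ChartedSpace E M]
  {F : Type*} [NormedAddCommGroup F] [NormedSpace ℝ F]
  {H : Type*} [TopologicalSpace H] {I : ModelWithCorners ℝ F H} [I.Boundaryless]
  {N : Type*} [TopologicalSpace N] [ChartedSpace H N] {ι : N → M}

theorem contDiffAt_writtenInExtChartAt (hι : ContMDiff I 𝓘(ℝ, E) ∞ ι) (x : N) :
    ContDiffAt ℝ 2 (writtenInExtChartAt I 𝓘(ℝ, E) x ι) (extChartAt I x x) := by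
  have h := (contMDiffAt_iff.mp (hι x)).2
  rw [I.range_eq_univ, contDiffWithinAt_univ] at h
  exact h.of_le (by norm_cast)

theorem coordDeriv_eq_fderiv {x : N} (hι : MDifferentiableAt I 𝓘(ℝ, E) ι x) (v : F) :
    coordDeriv E I ι x v = (tangentCoord 𝓘(ℝ, E) (ι x)).symm
      (fderiv ℝ (writtenInExtChartAt I 𝓘(ℝ, E) x ι) (extChartAt I x x) v) := by
  have h := hι.mfderiv
  rw [I.range_eq_univ, fderivWithin_univ] at h
  exact DFunLike.congr_fun h v

theorem eventually_mem_target_and_mem_source {x : N} (hι : ContinuousAt ι x) :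
    ∀ᶠ y in 𝓝 (extChartAt I x x), y ∈ (extChartAt I x).target ∧
      ι ((extChartAt I x).symm y) ∈ (extChartAt 𝓘(ℝ, E) (ι x)).source := by
  have h_tendsto : Tendsto (fun y ↦ ι ((extChartAt I x).symm y)) (𝓝 (extChartAt I x x))
      (𝓝 (ι x)) := by
    refine Tendsto.comp (y := 𝓝 x) hι ?_
    simpa only [ContinuousAt, extChartAt_to_inv] using continuousAt_extChartAt_symm (I := I) x
  exact (Filter.Eventually.and (extChartAt_target_mem_nhds x)
    (h_tendsto.eventually (extChartAt_source_mem_nhds (I := 𝓘(ℝ, E)) (ι x))))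

variable (I) in
/-- The value at the point of coordinates `y` of the vector field with constant coordinates `v` in
the preferred chart at `x`, read on the model space: the counterpart of `coordVec` for any model. -/
def chartVec (x : N) (y v : F) : F :=
  tangentCoord I _ (mfderiv 𝓘(ℝ, F) I (extChartAt I x).symm y ((tangentCoord 𝓘(ℝ, F) y).symm v))

theorem constField_fderiv [IsManifold 𝓘(ℝ, E) ∞ M] [IsManifold I ∞ N] {x : N} {y : F}
    (hy : y ∈ (extChartAt I x).target)
    (hq : ι ((extChartAt I x).symm y) ∈ (extChartAt 𝓘(ℝ, E) (ι x)).source)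
    (hι : MDifferentiableAt I 𝓘(ℝ, E) ι ((extChartAt I x).symm y)) (v : F) :
    constField (ι x) (fderiv ℝ (writtenInExtChartAt I 𝓘(ℝ, E) x ι) y v)
        (ι ((extChartAt I x).symm y)) =
      coordDeriv E I ι ((extChartAt I x).symm y) (chartVec I x y v) := by
  have h_symm : MDifferentiableAt 𝓘(ℝ, F) I (extChartAt I x).symm y := by
    simpa only [I.range_eq_univ, mdifferentiableWithinAt_univ] using
      mdifferentiableWithinAt_extChartAt_symm hy
  have h_chart : MDifferentiableAt 𝓘(ℝ, E) 𝓘(ℝ, E) (extChartAt 𝓘(ℝ, E) (ι x))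
      (ι ((extChartAt I x).symm y)) :=
    mdifferentiableAt_extChartAt (by rwa [extChartAt_source] at hq)
  have h_comp := mfderiv_comp y (h_chart.comp _ hι) h_symm
  rw [mfderiv_comp _ h_chart hι, mfderiv_eq_fderiv] at h_comp
  refine (congrArg (fun w : E ↦ constField (ι x) w _) (DFunLike.congr_fun h_comp v)).trans ?_
  exact constField_mfderiv hq _

variable [RiemannianBundle (fun p : M ↦ TangentSpace 𝓘(ℝ, E) p)]

section

variable [IsManifold 𝓘(ℝ, E) ∞ M] [IsManifold I ∞ N] {x : N} {y : F}
  (hy : y ∈ (extChartAt I x).target)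
  (hq : ι ((extChartAt I x).symm y) ∈ (extChartAt 𝓘(ℝ, E) (ι x)).source)
  (hι : MDifferentiableAt I 𝓘(ℝ, E) ι ((extChartAt I x).symm y))

include hy hq hι

theorem chartMetric_fderiv (v w : F) :
    chartMetric (ι x) (writtenInExtChartAt I 𝓘(ℝ, E) x ι y)
        (fderiv ℝ (writtenInExtChartAt I 𝓘(ℝ, E) x ι) y v)
        (fderiv ℝ (writtenInExtChartAt I 𝓘(ℝ, E) x ι) y w) =
      inner ℝ (coordDeriv E I ι ((extChartAt I x).symm y) (chartVec I x y v))
        (coordDeriv E I ι ((extChartAt I x).symm y) (chartVec I x y w)) := by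
  rw [← constField_fderiv hy hq hι, ← constField_fderiv hy hq hι]
  exact chartMetric_extChartAt hq _ _

theorem chartMetric_chartMap_fderiv (S : AlmostContactMetricStructure E M) (v w : F) :
    chartMetric (ι x) (writtenInExtChartAt I 𝓘(ℝ, E) x ι y)
        (chartMap S (ι x) (writtenInExtChartAt I 𝓘(ℝ, E) x ι y)
          (fderiv ℝ (writtenInExtChartAt I 𝓘(ℝ, E) x ι) y v))
        (fderiv ℝ (writtenInExtChartAt I 𝓘(ℝ, E) x ι) y w) =
      inner ℝ (S.φ _ (coordDeriv E I ι ((extChartAt I x).symm y) (chartVec I x y v)))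
        (coordDeriv E I ι ((extChartAt I x).symm y) (chartVec I x y w)) := by
  rw [← constField_fderiv hy hq hι, ← constField_fderiv hy hq hι, ← constField_chartMap S hq]
  exact chartMetric_extChartAt hq _ _

theorem chartMetric_reeb_fderiv (S : AlmostContactMetricStructure E M) (w : F) :
    chartMetric (ι x) (writtenInExtChartAt I 𝓘(ℝ, E) x ι y)
        (coordRep (ι x) S.ξ (writtenInExtChartAt I 𝓘(ℝ, E) x ι y))
        (fderiv ℝ (writtenInExtChartAt I 𝓘(ℝ, E) x ι) y w) =
      inner ℝ (S.ξ (ι ((extChartAt I x).symm y)))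
        (coordDeriv E I ι ((extChartAt I x).symm y) (chartVec I x y w)) := by
  rw [← constField_fderiv hy hq hι, ← constField_coordRep hq S.ξ]
  exact chartMetric_extChartAt hq _ _

end

theorem ambientDeriv_eq_alongDeriv {x : N} (hι : MDifferentiableAt I 𝓘(ℝ, E) ι x)
    (v w : TangentSpace I x) :
    ambientDeriv E I ι x v w = (tangentCoord 𝓘(ℝ, E) (ι x)).symm
      (alongDeriv (writtenInExtChartAt I 𝓘(ℝ, E) x ι) (chartChristoffel (ι x)) (extChartAt I x x)
        (tangentCoord I x v) (tangentCoord I x w)) := by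
  have h (v : TangentSpace I x) := coordDeriv_eq_fderiv hι (tangentCoord I x v)
  rw [ambientDeriv, alongDeriv, chartChristoffel, ← h, ← h, map_add,
    ContinuousLinearEquiv.symm_apply_apply]
  rfl

variable [IsManifold 𝓘(ℝ, E) ∞ M] [FiniteDimensional ℝ E]
  [IsContMDiffRiemannianBundle 𝓘(ℝ, E) ∞ E (fun p : M ↦ TangentSpace 𝓘(ℝ, E) p)]

theorem ambientDeriv_symm (hι : ContMDiff I 𝓘(ℝ, E) ∞ ι) (x : N) (v w : TangentSpace I x) :
    ambientDeriv E I ι x v w = ambientDeriv E I ι x w v := by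
  have hx := hι.mdifferentiable (by simp) x
  rw [ambientDeriv_eq_alongDeriv hx, ambientDeriv_eq_alongDeriv hx,
    (riemannianChart (ι x)).alongDeriv_symm (contDiffAt_writtenInExtChartAt hι x)]

theorem ambientDeriv_add (hι : ContMDiff I 𝓘(ℝ, E) ∞ ι) (x : N) (v w w' : TangentSpace I x) :
    ambientDeriv E I ι x v (w + w') = ambientDeriv E I ι x v w + ambientDeriv E I ι x v w' := by
  have hx := hι.mdifferentiable (by simp) x
  simp only [ambientDeriv_eq_alongDeriv hx, map_add, (riemannianChart (ι x)).alongDeriv_add]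

theorem ambientDeriv_smul (hι : ContMDiff I 𝓘(ℝ, E) ∞ ι) (x : N) (c : ℝ)
    (v w : TangentSpace I x) :
    ambientDeriv E I ι x v (c • w) = c • ambientDeriv E I ι x v w := by
  have hx := hι.mdifferentiable (by simp) x
  simp only [ambientDeriv_eq_alongDeriv hx, map_smul, (riemannianChart (ι x)).alongDeriv_smul]

/-- `ambientDeriv`, as a bilinear map on the model space. -/
def ambientForm (hι : ContMDiff I 𝓘(ℝ, E) ∞ ι) (x : N) :
    F →ₗ[ℝ] F →ₗ[ℝ] TangentSpace 𝓘(ℝ, E) (ι x) :=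
  LinearMap.mk₂ ℝ
    (fun v w ↦ ambientDeriv E I ι x ((tangentCoord I x).symm v) ((tangentCoord I x).symm w))
    (fun v v' w ↦ by
      rw [map_add, ambientDeriv_symm hι, ambientDeriv_add hι,
        ambientDeriv_symm hι x ((tangentCoord I x).symm v),
        ambientDeriv_symm hι x ((tangentCoord I x).symm v')])
    (fun c v w ↦ by
      rw [map_smul, ambientDeriv_symm hι, ambientDeriv_smul hι, ambientDeriv_symm hι])
    (fun v w w' ↦ by rw [map_add, ambientDeriv_add hι])
    (fun c v w ↦ by rw [map_smul, ambientDeriv_smul hι])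

theorem ambientDeriv_eq_ambientForm (hι : ContMDiff I 𝓘(ℝ, E) ∞ ι) (x : N)
    (v w : TangentSpace I x) :
    ambientDeriv E I ι x v w = ambientForm hι x (tangentCoord I x v) (tangentCoord I x w) :=
  rfl

end ChartReading

section ProductChart

open Filter Topology

variable {E₁ : Type*} [NormedAddCommGroup E₁] [NormedSpace ℝ E₁]
  {N₁ : Type*} [TopologicalSpace N₁] [ChartedSpace E₁ N₁]
  {E₂ : Type*} [NormedAddCommGroup E₂] [NormedSpace ℝ E₂]
  {N₂ : Type*} [TopologicalSpace N₂] [ChartedSpace E₂ N₂] {f : N₁ → ℝ}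

variable (E₁) in
/-- The warping function `f` in the preferred chart at `a`, divided by `f a`. -/
def chartWarping (f : N₁ → ℝ) (a : N₁) (s : E₁) : ℝ :=
  f ((extChartAt 𝓘(ℝ, E₁) a).symm s) / f a

theorem hasFDerivAt_chartWarping (hf : ContMDiff 𝓘(ℝ, E₁) 𝓘(ℝ, ℝ) ∞ f) (a : N₁) :
    HasFDerivAt (chartWarping E₁ f a)
      ((f a)⁻¹ • fderiv ℝ (fun s ↦ f ((extChartAt 𝓘(ℝ, E₁) a).symm s)) (extChartAt 𝓘(ℝ, E₁) a a))
      (extChartAt 𝓘(ℝ, E₁) a a) := by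
  have h_diff : DifferentiableAt ℝ (fun s ↦ f ((extChartAt 𝓘(ℝ, E₁) a).symm s))
      (extChartAt 𝓘(ℝ, E₁) a a) :=
    (contDiffAt_writtenInExtChartAt hf a).differentiableAt two_ne_zero
  exact h_diff.hasFDerivAt.mul_const (f a)⁻¹

theorem exists_chartVec_eq [IsManifold 𝓘(ℝ, E₂) ∞ N₂] {b : N₂} {t : E₂}
    (ht : t ∈ (extChartAt 𝓘(ℝ, E₂) b).target) (z : E₂) :
    ∃ w, chartVec 𝓘(ℝ, E₂) b t w = z :=
  ⟨_, congrArg (tangentCoord 𝓘(ℝ, E₂) _) (coordVec_mfderiv ht ((tangentCoord 𝓘(ℝ, E₂) _).symm z))⟩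

theorem mdifferentiableAt_extChartAt_symm [IsManifold 𝓘(ℝ, E₁) ∞ N₁] {a : N₁} {s : E₁}
    (hs : s ∈ (extChartAt 𝓘(ℝ, E₁) a).target) :
    MDifferentiableAt 𝓘(ℝ, E₁) 𝓘(ℝ, E₁) (extChartAt 𝓘(ℝ, E₁) a).symm s := by
  simpa only [ModelWithCorners.range_eq_univ, mdifferentiableWithinAt_univ] using
    mdifferentiableWithinAt_extChartAt_symm hs

theorem chartVec_prod [IsManifold 𝓘(ℝ, E₁) ∞ N₁] [IsManifold 𝓘(ℝ, E₂) ∞ N₂] {a : N₁} {b : N₂}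
    {q : E₁ × E₂} (hq : q ∈ (extChartAt (𝓘(ℝ, E₁).prod 𝓘(ℝ, E₂)) (a, b)).target) (v : E₁ × E₂) :
    chartVec (𝓘(ℝ, E₁).prod 𝓘(ℝ, E₂)) (a, b) q v =
      (chartVec 𝓘(ℝ, E₁) a q.1 v.1, chartVec 𝓘(ℝ, E₂) b q.2 v.2) := by
  rw [extChartAt_prod, PartialEquiv.prod_target] at hq
  have h_fst := (mdifferentiableAt_extChartAt_symm hq.1).hasMFDerivAt.comp q
    (hasFDerivAt_fst (𝕜 := ℝ) (E := E₁) (F := E₂) (p := q)).hasMFDerivAt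
  have h_snd := (mdifferentiableAt_extChartAt_symm hq.2).hasMFDerivAt.comp q
    (hasFDerivAt_snd (𝕜 := ℝ) (E := E₁) (F := E₂) (p := q)).hasMFDerivAt
  exact DFunLike.congr_fun (h_fst.prodMk h_snd).mfderiv v

theorem coordVec_zero (a : N₁) (s : E₁) : coordVec a s (0 : E₁) = 0 := by
  rw [coordVec, map_zero, map_zero]

theorem chartVec_zero (b : N₂) (t : E₂) : chartVec 𝓘(ℝ, E₂) b t 0 = 0 := by
  rw [chartVec, map_zero, map_zero, map_zero]

end ProductChart

section ImmersionChart

open Filter Topology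

variable {E : Type*} [NormedAddCommGroup E] [NormedSpace ℝ E]
  {M : Type*} [TopologicalSpace M] [ChartedSpace E M] [IsManifold 𝓘(ℝ, E) ∞ M]
  [RiemannianBundle (fun p : M ↦ TangentSpace 𝓘(ℝ, E) p)]
  {E₁ : Type*} [NormedAddCommGroup E₁] [NormedSpace ℝ E₁]
  {N₁ : Type*} [TopologicalSpace N₁] [ChartedSpace E₁ N₁]
  [RiemannianBundle (fun p : N₁ ↦ TangentSpace 𝓘(ℝ, E₁) p)]
  {E₂ : Type*} [NormedAddCommGroup E₂] [NormedSpace ℝ E₂]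
  {N₂ : Type*} [TopologicalSpace N₂] [ChartedSpace E₂ N₂] [IsManifold 𝓘(ℝ, E₂) ∞ N₂]
  [RiemannianBundle (fun p : N₂ ↦ TangentSpace 𝓘(ℝ, E₂) p)]
  {f : N₁ → ℝ} {ι : N₁ × N₂ → M}

theorem IsWarpedProductInvariantSlant.exists_isTangentialPart_chartVec [FiniteDimensional ℝ E]
    {S : AlmostContactMetricStructure E M} {θ : ℝ}
    (hM : IsWarpedProductInvariantSlant E E₁ E₂ S f ι θ) {a : N₁} {b : N₂} {q : E₁ × E₂}
    (hq : q ∈ (extChartAt (𝓘(ℝ, E₁).prod 𝓘(ℝ, E₂)) (a, b)).target) (z : E₂) :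
    ∃ t, IsTangentialPart
        (coordDeriv E (𝓘(ℝ, E₁).prod 𝓘(ℝ, E₂)) ι
          ((extChartAt (𝓘(ℝ, E₁).prod 𝓘(ℝ, E₂)) (a, b)).symm q))
        (S.φ (ι ((extChartAt (𝓘(ℝ, E₁).prod 𝓘(ℝ, E₂)) (a, b)).symm q)))
        (chartVec 𝓘(ℝ, E₂) b q.2 z) (chartVec 𝓘(ℝ, E₂) b q.2 t) ∧
      ‖coordDeriv E (𝓘(ℝ, E₁).prod 𝓘(ℝ, E₂)) ι
          ((extChartAt (𝓘(ℝ, E₁).prod 𝓘(ℝ, E₂)) (a, b)).symm q)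
          (0, chartVec 𝓘(ℝ, E₂) b q.2 t)‖ ^ 2 =
        Real.cos θ ^ 2 * ‖coordDeriv E (𝓘(ℝ, E₁).prod 𝓘(ℝ, E₂)) ι
          ((extChartAt (𝓘(ℝ, E₁).prod 𝓘(ℝ, E₂)) (a, b)).symm q)
          (0, chartVec 𝓘(ℝ, E₂) b q.2 z)‖ ^ 2 := by
  obtain ⟨y, hy⟩ := hM.exists_isTangentialPart ((extChartAt 𝓘(ℝ, E₁) a).symm q.1)
    ((extChartAt 𝓘(ℝ, E₂) b).symm q.2) (chartVec 𝓘(ℝ, E₂) b q.2 z)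
  rw [extChartAt_prod, PartialEquiv.prod_target] at hq
  obtain ⟨t, rfl⟩ := exists_chartVec_eq hq.2 y
  exact ⟨t, hy⟩

variable [IsManifold 𝓘(ℝ, E₁) ∞ N₁]

theorem IsWarpedProductImmersion.chartMetric_fderiv
    (hM : IsWarpedProductImmersion E E₁ E₂ f ι) {a : N₁} {b : N₂} {q : E₁ × E₂}
    (hq : q ∈ (extChartAt (𝓘(ℝ, E₁).prod 𝓘(ℝ, E₂)) (a, b)).target)
    (hι : ι ((extChartAt (𝓘(ℝ, E₁).prod 𝓘(ℝ, E₂)) (a, b)).symm q) ∈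
      (extChartAt 𝓘(ℝ, E) (ι (a, b))).source) (v w : E₁ × E₂) :
    chartMetric (ι (a, b)) (writtenInExtChartAt (𝓘(ℝ, E₁).prod 𝓘(ℝ, E₂)) 𝓘(ℝ, E) (a, b) ι q)
        (fderiv ℝ (writtenInExtChartAt (𝓘(ℝ, E₁).prod 𝓘(ℝ, E₂)) 𝓘(ℝ, E) (a, b) ι) q v)
        (fderiv ℝ (writtenInExtChartAt (𝓘(ℝ, E₁).prod 𝓘(ℝ, E₂)) 𝓘(ℝ, E) (a, b) ι) q w) =
      inner ℝ (coordVec a q.1 v.1) (coordVec a q.1 w.1) +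
        f ((extChartAt 𝓘(ℝ, E₁) a).symm q.1) ^ 2 *
          inner ℝ (coordVec b q.2 v.2) (coordVec b q.2 w.2) := by
  rw [WarpedSemiSlant.chartMetric_fderiv hq hι (hM.mdifferentiableAt _), chartVec_prod hq,
    chartVec_prod hq]
  exact hM.inner_coordDeriv _ _ _ _

variable [FiniteDimensional ℝ E] {S : AlmostContactMetricStructure E M} {θ : ℝ}

theorem IsWarpedProductInvariantSlant.warpedChart
    (hM : IsWarpedProductInvariantSlant E E₁ E₂ S f ι θ) (a : N₁) (b : N₂) :
    WarpedChart (chartMetric (ι (a, b))) (chartMap S (ι (a, b))) (coordRep (ι (a, b)) S.ξ)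
      (writtenInExtChartAt (𝓘(ℝ, E₁).prod 𝓘(ℝ, E₂)) 𝓘(ℝ, E) (a, b) ι)
      (extChartAt 𝓘(ℝ, E₁) a a, extChartAt 𝓘(ℝ, E₂) b b) (chartWarping E₁ f a) θ := by
  have h_dom : ∀ᶠ q in 𝓝 (extChartAt 𝓘(ℝ, E₁) a a, extChartAt 𝓘(ℝ, E₂) b b),
      q ∈ (extChartAt (𝓘(ℝ, E₁).prod 𝓘(ℝ, E₂)) (a, b)).target ∧
        ι ((extChartAt (𝓘(ℝ, E₁).prod 𝓘(ℝ, E₂)) (a, b)).symm q) ∈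
          (extChartAt 𝓘(ℝ, E) (ι (a, b))).source :=
    eventually_mem_target_and_mem_source hM.smooth_ι.continuous.continuousAt
  obtain ⟨h_target, h_source⟩ := h_dom.self_of_nhds
  refine ⟨contDiffAt_writtenInExtChartAt hM.smooth_ι (a, b),
    (hasFDerivAt_chartWarping hM.smooth_f a).differentiableAt, ?normalized, ?mixed, ?horizontal,
    ?vertical, ?invariant, ?reeb, ?slant⟩
  case normalized =>
    rw [chartWarping, extChartAt_to_inv, div_self (hM.f_pos a).ne']
  case mixed =>
    filter_upwards [h_dom] with q ⟨hq, hι⟩ x z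
    simp only [hM.chartMetric_fderiv hq hι, coordVec_zero, inner_zero_left, inner_zero_right,
      mul_zero, add_zero]
  case horizontal =>
    filter_upwards [(Continuous.prodMk_right _).continuousAt.eventually h_dom] with t ⟨ht, hι⟩ x y
    simp only [hM.chartMetric_fderiv ht hι, hM.chartMetric_fderiv h_target h_source,
      coordVec_zero, inner_zero_left, mul_zero]
  case vertical =>
    filter_upwards [(Continuous.prodMk_left _).continuousAt.eventually h_dom] with s ⟨hs, hι⟩ z w
    have hf := (hM.f_pos a).ne'
    simp only [hM.chartMetric_fderiv hs hι, hM.chartMetric_fderiv h_target h_source,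
      coordVec_zero, inner_zero_left, chartWarping, extChartAt_to_inv]
    field_simp
    ring
  case invariant =>
    filter_upwards [h_dom] with q ⟨hq, hι⟩ x z
    rw [chartMetric_chartMap_fderiv hq hι (hM.mdifferentiableAt _), chartVec_prod hq,
      chartVec_prod hq, chartVec_zero, chartVec_zero]
    exact hM.inner_map_horizontal_vertical _ _ _ _
  case reeb =>
    filter_upwards [h_dom] with q ⟨hq, hι⟩ z
    rw [chartMetric_reeb_fderiv hq hι (hM.mdifferentiableAt _), chartVec_prod hq, chartVec_zero]
    exact hM.inner_reeb_vertical _ _ _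
  case slant =>
    filter_upwards [h_dom] with q ⟨hq, hι⟩ z
    have hd := hM.mdifferentiableAt ((extChartAt (𝓘(ℝ, E₁).prod 𝓘(ℝ, E₂)) (a, b)).symm q)
    obtain ⟨t, ht, ht_sq⟩ := hM.exists_isTangentialPart_chartVec hq z
    simp only [WarpedSemiSlant.chartMetric_fderiv hq hι hd, chartMetric_chartMap_fderiv hq hι hd,
      chartVec_prod hq, chartVec_zero, real_inner_self_eq_norm_sq]
    exact ⟨t, fun w ↦ ht _, ht_sq⟩

end ImmersionChart

section LeafDerivatives

open Filter Topology

theorem alongDeriv_comp {E : Type*} [NormedAddCommGroup E] [NormedSpace ℝ E]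
    {F₀ : Type*} [NormedAddCommGroup F₀] [NormedSpace ℝ F₀]
    {F : Type*} [NormedAddCommGroup F] [NormedSpace ℝ F]
    {u : F → E} {Γ : E → E → E} {j : F₀ → F} {L : F₀ →L[ℝ] F} {y : F₀}
    (hu : ContDiffAt ℝ 2 u (j y)) (hj : ∀ t, HasFDerivAt j L t) (v w : F₀) :
    alongDeriv (fun t ↦ u (j t)) Γ y v w = alongDeriv u Γ (j y) (L v) (L w) := by
  have h_diff : ∀ᶠ z in 𝓝 (j y), DifferentiableAt ℝ u z :=
    (hu.eventually (by simp)).mono fun z hz ↦ hz.differentiableAt two_ne_zero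
  have h_fderiv : fderiv ℝ (fun t ↦ u (j t)) =ᶠ[𝓝 y] fun t ↦ (fderiv ℝ u (j t)).comp L := by
    filter_upwards [(hj y).continuousAt.eventually h_diff] with t ht
    exact (ht.hasFDerivAt.comp t (hj t)).fderiv
  have h_diff_fderiv : DifferentiableAt ℝ (fderiv ℝ u) (j y) :=
    (hu.fderiv_right (m := 1) (by norm_num)).differentiableAt one_ne_zero
  have h_second : HasFDerivAt (fun t ↦ (fderiv ℝ u (j t)).comp L) _ y :=
    (h_diff_fderiv.hasFDerivAt.comp y (hj y)).clm_comp (hasFDerivAt_const L y)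
  simp [alongDeriv, h_fderiv.fderiv_eq, h_second.fderiv, h_fderiv.self_of_nhds]

variable {E : Type*} [NormedAddCommGroup E] [NormedSpace ℝ E] [FiniteDimensional ℝ E]
  {M : Type*} [TopologicalSpace M] [ChartedSpace E M] [IsManifold 𝓘(ℝ, E) ∞ M]
  [RiemannianBundle (fun p : M ↦ TangentSpace 𝓘(ℝ, E) p)]
  [IsContMDiffRiemannianBundle 𝓘(ℝ, E) ∞ E (fun p : M ↦ TangentSpace 𝓘(ℝ, E) p)]
  {E₁ : Type*} [NormedAddCommGroup E₁] [NormedSpace ℝ E₁]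
  {N₁ : Type*} [TopologicalSpace N₁] [ChartedSpace E₁ N₁]
  {E₂ : Type*} [NormedAddCommGroup E₂] [NormedSpace ℝ E₂]
  {N₂ : Type*} [TopologicalSpace N₂] [ChartedSpace E₂ N₂] {ι : N₁ × N₂ → M}
  (hι : ContMDiff (𝓘(ℝ, E₁).prod 𝓘(ℝ, E₂)) 𝓘(ℝ, E) ∞ ι) (a : N₁) (b : N₂)

theorem ambientDeriv_horizontal_leaf (v w : TangentSpace 𝓘(ℝ, E₁) a) :
    ambientDeriv E 𝓘(ℝ, E₁) (fun a' ↦ ι (a', b)) a v w =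
      (ambientForm hι (a, b)).compl₁₂ (LinearMap.inl ℝ E₁ E₂) (LinearMap.inl ℝ E₁ E₂)
        (tangentCoord 𝓘(ℝ, E₁) a v) (tangentCoord 𝓘(ℝ, E₁) a w) := by
  have h_mdiff := hι.mdifferentiable (by simp) (a, b)
  have h_leaf : MDifferentiableAt 𝓘(ℝ, E₁) 𝓘(ℝ, E) (fun a' ↦ ι (a', b)) a :=
    h_mdiff.comp a (mdifferentiableAt_id.prodMk mdifferentiableAt_const)
  have h_chart : writtenInExtChartAt 𝓘(ℝ, E₁) 𝓘(ℝ, E) a (fun a' ↦ ι (a', b)) =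
      fun s ↦ writtenInExtChartAt (𝓘(ℝ, E₁).prod 𝓘(ℝ, E₂)) 𝓘(ℝ, E) (a, b) ι
        (s, extChartAt 𝓘(ℝ, E₂) b b) := by
    ext s
    simp only [writtenInExtChartAt, extChartAt_prod, Function.comp_apply, PartialEquiv.prod_symm,
      PartialEquiv.prod_coe, extChartAt_to_inv]
  rw [ambientDeriv_eq_alongDeriv h_leaf, h_chart,
    alongDeriv_comp (j := fun s ↦ (s, extChartAt 𝓘(ℝ, E₂) b b)) (y := extChartAt 𝓘(ℝ, E₁) a a)
      (contDiffAt_writtenInExtChartAt hι (a, b)) (fun s ↦ hasFDerivAt_prodMk_left s _)]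
  exact (ambientDeriv_eq_alongDeriv h_mdiff _ _).symm

theorem ambientDeriv_vertical_leaf (v w : TangentSpace 𝓘(ℝ, E₂) b) :
    ambientDeriv E 𝓘(ℝ, E₂) (fun b' ↦ ι (a, b')) b v w =
      (ambientForm hι (a, b)).compl₁₂ (LinearMap.inr ℝ E₁ E₂) (LinearMap.inr ℝ E₁ E₂)
        (tangentCoord 𝓘(ℝ, E₂) b v) (tangentCoord 𝓘(ℝ, E₂) b w) := by
  have h_mdiff := hι.mdifferentiable (by simp) (a, b)
  have h_leaf : MDifferentiableAt 𝓘(ℝ, E₂) 𝓘(ℝ, E) (fun b' ↦ ι (a, b')) b :=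
    h_mdiff.comp b (mdifferentiableAt_const.prodMk mdifferentiableAt_id)
  have h_chart : writtenInExtChartAt 𝓘(ℝ, E₂) 𝓘(ℝ, E) b (fun b' ↦ ι (a, b')) =
      fun t ↦ writtenInExtChartAt (𝓘(ℝ, E₁).prod 𝓘(ℝ, E₂)) 𝓘(ℝ, E) (a, b) ι
        (extChartAt 𝓘(ℝ, E₁) a a, t) := by
    ext t
    simp only [writtenInExtChartAt, extChartAt_prod, Function.comp_apply, PartialEquiv.prod_symm,
      PartialEquiv.prod_coe, extChartAt_to_inv]
  rw [ambientDeriv_eq_alongDeriv h_leaf, h_chart,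
    alongDeriv_comp (j := fun t ↦ (extChartAt 𝓘(ℝ, E₁) a a, t)) (y := extChartAt 𝓘(ℝ, E₂) b b)
      (contDiffAt_writtenInExtChartAt hι (a, b)) (fun t ↦ hasFDerivAt_prodMk_right _ t)]
  exact (ambientDeriv_eq_alongDeriv h_mdiff _ _).symm

end LeafDerivatives

section LogGradient

variable {E₁ : Type*} [NormedAddCommGroup E₁] [NormedSpace ℝ E₁]
  {N₁ : Type*} [TopologicalSpace N₁] [ChartedSpace E₁ N₁]
  {E₂ : Type*} [NormedAddCommGroup E₂] [NormedSpace ℝ E₂]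
  {N₂ : Type*} [TopologicalSpace N₂] [ChartedSpace E₂ N₂] {f : N₁ → ℝ}

theorem mfderiv_log_fst (hf : ContMDiff 𝓘(ℝ, E₁) 𝓘(ℝ, ℝ) ∞ f) {a : N₁} (ha : f a ≠ 0) (b : N₂) :
    mfderiv (𝓘(ℝ, E₁).prod 𝓘(ℝ, E₂)) 𝓘(ℝ, ℝ) (fun p : N₁ × N₂ ↦ Real.log (f p.1)) (a, b) =
      (fderiv ℝ (chartWarping E₁ f a) (extChartAt 𝓘(ℝ, E₁) a a)).comp
        (ContinuousLinearMap.fst ℝ E₁ E₂) := by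
  have h_f : HasMFDerivAt 𝓘(ℝ, E₁) 𝓘(ℝ, ℝ) f a
      (fderiv ℝ (fun s ↦ f ((extChartAt 𝓘(ℝ, E₁) a).symm s)) (extChartAt 𝓘(ℝ, E₁) a a)) := by
    have h_diff := (contDiffAt_writtenInExtChartAt hf a).differentiableAt two_ne_zero
    refine ⟨hf.continuous.continuousAt, ?_⟩
    rw [ModelWithCorners.range_eq_univ]
    exact h_diff.hasFDerivAt.hasFDerivWithinAt
  have h_log := ((Real.hasDerivAt_log ha).hasFDerivAt.hasMFDerivAt.comp a h_f).comp (a, b)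
    (hasMFDerivAt_fst (I := 𝓘(ℝ, E₁)) (I' := 𝓘(ℝ, E₂)) (a, b))
  rw [(hasFDerivAt_chartWarping hf a).fderiv]
  refine h_log.mfderiv.trans ?_
  ext v
  exact mul_comm (fderiv ℝ (fun s ↦ f ((extChartAt 𝓘(ℝ, E₁) a).symm s)) _ v.1) (f a)⁻¹

variable {E : Type*} [NormedAddCommGroup E] [NormedSpace ℝ E] [FiniteDimensional ℝ E]
  {M : Type*} [TopologicalSpace M] [ChartedSpace E M]
  [RiemannianBundle (fun p : M ↦ TangentSpace 𝓘(ℝ, E) p)]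
  [RiemannianBundle (fun p : N₁ ↦ TangentSpace 𝓘(ℝ, E₁) p)]
  [RiemannianBundle (fun p : N₂ ↦ TangentSpace 𝓘(ℝ, E₂) p)]
  {ι : N₁ × N₂ → M}

theorem IsWarpedProductImmersion.exists_gradient_log (hM : IsWarpedProductImmersion E E₁ E₂ f ι)
    (a : N₁) (b : N₂) :
    ∃ g : E₁, (∀ x, fderiv ℝ (chartWarping E₁ f a) (extChartAt 𝓘(ℝ, E₁) a a) x =
        inner ℝ (coordDeriv E (𝓘(ℝ, E₁).prod 𝓘(ℝ, E₂)) ι (a, b) (g, 0))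
          (coordDeriv E (𝓘(ℝ, E₁).prod 𝓘(ℝ, E₂)) ι (a, b) (x, 0))) ∧
      gradNormSq E (𝓘(ℝ, E₁).prod 𝓘(ℝ, E₂)) ι (fun p ↦ Real.log (f p.1)) (a, b) =
        ‖coordDeriv E (𝓘(ℝ, E₁).prod 𝓘(ℝ, E₂)) ι (a, b) (g, 0)‖ ^ 2 := by
  set D := coordDeriv E (𝓘(ℝ, E₁).prod 𝓘(ℝ, E₂)) ι (a, b)
  obtain ⟨⟨g, t⟩, h_grad⟩ : ∃ w : E₁ × E₂, w = tangentCoord (𝓘(ℝ, E₁).prod 𝓘(ℝ, E₂)) (a, b)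
    (inducedGradient E (𝓘(ℝ, E₁).prod 𝓘(ℝ, E₂)) ι (fun p ↦ Real.log (f p.1)) (a, b)) := ⟨_, rfl⟩
  have h_inner (x : E₁) (z : E₂) : inner ℝ (D (g, t)) (D (x, z)) =
      fderiv ℝ (chartWarping E₁ f a) (extChartAt 𝓘(ℝ, E₁) a a) x := by
    have h := inducedInner_inducedGradient (hM.coordDeriv_injective (a, b))
      (fun p ↦ Real.log (f p.1)) ((tangentCoord _ _).symm (x, z))
    rw [mfderiv_log_fst hM.smooth_f (hM.f_pos a).ne'] at h
    rw [h_grad]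
    exact h
  have h_add : D (g, t) = D (g, 0) + D (0, t) := by
    rw [← map_add, Prod.mk_add_mk, add_zero, zero_add]
  -- `log f` does not depend on the second factor, so its gradient is horizontal
  have h_vertical : D (0, t) = 0 := by
    have h := h_inner 0 t
    rw [map_zero, h_add, inner_add_left, hM.inner_coordDeriv_inl_inr, zero_add] at h
    exact inner_self_eq_zero.mp h
  rw [h_vertical, add_zero] at h_add
  refine ⟨g, fun x ↦ ?_, ?_⟩
  · rw [← h_add, h_inner]
  · rw [← h_add, ← real_inner_self_eq_norm_sq, h_grad]
    rfl

end LogGradient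

section Inequality

variable {E : Type*} [NormedAddCommGroup E] [NormedSpace ℝ E] [FiniteDimensional ℝ E]
  {M : Type*} [TopologicalSpace M] [ChartedSpace E M] [IsManifold 𝓘(ℝ, E) ∞ M]
  [RiemannianBundle (fun p : M ↦ TangentSpace 𝓘(ℝ, E) p)]
  [IsContMDiffRiemannianBundle 𝓘(ℝ, E) ∞ E (fun p : M ↦ TangentSpace 𝓘(ℝ, E) p)]
  {E₁ : Type*} [NormedAddCommGroup E₁] [NormedSpace ℝ E₁]
  {N₁ : Type*} [TopologicalSpace N₁] [ChartedSpace E₁ N₁] [IsManifold 𝓘(ℝ, E₁) ∞ N₁]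
  [RiemannianBundle (fun p : N₁ ↦ TangentSpace 𝓘(ℝ, E₁) p)]
  {E₂ : Type*} [NormedAddCommGroup E₂] [NormedSpace ℝ E₂]
  {N₂ : Type*} [TopologicalSpace N₂] [ChartedSpace E₂ N₂] [IsManifold 𝓘(ℝ, E₂) ∞ N₂]
  [RiemannianBundle (fun p : N₂ ↦ TangentSpace 𝓘(ℝ, E₂) p)]
  {S : AlmostContactMetricStructure E M} {f : N₁ → ℝ} {ι : N₁ × N₂ → M} {θ : ℝ}

namespace IsWarpedProductInvariantSlant

variable (hM : IsWarpedProductInvariantSlant E E₁ E₂ S f ι θ) (hS : S.IsNearlyCosymplectic)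
  (a : N₁) (b : N₂)

include hS

theorem exists_nearlyCosymplecticPoint :
    ∃ P, NearlyCosymplecticPoint (coordDeriv E (𝓘(ℝ, E₁).prod 𝓘(ℝ, E₂)) ι (a, b))
      (ambientForm hM.smooth_ι (a, b))
      (fderiv ℝ (chartWarping E₁ f a) (extChartAt 𝓘(ℝ, E₁) a a) : E₁ →ₗ[ℝ] ℝ)
      (S.φ (ι (a, b))).toLinearMap (S.ξ (ι (a, b))) θ P := by
  have h_base : writtenInExtChartAt (𝓘(ℝ, E₁).prod 𝓘(ℝ, E₂)) 𝓘(ℝ, E) (a, b) ι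
      (extChartAt 𝓘(ℝ, E₁) a a, extChartAt 𝓘(ℝ, E₂) b b) =
        extChartAt 𝓘(ℝ, E) (ι (a, b)) (ι (a, b)) :=
    congrArg (extChartAt 𝓘(ℝ, E) (ι (a, b)) ∘ ι) (extChartAt_to_inv (a, b))
  have C := nearlyCosymplecticChart hS (ι (a, b))
  rw [← h_base] at C
  refine ⟨_, (hM.warpedChart a b).nearlyCosymplecticPoint C
    (tangentCoord 𝓘(ℝ, E) (ι (a, b))).symm.toLinearEquiv (fun v w ↦ ?metric)
    (coordDeriv_eq_fderiv (hM.mdifferentiableAt (a, b)))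
    (ambientDeriv_eq_alongDeriv (hM.mdifferentiableAt (a, b))) (fun v ↦ ?map) ?reeb
    (hM.coordDeriv_injective (a, b)) (hM.exists_map_horizontal a b) (hM.exists_reeb_eq a b)
    (hM.sin_ne_zero a)⟩
  case metric =>
    rw [h_base, chartMetric_self]
    rfl
  case map =>
    rw [h_base, chartMap_self]
    exact ((tangentCoord 𝓘(ℝ, E) (ι (a, b))).symm_apply_apply _).symm
  case reeb =>
    rw [h_base, coordRep_self]
    exact ((tangentCoord 𝓘(ℝ, E) (ι (a, b))).symm_apply_apply _).symm

include hM

variable [FiniteDimensional ℝ E₁] [FiniteDimensional ℝ E₂]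

theorem le_secondFundamentalFormNormSq :
    2 * Module.finrank ℝ E₂ * (1 / Real.sin θ) ^ 2 * (1 + 1 / 9 * Real.cos θ ^ 2) *
        gradNormSq E (𝓘(ℝ, E₁).prod 𝓘(ℝ, E₂)) ι (fun p ↦ Real.log (f p.1)) (a, b) ≤
      secondFundamentalFormNormSq E (𝓘(ℝ, E₁).prod 𝓘(ℝ, E₂)) ι (a, b) := by
  obtain ⟨P, H⟩ := hM.exists_nearlyCosymplecticPoint hS a b
  obtain ⟨g, hg, h_grad⟩ := hM.exists_gradient_log a b
  rw [h_grad, secondFundamentalFormNormSq_eq_sum (ambientDeriv_eq_ambientForm hM.smooth_ι (a, b))]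
  exact H.le_sum_norm_secondForm_sq (isFrame_orthonormalFrame (hM.coordDeriv_injective (a, b))) hg

section Equality

variable (h_eq : secondFundamentalFormNormSq E (𝓘(ℝ, E₁).prod 𝓘(ℝ, E₂)) ι (a, b) =
  2 * Module.finrank ℝ E₂ * (1 / Real.sin θ) ^ 2 * (1 + 1 / 9 * Real.cos θ ^ 2) *
    gradNormSq E (𝓘(ℝ, E₁).prod 𝓘(ℝ, E₂)) ι (fun p ↦ Real.log (f p.1)) (a, b))

include h_eq

theorem secondForm_eq_zero_of_eq :
    (∀ x y, secondForm (coordDeriv E (𝓘(ℝ, E₁).prod 𝓘(ℝ, E₂)) ι (a, b))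
      (ambientForm hM.smooth_ι (a, b)) (x, 0) (y, 0) = 0) ∧
    ∀ z w, secondForm (coordDeriv E (𝓘(ℝ, E₁).prod 𝓘(ℝ, E₂)) ι (a, b))
      (ambientForm hM.smooth_ι (a, b)) (0, z) (0, w) = 0 := by
  obtain ⟨P, H⟩ := hM.exists_nearlyCosymplecticPoint hS a b
  obtain ⟨g, hg, h_grad⟩ := hM.exists_gradient_log a b
  rw [h_grad, secondFundamentalFormNormSq_eq_sum
    (ambientDeriv_eq_ambientForm hM.smooth_ι (a, b))] at h_eq
  exact H.secondForm_eq_zero_of_sum_norm_sq_eq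
    (isFrame_orthonormalFrame (hM.coordDeriv_injective (a, b))) hg h_eq

theorem secondFundamentalForm_horizontal_leaf_eq_zero (v w : TangentSpace 𝓘(ℝ, E₁) a) :
    secondFundamentalForm E 𝓘(ℝ, E₁) (fun a' ↦ ι (a', b)) a v w = 0 := by
  obtain ⟨P, H⟩ := hM.exists_nearlyCosymplecticPoint hS a b
  rw [secondFundamentalForm_eq_secondForm (ambientDeriv_horizontal_leaf hM.smooth_ι a b),
    coordDeriv_horizontal_leaf (hM.mdifferentiableAt (a, b))]
  exact H.secondForm_inl_eq_zero ((hM.secondForm_eq_zero_of_eq hS a b h_eq).1 _ _)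

theorem exists_secondFundamentalForm_vertical_leaf_eq :
    ∃ K, ∀ v w, secondFundamentalForm E 𝓘(ℝ, E₂) (fun b' ↦ ι (a, b')) b v w =
      inducedInner E 𝓘(ℝ, E₂) (fun b' ↦ ι (a, b')) b v w • K := by
  obtain ⟨P, H⟩ := hM.exists_nearlyCosymplecticPoint hS a b
  obtain ⟨g, hg, -⟩ := hM.exists_gradient_log a b
  refine ⟨-coordDeriv E (𝓘(ℝ, E₁).prod 𝓘(ℝ, E₂)) ι (a, b) (g, 0), fun v w ↦ ?_⟩
  rw [secondFundamentalForm_eq_secondForm (ambientDeriv_vertical_leaf hM.smooth_ι a b),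
    inducedInner_eq_coordDeriv, coordDeriv_vertical_leaf (hM.mdifferentiableAt (a, b)), smul_neg]
  exact H.secondForm_inr_eq hg ((hM.secondForm_eq_zero_of_eq hS a b h_eq).2 _ _)

theorem meanCurvature_eq_zero_of_eq :
    meanCurvature E (𝓘(ℝ, E₁).prod 𝓘(ℝ, E₂)) ι (a, b) = 0 := by
  obtain ⟨P, H⟩ := hM.exists_nearlyCosymplecticPoint hS a b
  obtain ⟨h_horizontal, h_vertical⟩ := hM.secondForm_eq_zero_of_eq hS a b h_eq
  exact meanCurvature_eq_zero (ambientDeriv_eq_ambientForm hM.smooth_ι (a, b))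
    (H.sum_secondForm_self_eq_zero (isFrame_orthonormalFrame (hM.coordDeriv_injective (a, b)))
      h_horizontal h_vertical)

end Equality

end IsWarpedProductInvariantSlant

end Inequality

end WarpedSemiSlant

end

theorem theorem3p5_general
    {E : Type*} [NormedAddCommGroup E] [NormedSpace ℝ E] [FiniteDimensional ℝ E]
    {M : Type*} [TopologicalSpace M] [ChartedSpace E M] [IsManifold 𝓘(ℝ, E) ∞ M]
    [RiemannianBundle (fun p : M ↦ TangentSpace 𝓘(ℝ, E) p)]
    [IsContMDiffRiemannianBundle 𝓘(ℝ, E) ∞ E (fun p : M ↦ TangentSpace 𝓘(ℝ, E) p)]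
    {E₁ : Type*} [NormedAddCommGroup E₁] [NormedSpace ℝ E₁] [FiniteDimensional ℝ E₁]
    {NT : Type*} [TopologicalSpace NT] [ChartedSpace E₁ NT] [IsManifold 𝓘(ℝ, E₁) ∞ NT]
    [RiemannianBundle (fun p : NT ↦ TangentSpace 𝓘(ℝ, E₁) p)]
    {E₂ : Type*} [NormedAddCommGroup E₂] [NormedSpace ℝ E₂] [FiniteDimensional ℝ E₂]
    {Nθ : Type*} [TopologicalSpace Nθ] [ChartedSpace E₂ Nθ] [IsManifold 𝓘(ℝ, E₂) ∞ Nθ]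
    [RiemannianBundle (fun p : Nθ ↦ TangentSpace 𝓘(ℝ, E₂) p)]
    (S : WarpedSemiSlant.AlmostContactMetricStructure E M) (hS : S.IsNearlyCosymplectic)
    (f : NT → ℝ) (ι : NT × Nθ → M) (θ : ℝ)
    (hM : WarpedSemiSlant.IsWarpedProductInvariantSlant E E₁ E₂ S f ι θ) :
    (∀ x : NT × Nθ,
      WarpedSemiSlant.secondFundamentalFormNormSq E (𝓘(ℝ, E₁).prod 𝓘(ℝ, E₂)) ι x ≥
        2 * Module.finrank ℝ E₂ * (1 / Real.sin θ) ^ 2 * (1 + 1 / 9 * Real.cos θ ^ 2) *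
          WarpedSemiSlant.gradNormSq E (𝓘(ℝ, E₁).prod 𝓘(ℝ, E₂)) ι
            (fun p ↦ Real.log (f p.1)) x) ∧
    ((∀ x : NT × Nθ,
      WarpedSemiSlant.secondFundamentalFormNormSq E (𝓘(ℝ, E₁).prod 𝓘(ℝ, E₂)) ι x =
        2 * Module.finrank ℝ E₂ * (1 / Real.sin θ) ^ 2 * (1 + 1 / 9 * Real.cos θ ^ 2) *
          WarpedSemiSlant.gradNormSq E (𝓘(ℝ, E₁).prod 𝓘(ℝ, E₂)) ι
            (fun p ↦ Real.log (f p.1)) x) →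
      (∀ b, WarpedSemiSlant.IsTotallyGeodesic E 𝓘(ℝ, E₁) (fun a ↦ ι (a, b))) ∧
      (∀ a, WarpedSemiSlant.IsTotallyUmbilical E 𝓘(ℝ, E₂) (fun b ↦ ι (a, b))) ∧
      WarpedSemiSlant.IsMinimal E (𝓘(ℝ, E₁).prod 𝓘(ℝ, E₂)) ι) := by
  refine ⟨fun x ↦ hM.le_secondFundamentalFormNormSq hS x.1 x.2, fun h_eq ↦ ⟨?_, ?_, ?_⟩⟩
  · exact fun b a ↦ hM.secondFundamentalForm_horizontal_leaf_eq_zero hS a b (h_eq (a, b))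
  · exact fun a ↦ WarpedSemiSlant.isTotallyUmbilical_of_forall_exists
      fun b ↦ hM.exists_secondFundamentalForm_vertical_leaf_eq hS a b (h_eq (a, b))
  · exact fun x ↦ hM.meanCurvature_eq_zero_of_eq hS x.1 x.2 (h_eq x)

theorem theorem3p5
    {E : Type*} [NormedAddCommGroup E] [NormedSpace ℝ E] [FiniteDimensional ℝ E]
    {M : Type*} [TopologicalSpace M] [ChartedSpace E M] [IsManifold 𝓘(ℝ, E) ∞ M]
    [RiemannianBundle (fun p : M ↦ TangentSpace 𝓘(ℝ, E) p)]
    [IsContMDiffRiemannianBundle 𝓘(ℝ, E) ∞ E (fun p : M ↦ TangentSpace 𝓘(ℝ, E) p)]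
    {E₁ : Type*} [NormedAddCommGroup E₁] [NormedSpace ℝ E₁] [FiniteDimensional ℝ E₁]
    {NT : Type*} [TopologicalSpace NT] [ChartedSpace E₁ NT] [IsManifold 𝓘(ℝ, E₁) ∞ NT]
    [RiemannianBundle (fun p : NT ↦ TangentSpace 𝓘(ℝ, E₁) p)]
    [IsContMDiffRiemannianBundle 𝓘(ℝ, E₁) ∞ E₁ (fun p : NT ↦ TangentSpace 𝓘(ℝ, E₁) p)]
    {E₂ : Type*} [NormedAddCommGroup E₂] [NormedSpace ℝ E₂] [FiniteDimensional ℝ E₂]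
    {Nθ : Type*} [TopologicalSpace Nθ] [ChartedSpace E₂ Nθ] [IsManifold 𝓘(ℝ, E₂) ∞ Nθ]
    [RiemannianBundle (fun p : Nθ ↦ TangentSpace 𝓘(ℝ, E₂) p)]
    [IsContMDiffRiemannianBundle 𝓘(ℝ, E₂) ∞ E₂ (fun p : Nθ ↦ TangentSpace 𝓘(ℝ, E₂) p)]
    (S : WarpedSemiSlant.AlmostContactMetricStructure E M) (hS : S.IsNearlyCosymplectic)
    (f : NT → ℝ) (ι : NT × Nθ → M) (θ : ℝ)
    (hM : WarpedSemiSlant.IsWarpedProductSemiSlant E E₁ E₂ S f ι θ)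
    (q : ℕ) (hq : Module.finrank ℝ E₂ = 2 * q) :
    (∀ x : NT × Nθ,
      WarpedSemiSlant.secondFundamentalFormNormSq E (𝓘(ℝ, E₁).prod 𝓘(ℝ, E₂)) ι x ≥
        4 * q * (1 / Real.sin θ) ^ 2 * (1 + 1 / 9 * Real.cos θ ^ 2) *
          WarpedSemiSlant.gradNormSq E (𝓘(ℝ, E₁).prod 𝓘(ℝ, E₂)) ι
            (fun p ↦ Real.log (f p.1)) x) ∧
    ((∀ x : NT × Nθ,
      WarpedSemiSlant.secondFundamentalFormNormSq E (𝓘(ℝ, E₁).prod 𝓘(ℝ, E₂)) ι x =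
        4 * q * (1 / Real.sin θ) ^ 2 * (1 + 1 / 9 * Real.cos θ ^ 2) *
          WarpedSemiSlant.gradNormSq E (𝓘(ℝ, E₁).prod 𝓘(ℝ, E₂)) ι
            (fun p ↦ Real.log (f p.1)) x) →
      (∀ b, WarpedSemiSlant.IsTotallyGeodesic E 𝓘(ℝ, E₁) (fun a ↦ ι (a, b))) ∧
      (∀ a, WarpedSemiSlant.IsTotallyUmbilical E 𝓘(ℝ, E₂) (fun b ↦ ι (a, b))) ∧
      WarpedSemiSlant.IsMinimal E (𝓘(ℝ, E₁).prod 𝓘(ℝ, E₂)) ι) := by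
  have h_dim : (4 : ℝ) * q = 2 * Module.finrank ℝ E₂ := by rw [hq]; push_cast; ring
  rw [h_dim]
  exact theorem3p5_general S hS f ι θ hM.isWarpedProductInvariantSlant
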